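/- Let $p>0$ and let $h:[0,\infty)\to\mathbb R$ be a nonnegative $C^1$ function such that $h>0$ on $[t_0,\infty)$ for some $t_0>0$ and $$\lim_{t\to\infty}\frac{h'(t)}{t^{p-1}h(t)}=0 .$$ Put $f(t)=h(t)e^{t^p}$. For each $n\in\mathbb N$ let $\lambda_n>0$, $\mu_n\in\mathbb R$ and let $u_n$ be a classical solution of $$-u_n''-\tfrac1r u_n'=\lambda_n f(u_n),\quad u_n>0\ \text{ in }(0,1),\qquad u_n(0)=\mu_n,\quad u_n'(0)=0=u_n(1),$$ and assume $\mu_n\to\infty$. For $\beta>0$ let $U_\beta(r)=(\beta\log\frac1r)^{1/p}$, $r\in(0,1]$, and let $Z_I[v]\in\{0,1,2,\dots,\infty\}$ be the number of zeros of a function $v$ on $I$. *Constants (for $p>2$).* Let $a_0=2$, $\delta_0=1$, and for $k\ge1$ let $\delta_k\in(0,\delta_{k-1})$ and $a_k\in(0,2)$ be determined by $$\frac{2p}{2+a_{k-1}}\Bigl(1-\frac{\delta_k}{\delta_{k-1}}\Bigr)-1+\Bigl(\frac{\delta_k}{\delta_{k-1}}\Bigr)^p=0,\qquad a_k=2-\Bigl(\frac{\delta_k}{\delta_{k-1}}\Bigr)^{p-1}(2+a_{k-1}).$$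 For $k\ge0$ and $\delta\in[\delta_{k+1},\delta_k]$ put $$\beta_k(\delta)=\frac{2(2+a_k)(\delta/\delta_k)^p}{2+a_k-2p(1-\delta/\delta_k)},\qquad \delta_k^*=\Bigl(1-\frac{a_k}{2(p-1)}\Bigr)\delta_k,\qquad \beta_k^*=\beta_k(\delta_k^*).$$ *Centers.* Let $\gamma_{0,n}>0$ be given by $p\lambda_n\mu_n^{p-1}f(\mu_n)\gamma_{0,n}^2=1$ (for large $n$) and let $\phi_n(r)=p\lambda_nr^2u_n(r)^{p-1}f(u_n(r))$. Along a subsequence of $n$, *centers* are sequences $(r_{0,n})\subset(0,1)$ with $$r_{0,n}/\gamma_{0,n}\to2\sqrt2,\quad u_n(r_{0,n})/\mu_n\to1,\quad \phi_n(r_{0,n})\to2,$$ and, if $p>2$, also $(r_{k,n})\subset(0,1)$ for every $k\ge1$ with $$u_n(r_{k,n})/\mu_n\to\delta_k,\quad \phi_n(r_{k,n})\to a_k^2/2 .$$ Then, after passing to a subsequence, which is fixed once and for all, centers exist, and for every choice of centers the following holds. For every $\beta$ with $0<\beta<4/p$ if $p\le2$, and $0<\beta<2$ if $p>2$, $$Z_{(0,r_{0,n}]}[u_n-U_\beta]\ge1\quad\text{for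 all large }n.$$ (i) Let $0<p<1$. For every $\beta\ge4/p$ there is $\delta\in(0,1]$ with $4\delta^{p-1}/p=\beta$, and there is a sequence $(r_n)\subset(0,1)$ with $u_n(r_n)/\mu_n\to\delta$ and $u_n(r_n)=U_\beta(r_n)$ for all large $n$. In particular $Z_{(0,r_n]}[u_n-U_\beta]\ge1$ for all large $n$. (ii) Let $1<p\le2$. For every $0<\beta<4/p$ there is $\delta\in(0,1)$ with $4\delta^{p-1}/p=\beta$, and there is a sequence $(r_n)$ with $r_n\in(r_{0,n},1)$, $u_n(r_n)/\mu_n\to\delta$ and $u_n(r_n)=U_\beta(r_n)$ for all large $n$. In particular $Z_{(0,r_n]}[u_n-U_\beta]\ge2$ for all large $n$. (iii) Let $p>2$ and $k\in\mathbb N\cup\{0\}$. For every $\beta\in(\beta_k^*,2)$ there are $\delta,\delta'$ with $\delta_k>\delta>\delta_k^*>\delta'>\delta_{k+1}$ and $\beta_k(\delta)=\beta_k(\delta')=\beta$, and there are sequences $(r_n),(r_n')\subset(0,1)$ with $r_n,r_n'\in(r_{k,n},r_{k+1,n})$ for all large $n$, $u_n(r_n)/\mu_n\to\delta$, $u_n(r_n')/\mu_n\to\delta'$,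 and $u_n(r_n)=U_\beta(r_n)$, $u_n(r_n')=U_\beta(r_n')$ for all large $n$. In particular $$Z_{(0,r_n']}[u_n-U_\beta]\ge1+2(k+1)\quad\text{for all large }n.$$ -/

import Mathlib

open Filter Topology Set

namespace RadialExp

/-- The standing assumption on `h : [0, ∞) → ℝ` (values at negative reals are irrelevant):
`h` is nonnegative and `C¹` on `[0, ∞)`, and positive on some half-line `[t₀, ∞)`, `t₀ > 0`. -/
structure CondH0 (h : ℝ → ℝ) : Prop where
  contDiffOn : ContDiffOn ℝ 1 h (Ici 0)
  nonneg : ∀ t, 0 ≤ t → 0 ≤ h t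
  eventually_pos : ∃ t₀ : ℝ, 0 < t₀ ∧ ∀ t, t₀ ≤ t → 0 < h t

/-- The growth condition `h'(t) / (t ^ (p - 1) h(t)) → 0` as `t → ∞`. -/
def CondH1 (p : ℝ) (h : ℝ → ℝ) : Prop :=
  Tendsto (fun t : ℝ => deriv h t / (t ^ (p - 1) * h t)) atTop (𝓝 0)

/-- The nonlinearity `f(t) = h(t) exp(t ^ p)`. -/
noncomputable def nonlin (p : ℝ) (h : ℝ → ℝ) (t : ℝ) : ℝ := h t * Real.exp (t ^ p)

/-- `(lam, mu, u)` solves `-u'' - u'/r = lam f(u)`, `u > 0` in `(0, 1)`,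
`u(0) = mu`, `u'(0) = 0 = u(1)`, in the classical sense (`u'(0)` is the one-sided derivative;
only the values of `u` on `[0, 1]` matter). -/
structure IsSolution (p : ℝ) (h : ℝ → ℝ) (lam mu : ℝ) (u : ℝ → ℝ) : Prop where
  lam_pos : 0 < lam
  continuousOn : ContinuousOn u (Icc 0 1)
  differentiableAt : ∀ r ∈ Ioo (0 : ℝ) 1, DifferentiableAt ℝ u r
  differentiableAt_deriv : ∀ r ∈ Ioo (0 : ℝ) 1, DifferentiableAt ℝ (deriv u) r
  equation : ∀ r ∈ Ioo (0 : ℝ) 1,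
    -(deriv (deriv u) r) - (1 / r) * deriv u r = lam * nonlin p h (u r)
  pos : ∀ r ∈ Ioo (0 : ℝ) 1, 0 < u r
  at_zero : u 0 = mu
  deriv_zero : HasDerivWithinAt u 0 (Ici 0) 0
  at_one : u 1 = 0

/-- The comparison curve `U_β(r) = (β log (1/r)) ^ (1/p)`. -/
noncomputable def curveU (p β r : ℝ) : ℝ := (β * Real.log (1 / r)) ^ (1 / p)

/-- The number (possibly `∞`) of zeros of `v` on `I`. -/
noncomputable def zeroCount (I : Set ℝ) (v : ℝ → ℝ) : ℕ∞ := {r | r ∈ I ∧ v r = 0}.encard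

/-! ### The numbers attached to the bubbles (for `p > 2`) -/

/-- `x` is an admissible value of the ratio `δ_k / δ_{k-1}` when `a = a_{k-1}`. -/
def IsRatio (p a x : ℝ) : Prop :=
  x ∈ Ioo (0 : ℝ) 1 ∧ 2 * p / (2 + a) * (1 - x) - 1 + x ^ p = 0

/-- For `p > 2` and `0 < a ≤ 2` there is exactly one admissible ratio `x`, and the number
`2 - x ^ (p - 1) (2 + a)` derived from it lies in `(0, 2)`. -/
theorem existsUnique_isRatio {p a : ℝ} (hp : 2 < p) (ha : a ∈ Ioc (0 : ℝ) 2) :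
    (∃! x, IsRatio p a x) ∧
      ∀ x, IsRatio p a x → 2 - x ^ (p - 1) * (2 + a) ∈ Ioo (0 : ℝ) 2 := by
  obtain ⟨ha0, ha2⟩ := ha
  have h2a : 0 < 2 + a := by linarith
  set c := 2 * p / (2 + a) with hc
  have hcmul : c * (2 + a) = 2 * p := div_mul_cancel₀ _ h2a.ne'
  have hc1 : 1 < c := by rw [hc, lt_div_iff₀ h2a]; linarith
  have hcp : c < p := by rw [hc, div_lt_iff₀ h2a]; nlinarith
  -- strict tangent line inequality for `x ^ p`
  have tan : ∀ x y : ℝ, 0 < x → 0 < y → x ≠ y → x ^ p + p * x ^ (p - 1) * (y - x) < y ^ p := by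
    intro x y hx hy hxy
    have hb := one_add_mul_self_lt_rpow_one_add (s := y / x - 1) (p := p)
      (by have := div_pos hy hx; linarith)
      (fun h0 => hxy ((div_eq_one_iff_eq hx.ne').1 (by linarith)).symm) (by linarith)
    rw [show 1 + (y / x - 1) = y / x by ring, Real.div_rpow hy.le hx.le,
      lt_div_iff₀ (Real.rpow_pos_of_pos hx p)] at hb
    have hxp : x ^ p = x ^ (p - 1) * x := by
      rw [← Real.rpow_add_one hx.ne']; ring_nf
    calc _ = (1 + p * (y / x - 1)) * x ^ p := by rw [hxp]; field_simp
      _ < _ := hb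
  have hsmall : ∀ x, IsRatio p a x → p * x ^ (p - 1) < c := by
    rintro x ⟨⟨h0, h1⟩, he⟩
    have := tan x 1 h0 one_pos h1.ne
    rw [Real.one_rpow] at this
    have h3 : (p * x ^ (p - 1) - c) * (1 - x) < 0 := by linarith
    by_contra! hle
    nlinarith
  refine ⟨?_, ?_⟩
  · -- existence: the minimum point of the function gives a negative value
    obtain ⟨s, hs0, hs1, hs⟩ : ∃ s : ℝ, 0 < s ∧ s < 1 ∧ p * s ^ (p - 1) = c := by
      have hq : 0 < c / p := by positivity
      refine ⟨(c / p) ^ (1 / (p - 1)), by positivity, ?_, ?_⟩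
      · exact Real.rpow_lt_one hq.le ((div_lt_one (by linarith)).2 hcp)
          (one_div_pos.2 (by linarith))
      · rw [← Real.rpow_mul hq.le, one_div_mul_cancel (by linarith), Real.rpow_one]
        field_simp
    have hneg : c * (1 - s) - 1 + s ^ p < 0 := by
      have := tan s 1 hs0 one_pos hs1.ne
      rw [hs, Real.one_rpow] at this
      linarith
    have hcont : ContinuousOn (fun x : ℝ => c * (1 - x) - 1 + x ^ p) (Icc 0 s) :=
      ContinuousOn.add (by fun_prop) (Real.continuous_rpow_const (by linarith)).continuousOn
    obtain ⟨x, ⟨hx0, hxs⟩, hx⟩ := intermediate_value_Ioo' hs0.le hcont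
      (show (0 : ℝ) ∈ _ from ⟨hneg, by
        rw [Real.zero_rpow (by linarith)]; linarith⟩)
    have hxR : IsRatio p a x := ⟨⟨hx0, hxs.trans hs1⟩, hx⟩
    have key : ∀ y z, IsRatio p a y → IsRatio p a z → ¬ y < z := by
      rintro y z hy hz hlt
      have h1 := tan z y hz.1.1 hy.1.1 hlt.ne'
      have h2 := hsmall z hz
      have h3 := hy.2
      have h4 := hz.2
      nlinarith
    exact ⟨x, hxR, fun y hy => le_antisymm (not_lt.1 (key _ _ hxR hy)) (not_lt.1 (key _ _ hy hxR))⟩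
  · intro x hx
    have h1 := hsmall x hx
    have h2 : 0 < x ^ (p - 1) := Real.rpow_pos_of_pos hx.1.1 _
    refine ⟨?_, by nlinarith⟩
    have : p * x ^ (p - 1) * (2 + a) < p * 2 := by nlinarith
    nlinarith

/-- The unique `x ∈ (0, 1)` with `2p/(2+a) (1 - x) - 1 + x ^ p = 0`. -/
noncomputable def ratio (p a : ℝ) : ℝ := sSup {x | IsRatio p a x}

/-- The numbers `a_k`: `a_0 = 2`, `a_k = 2 - (δ_k/δ_{k-1}) ^ (p-1) (2 + a_{k-1})`. -/
noncomputable def aSeq (p : ℝ) : ℕ → ℝ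
  | 0 => 2
  | k + 1 => 2 - ratio p (aSeq p k) ^ (p - 1) * (2 + aSeq p k)

/-- The numbers `δ_k`: `δ_0 = 1`, and `δ_k / δ_{k-1}` is the ratio determined by `a_{k-1}`. -/
noncomputable def deltaSeq (p : ℝ) : ℕ → ℝ
  | 0 => 1
  | k + 1 => ratio p (aSeq p k) * deltaSeq p k

theorem isRatio_ratio {p a : ℝ} (hp : 2 < p) (ha : a ∈ Ioc (0 : ℝ) 2) :
    IsRatio p a (ratio p a) := by
  obtain ⟨x, hx, hu⟩ := (existsUnique_isRatio hp ha).1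
  have : {y | IsRatio p a y} = {x} := by
    ext y
    exact ⟨fun hy => hu y hy, fun hy => by rw [mem_singleton_iff.1 hy]; exact hx⟩
  rw [ratio, this, csSup_singleton]
  exact hx

theorem aSeq_mem {p : ℝ} (hp : 2 < p) (k : ℕ) : aSeq p k ∈ Ioc (0 : ℝ) 2 := by
  induction k with
  | zero => exact ⟨by norm_num [aSeq], le_refl _⟩
  | succ k ih =>
    have := (existsUnique_isRatio hp ih).2 _ (isRatio_ratio hp ih)
    exact ⟨this.1, this.2.le⟩

theorem deltaSeq_pos {p : ℝ} (hp : 2 < p) (k : ℕ) : 0 < deltaSeq p k := by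
  induction k with
  | zero => exact one_pos
  | succ k ih => exact mul_pos (isRatio_ratio hp (aSeq_mem hp k)).1.1 ih

/-- The two sequences satisfy their defining relations:
`δ_{k+1} ∈ (0, δ_k)`, `a_{k+1} ∈ (0, 2)`, and the two recurrence formulas. -/
theorem bubble_numbers_spec {p : ℝ} (hp : 2 < p) (k : ℕ) :
    deltaSeq p (k + 1) ∈ Ioo 0 (deltaSeq p k) ∧
      aSeq p (k + 1) ∈ Ioo (0 : ℝ) 2 ∧
      2 * p / (2 + aSeq p k) * (1 - deltaSeq p (k + 1) / deltaSeq p k) - 1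
        + (deltaSeq p (k + 1) / deltaSeq p k) ^ p = 0 ∧
      aSeq p (k + 1)
        = 2 - (deltaSeq p (k + 1) / deltaSeq p k) ^ (p - 1) * (2 + aSeq p k) := by
  have hd := deltaSeq_pos hp k
  have hx := isRatio_ratio hp (aSeq_mem hp k)
  have e : deltaSeq p (k + 1) / deltaSeq p k = ratio p (aSeq p k) :=
    mul_div_cancel_right₀ _ hd.ne'
  rw [e]
  exact ⟨⟨deltaSeq_pos hp _, by simpa [deltaSeq] using mul_lt_of_lt_one_left hd hx.1.2⟩,
    (existsUnique_isRatio hp (aSeq_mem hp k)).2 _ hx, hx.2, rfl⟩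

/-- The function `β_k(δ)`, used for `δ ∈ [δ_{k+1}, δ_k]`. -/
noncomputable def betaFun (p : ℝ) (k : ℕ) (δ : ℝ) : ℝ :=
  2 * (2 + aSeq p k) * (δ / deltaSeq p k) ^ p /
    (2 + aSeq p k - 2 * p * (1 - δ / deltaSeq p k))

/-- The minimum point `δ_k^*` of `β_k`. -/
noncomputable def deltaStar (p : ℝ) (k : ℕ) : ℝ :=
  (1 - aSeq p k / (2 * (p - 1))) * deltaSeq p k

/-- The minimum value `β_k^* = β_k(δ_k^*)`. -/
noncomputable def betaStar (p : ℝ) (k : ℕ) : ℝ := betaFun p k (deltaStar p k)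

/-! ### The centers of the bubbles -/

/-- The scale `γ_0 > 0` of the first bubble, `p lam mu ^ (p-1) f(mu) γ_0 ^ 2 = 1`. -/
noncomputable def gammaZero (p : ℝ) (h : ℝ → ℝ) (lam mu : ℝ) : ℝ :=
  (Real.sqrt (p * lam * mu ^ (p - 1) * nonlin p h mu))⁻¹

/-- The quantity `p lam r ^ 2 u(r) ^ (p-1) f(u(r))`. -/
noncomputable def phi (p : ℝ) (h : ℝ → ℝ) (lam : ℝ) (u : ℝ → ℝ) (r : ℝ) : ℝ :=
  p * lam * r ^ 2 * u r ^ (p - 1) * nonlin p h (u r)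

/-- `r k n` is (the `n`-th term of) a sequence `(r_{k,n})_n` of centers of the `(k+1)`-th bubble
of the solutions `(lam n, mu n, u n)`. If `p ≤ 2` only `k = 0` is meaningful
(`r k` is then unconstrained for `k ≥ 1`); if `p > 2` all `k` are. -/
structure IsCenters (p : ℝ) (h : ℝ → ℝ) (lam mu : ℕ → ℝ) (u : ℕ → ℝ → ℝ)
    (r : ℕ → ℕ → ℝ) : Prop where
  first_mem : ∀ n, r 0 n ∈ Ioo (0 : ℝ) 1
  first_scale :
    Tendsto (fun n => r 0 n / gammaZero p h (lam n) (mu n)) atTop (𝓝 (2 * Real.sqrt 2))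
  first_height : Tendsto (fun n => u n (r 0 n) / mu n) atTop (𝓝 1)
  first_phi : Tendsto (fun n => phi p h (lam n) (u n) (r 0 n)) atTop (𝓝 2)
  mem : 2 < p → ∀ k, 1 ≤ k → ∀ n, r k n ∈ Ioo (0 : ℝ) 1
  height : 2 < p → ∀ k, 1 ≤ k →
    Tendsto (fun n => u n (r k n) / mu n) atTop (𝓝 (deltaSeq p k))
  phi_lim : 2 < p → ∀ k, 1 ≤ k →
    Tendsto (fun n => phi p h (lam n) (u n) (r k n)) atTop (𝓝 (aSeq p k ^ 2 / 2))

end RadialExp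

namespace RadialExp

/-! With t = log(1/r) and v(t) = u(e^{-t}) the equation becomes v'' = -λ e^{-2t} f(v). Thus v is
concave and nondecreasing, and u = U_β at r exactly when v^p = βt. Everything about crossings
therefore follows from the limit L(y) of t/μ^p at a given relative height y = v/μ: crossings sit
where y^p - β L(y) changes sign.

Three rescaled quantities are followed: the time σ = (t - (log λ)/2)/μ^p, the slope b = μ^{p-1} v'
and a potential ψ. With κ(y) = (2/p) y^{1-p} they satisfy b' = -p y^{p-1} ψ, (b²/2 + ψ)' ≈ κ(y) b'
and log ψ = (y^p - 2σ + o(1)) μ^p, and in the limit dy/dσ = b. Since ψ is bounded, y^p ≤ 2σ in the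
limit. Where this is strict, ψ is exponentially small, so b is constant and σ is affine in y. Where
the line 2σ meets y^p, at a height δ, the slope may jump from c (above δ) to B (below δ). The energy
law gives B² - c² = 2κ(δ)(B - c), so B = c or B = 2κ(δ) - c; the constraint y^p ≤ 2σ forces B ≥ κ(δ)
> c, which leaves the reflection B = 2κ(δ) - c. Starting from c = 0 at y = 1 one gets B = 4/p. For p
≤ 2 the resulting line stays above y^p on (0,1); for p > 2 it meets y^p again at δ_1, and iterating
produces exactly the recursion for δ_k and a_k.

The limits are taken along ultrafilters. Each limit is a `Profile`, and a profile is determined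
uniquely, so the whole sequence converges and no genuine subsequence is needed. The limit of log λ /
μ^p comes from 0 < t ≤ v/v' at small relative heights. The first center requires an analysis on the
scale t = O(1) around log(1/γ_0), where b²/(ψ e^{-2t}) is almost conserved; the later centers are
points where b = κ(δ_k).

The argument rests on `LogSol.hasDerivAt_energy`, `Profile.reflection`, `Profile.affine_extension`,
`Family.exists_profile`, `Family.tendsto_log_lam`, `Family.eventually_liouville` and
`Family.eventually_cross_of_sign`. -/

/-! ### Growth of the nonlinearity -/

/-- The relative error in `(f(s) / (p s ^ (p - 1)))' ≈ f(s)`. -/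
noncomputable def relErr (p : ℝ) (h : ℝ → ℝ) (s : ℝ) : ℝ :=
  deriv h s / (s ^ (p - 1) * h s) / p - (p - 1) / (p * s ^ p)

/-- The approximate primitive `f(s) / (p s ^ (p - 1))` of `f`. -/
noncomputable def approxPrim (p : ℝ) (h : ℝ → ℝ) (s : ℝ) : ℝ := nonlin p h s / (p * s ^ (p - 1))

theorem tendsto_relErr {p : ℝ} (hp : 0 < p) {h : ℝ → ℝ} (hH1 : CondH1 p h) :
    Tendsto (relErr p h) atTop (𝓝 0) := by
  have h1 : Tendsto (fun s : ℝ => (p - 1) / (p * s ^ p)) atTop (𝓝 0) :=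
    Tendsto.const_div_atTop ((tendsto_rpow_atTop hp).const_mul_atTop hp) _
  have h2 := (Tendsto.div_const hH1 p).sub h1
  rw [zero_div, sub_zero] at h2
  exact h2

theorem CondH0.hasDerivAt {h : ℝ → ℝ} (hH0 : CondH0 h) {s : ℝ} (hs : 0 < s) :
    HasDerivAt h (deriv h s) s :=
  ((hH0.contDiffOn.differentiableOn (by norm_num)) s hs.le).differentiableAt
    (Ici_mem_nhds hs) |>.hasDerivAt

theorem hasDerivAt_nonlin {p : ℝ} {h : ℝ → ℝ} (hH0 : CondH0 h) {s : ℝ} (hs : 0 < s) :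
    HasDerivAt (nonlin p h)
      (deriv h s * Real.exp (s ^ p) + h s * (Real.exp (s ^ p) * (p * s ^ (p - 1)))) s :=
  (hH0.hasDerivAt hs).mul ((Real.hasDerivAt_rpow_const (Or.inl hs.ne')).exp)

theorem hasDerivAt_approxPrim {p : ℝ} (hp : 0 < p) {h : ℝ → ℝ} (hH0 : CondH0 h) {s : ℝ}
    (hs : 0 < s) (hh : 0 < h s) :
    HasDerivAt (approxPrim p h) (nonlin p h s * (1 + relErr p h s)) s := by
  have h1 := (hasDerivAt_nonlin (p := p) hH0 hs).div
    ((Real.hasDerivAt_rpow_const (p := p - 1) (Or.inl hs.ne')).const_mul p) (by positivity)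
  refine h1.congr_deriv ?_
  have e1 : s ^ p = s ^ (p - 1) * s := by rw [← Real.rpow_add_one hs.ne']; ring_nf
  have e2 : s ^ (p - 1) = s ^ (p - 1 - 1) * s := by rw [← Real.rpow_add_one hs.ne']; ring_nf
  have h2 : 0 < s ^ (p - 1 - 1) := by positivity
  unfold relErr nonlin
  generalize Real.exp (s ^ p) = E
  rw [e1, e2]
  field_simp
  ring

/-- Integrating |h'/h| ≤ (ε/2) p s^{p-1} from N bounds |log h(s) - log h(N)| by (ε/2)(s^p - N^p),
and the constant log h(N) is absorbed for large s. Hence h does not affect the exponent s^p to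
leading order. -/
theorem tendsto_log_div_rpow {p : ℝ} (hp : 0 < p) {h : ℝ → ℝ} (hH0 : CondH0 h)
    (hH1 : CondH1 p h) : Tendsto (fun s => Real.log (h s) / s ^ p) atTop (𝓝 0) := by
  obtain ⟨t₀, ht₀, hpos⟩ := hH0.eventually_pos
  rw [Metric.tendsto_nhds]
  intro ε hε
  obtain ⟨M, hM⟩ := eventually_atTop.1 ((Metric.tendsto_nhds.1 hH1) (p * (ε / 2)) (by positivity))
  set N := max M t₀ with hN
  have hN0 : 0 < N := lt_of_lt_of_le ht₀ (le_max_right _ _)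
  have hbd : ∀ s, N ≤ s → |deriv h s / h s| ≤ ε / 2 * (p * s ^ (p - 1)) := by
    intro s hs
    have hs0 : 0 < s := hN0.trans_le hs
    have h1 := (hM s ((le_max_left _ _).trans hs)).le
    rw [Real.dist_eq, sub_zero] at h1
    have h2 : 0 < s ^ (p - 1) := by positivity
    have h3 := hpos s ((le_max_right _ _).trans hs)
    have e : deriv h s / h s = deriv h s / (s ^ (p - 1) * h s) * s ^ (p - 1) := by field_simp
    rw [e, abs_mul, abs_of_pos h2]
    nlinarith
  have hd : ∀ s, N ≤ s → HasDerivAt (fun s => Real.log (h s)) (deriv h s / h s) s := fun s hs =>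
    (hH0.hasDerivAt (hN0.trans_le hs)).log (hpos s ((le_max_right _ _).trans hs)).ne'
  have hr : ∀ s, N ≤ s → HasDerivAt (fun s : ℝ => ε / 2 * s ^ p) (ε / 2 * (p * s ^ (p - 1))) s :=
    fun s hs => (Real.hasDerivAt_rpow_const (Or.inl (hN0.trans_le hs).ne')).const_mul _
  have mono : ∀ g g' : ℝ → ℝ, (∀ s, N ≤ s → HasDerivAt g (g' s) s) → (∀ s, N ≤ s → 0 ≤ g' s) →
      ∀ s, N ≤ s → g N ≤ g s := by
    intro g g' hg hg' s hs
    refine monotoneOn_of_deriv_nonneg (convex_Ici N)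
      (fun x hx => (hg x hx).continuousAt.continuousWithinAt)
      (fun x hx => (hg x (interior_subset hx)).differentiableAt.differentiableWithinAt)
      (fun x hx => ?_) (mem_Ici.2 le_rfl) hs hs
    rw [(hg x (interior_subset hx)).deriv]
    exact hg' x (interior_subset hx)
  have m1 := mono _ _ (fun s hs => (hr s hs).add (hd s hs))
    (fun s hs => by linarith [(abs_le.1 (hbd s hs)).1])
  have m2 := mono _ _ (fun s hs => (hr s hs).sub (hd s hs))
    (fun s hs => by linarith [(abs_le.1 (hbd s hs)).2])
  have hlarge := (tendsto_rpow_atTop hp).eventually_gt_atTop (|Real.log (h N)| / (ε / 2))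
  filter_upwards [hlarge, eventually_ge_atTop N] with s h1 h2
  have hs0 : 0 < s := hN0.trans_le h2
  have hsp : 0 < s ^ p := by positivity
  have hNp : 0 < N ^ p := by positivity
  rw [div_lt_iff₀ (by positivity)] at h1
  have m1' := m1 s h2
  have m2' := m2 s h2
  simp only [Pi.add_apply, Pi.sub_apply] at m1' m2'
  rw [Real.dist_eq, sub_zero, abs_div, abs_of_pos hsp, div_lt_iff₀ hsp, abs_lt]
  have h3 := abs_le.1 (le_refl |Real.log (h N)|)
  constructor <;> nlinarith [mul_pos hε hNp]

theorem tendsto_nonlin {p : ℝ} (hp : 0 < p) {h : ℝ → ℝ} (hH0 : CondH0 h)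
    (hH1 : CondH1 p h) : Tendsto (nonlin p h) atTop atTop := by
  obtain ⟨t₀, ht₀, hpos⟩ := hH0.eventually_pos
  have h1 : Tendsto (fun s => (Real.log (h s) / s ^ p + 1) * s ^ p) atTop atTop :=
    Tendsto.pos_mul_atTop one_pos
      (by simpa using (tendsto_log_div_rpow hp hH0 hH1).add_const 1) (tendsto_rpow_atTop hp)
  refine (Real.tendsto_exp_atTop.comp h1).congr' ?_
  filter_upwards [eventually_ge_atTop t₀] with s hs
  have hs0 : 0 < s := ht₀.trans_le hs
  have : s ^ p ≠ 0 := by positivity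
  simp only [Function.comp, nonlin]
  rw [add_mul, div_mul_cancel₀ _ this, one_mul, Real.exp_add, Real.exp_log (hpos s hs)]

theorem CondH0.continuousOn_nonlin {p : ℝ} (hp : 0 < p) {h : ℝ → ℝ} (hH0 : CondH0 h) :
    ContinuousOn (nonlin p h) (Ici 0) :=
  hH0.contDiffOn.continuousOn.mul
    (Real.continuous_exp.comp (Real.continuous_rpow_const hp.le)).continuousOn

theorem nonlin_nonneg {p : ℝ} {h : ℝ → ℝ} (hH0 : CondH0 h) {s : ℝ} (hs : 0 ≤ s) :
    0 ≤ nonlin p h s := mul_nonneg (hH0.nonneg s hs) (Real.exp_pos _).le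

/-- For large `s`, `f(s)` is the maximum of `f` on `[0, s]`. -/
theorem eventually_nonlin_le {p : ℝ} (hp : 0 < p) {h : ℝ → ℝ} (hH0 : CondH0 h)
    (hH1 : CondH1 p h) :
    ∀ᶠ s in atTop, ∀ x ∈ Icc 0 s, nonlin p h x ≤ nonlin p h s := by
  obtain ⟨t₀, ht₀, hpos⟩ := hH0.eventually_pos
  obtain ⟨M, hM⟩ := eventually_atTop.1 ((Metric.tendsto_nhds.1 hH1) p hp)
  set N := max M t₀ with hN
  have hN0 : 0 < N := lt_of_lt_of_le ht₀ (le_max_right _ _)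
  have hmono : MonotoneOn (nonlin p h) (Ici N) := by
    refine monotoneOn_of_deriv_nonneg (convex_Ici N)
      (fun x hx => (hasDerivAt_nonlin hH0 (hN0.trans_le hx)).continuousAt.continuousWithinAt)
      (fun x hx => (hasDerivAt_nonlin hH0 (hN0.trans_le
        (interior_subset hx))).differentiableAt.differentiableWithinAt)
      (fun s hs => ?_)
    have hs := interior_subset hs
    have hs0 : 0 < s := hN0.trans_le hs
    rw [(hasDerivAt_nonlin hH0 hs0).deriv]
    have h1 := (hM s ((le_max_left _ _).trans hs)).le
    rw [Real.dist_eq, sub_zero] at h1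
    have h2 : 0 < s ^ (p - 1) := by positivity
    have h3 := hpos s ((le_max_right _ _).trans hs)
    have e : deriv h s = deriv h s / (s ^ (p - 1) * h s) * (s ^ (p - 1) * h s) := by field_simp
    have h4 : 0 ≤ deriv h s + h s * (p * s ^ (p - 1)) := by
      rw [e]; nlinarith [(abs_le.1 h1).1, mul_pos h2 h3]
    have := mul_nonneg h4 (Real.exp_pos (s ^ p)).le
    linarith
  obtain ⟨C, hC⟩ := (isCompact_Icc (a := (0 : ℝ)) (b := N)).bddAbove_image
    ((hH0.continuousOn_nonlin hp).mono Icc_subset_Ici_self)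
  filter_upwards [(tendsto_nonlin hp hH0 hH1).eventually_ge_atTop C, eventually_ge_atTop N]
    with s h1 h2 x hx
  rcases le_total x N with h | h
  · exact (hC (mem_image_of_mem _ ⟨hx.1, h⟩)).trans h1
  · exact hmono h h2 hx.2

/-! ### The equation in logarithmic radius and its energy law -/

theorem monotoneOn_of_hasDerivAt {s : Set ℝ} (hs : Convex ℝ s) {g g' : ℝ → ℝ}
    (hg : ∀ t ∈ s, HasDerivAt g (g' t) t) (hg' : ∀ t ∈ s, 0 ≤ g' t) : MonotoneOn g s :=
  monotoneOn_of_deriv_nonneg hs (fun t ht => (hg t ht).continuousAt.continuousWithinAt)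
    (fun t ht => (hg t (interior_subset ht)).differentiableAt.differentiableWithinAt)
    (fun t ht => by rw [(hg t (interior_subset ht)).deriv]; exact hg' t (interior_subset ht))

theorem antitoneOn_of_hasDerivAt {s : Set ℝ} (hs : Convex ℝ s) {g g' : ℝ → ℝ}
    (hg : ∀ t ∈ s, HasDerivAt g (g' t) t) (hg' : ∀ t ∈ s, g' t ≤ 0) : AntitoneOn g s :=
  antitoneOn_of_deriv_nonpos hs (fun t ht => (hg t ht).continuousAt.continuousWithinAt)
    (fun t ht => (hg t (interior_subset ht)).differentiableAt.differentiableWithinAt)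
    (fun t ht => by rw [(hg t (interior_subset ht)).deriv]; exact hg' t (interior_subset ht))

/-- The radial problem in the variable `t = log (1 / r)`: `v(t) = u(exp (-t))`, `w = v'`. -/
structure LogSol (p : ℝ) (h : ℝ → ℝ) (lam mu : ℝ) (v w : ℝ → ℝ) : Prop where
  lam_pos : 0 < lam
  hasDerivAt : ∀ t, 0 < t → HasDerivAt v (w t) t
  hasDerivAt_slope : ∀ t, 0 < t →
    HasDerivAt w (-(lam * Real.exp (-(2 * t)) * nonlin p h (v t))) t
  tendsto_top : Tendsto v atTop (𝓝 mu)
  pos : ∀ t, 0 < t → 0 < v t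
  tendsto_zero : Tendsto v (𝓝[>] 0) (𝓝 0)

/-- The substitution r = e^{-t} absorbs the first-order term u'/r, because u'' + u'/r = r^{-2} (r
d/dr)² u. -/
theorem IsSolution.logSol {p : ℝ} {h : ℝ → ℝ} {lam mu : ℝ} {u : ℝ → ℝ}
    (S : IsSolution p h lam mu u) :
    LogSol p h lam mu (fun t => u (Real.exp (-t)))
      (fun t => -(Real.exp (-t) * deriv u (Real.exp (-t)))) := by
  have hmem : ∀ t : ℝ, 0 < t → Real.exp (-t) ∈ Ioo (0 : ℝ) 1 := fun t ht =>
    ⟨Real.exp_pos _, by rw [Real.exp_lt_one_iff]; linarith⟩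
  have hexp : ∀ t : ℝ, HasDerivAt (fun t : ℝ => Real.exp (-t)) (-Real.exp (-t)) t := fun t => by
    simpa using (hasDerivAt_neg t).exp
  refine ⟨S.lam_pos, fun t ht => ?_, fun t ht => ?_, ?_, fun t ht => S.pos _ (hmem t ht), ?_⟩
  · have := (S.differentiableAt _ (hmem t ht)).hasDerivAt.comp t (hexp t)
    exact this.congr_deriv (by ring)
  · have h1 := (S.differentiableAt_deriv _ (hmem t ht)).hasDerivAt.comp t (hexp t)
    have h2 := ((hexp t).mul h1).neg
    refine h2.congr_deriv ?_
    have he := S.equation _ (hmem t ht)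
    have e2 : Real.exp (-(2 * t)) = Real.exp (-t) * Real.exp (-t) := by
      rw [← Real.exp_add]; ring_nf
    have hne := (Real.exp_pos (-t)).ne'
    simp only [Function.comp]
    rw [e2]
    field_simp at he
    linear_combination -Real.exp (-t) * he
  · have h1 : Tendsto (fun t : ℝ => Real.exp (-t)) atTop (𝓝[Icc 0 1] 0) := by
      refine tendsto_nhdsWithin_iff.2 ⟨Real.tendsto_exp_neg_atTop_nhds_zero, ?_⟩
      filter_upwards [eventually_gt_atTop 0] with t ht
      exact Ioo_subset_Icc_self (hmem t ht)
    have h2 : Tendsto u (𝓝[Icc 0 1] 0) (𝓝 (u 0)) := S.continuousOn 0 (by simp)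
    rw [S.at_zero] at h2
    exact h2.comp h1
  · have h1 : Tendsto (fun t : ℝ => Real.exp (-t)) (𝓝[>] 0) (𝓝[Icc 0 1] 1) := by
      refine tendsto_nhdsWithin_iff.2 ⟨?_, ?_⟩
      · have : Tendsto (fun t : ℝ => Real.exp (-t)) (𝓝 0) (𝓝 (Real.exp (-0))) :=
          (hexp 0).continuousAt
        rw [neg_zero, Real.exp_zero] at this
        exact this.mono_left nhdsWithin_le_nhds
      · filter_upwards [self_mem_nhdsWithin] with t ht
        exact Ioo_subset_Icc_self (hmem t ht)
    have h2 : Tendsto u (𝓝[Icc 0 1] 1) (𝓝 (u 1)) := S.continuousOn 1 (by simp)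
    rw [S.at_one] at h2
    exact h2.comp h1

/-- The rescaled slope `mu ^ (p - 1) v'`. -/
noncomputable def scaledSlope (p mu : ℝ) (w : ℝ → ℝ) (t : ℝ) : ℝ := mu ^ (p - 1) * w t

/-- The rescaled potential energy. -/
noncomputable def potential (p : ℝ) (h : ℝ → ℝ) (lam mu : ℝ) (v : ℝ → ℝ) (t : ℝ) : ℝ :=
  (mu ^ (p - 1)) ^ 2 * (lam * Real.exp (-(2 * t)) * approxPrim p h (v t))

/-- The function `κ(y) = (2 / p) y ^ (1 - p)`. -/
noncomputable def kap (p y : ℝ) : ℝ := 2 / p * y ^ (1 - p)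

namespace LogSol

variable {p : ℝ} {h : ℝ → ℝ} {lam mu : ℝ} {v w : ℝ → ℝ}

theorem antitoneOn_slope (S : LogSol p h lam mu v w) (hH0 : CondH0 h) :
    AntitoneOn w (Ioi 0) :=
  antitoneOn_of_hasDerivAt (convex_Ioi 0) (fun t ht => S.hasDerivAt_slope t ht) fun t ht => by
    have h1 := nonlin_nonneg (p := p) hH0 (S.pos t ht).le
    have h2 := mul_nonneg (mul_pos S.lam_pos (Real.exp_pos (-(2 * t)))).le h1
    linarith

theorem sub_le (S : LogSol p h lam mu v w) (hH0 : CondH0 h) {t₁ t₂ : ℝ} (h1 : 0 < t₁)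
    (h12 : t₁ ≤ t₂) : v t₂ - v t₁ ≤ w t₁ * (t₂ - t₁) := by
  have := antitoneOn_of_hasDerivAt (s := Ici t₁) (convex_Ici _)
    (g := fun t => v t - w t₁ * t) (g' := fun t => w t - w t₁)
    (fun t ht => ((S.hasDerivAt t (h1.trans_le ht)).sub ((hasDerivAt_id t).const_mul (w t₁))).congr_deriv
      (by ring))
    (fun t ht => by
      have := S.antitoneOn_slope hH0 (mem_Ioi.2 h1) (mem_Ioi.2 (h1.trans_le ht)) ht
      linarith) (mem_Ici.2 le_rfl) (mem_Ici.2 h12) h12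
  simp only at this
  linarith

theorem le_sub (S : LogSol p h lam mu v w) (hH0 : CondH0 h) {t₁ t₂ : ℝ} (h1 : 0 < t₁)
    (h12 : t₁ ≤ t₂) : w t₂ * (t₂ - t₁) ≤ v t₂ - v t₁ := by
  have := monotoneOn_of_hasDerivAt (s := Icc t₁ t₂) (convex_Icc _ _)
    (g := fun t => v t - w t₂ * t) (g' := fun t => w t - w t₂)
    (fun t ht => ((S.hasDerivAt t (h1.trans_le ht.1)).sub
      ((hasDerivAt_id t).const_mul (w t₂))).congr_deriv (by ring))
    (fun t ht => by
      have := S.antitoneOn_slope hH0 (mem_Ioi.2 (h1.trans_le ht.1))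
        (mem_Ioi.2 (h1.trans_le h12)) ht.2
      linarith) (left_mem_Icc.2 h12) (right_mem_Icc.2 h12) h12
  simp only at this
  linarith

/-- A concave function with a negative slope somewhere would become negative in finite time. -/
theorem slope_nonneg (S : LogSol p h lam mu v w) (hH0 : CondH0 h) {t : ℝ} (ht : 0 < t) :
    0 ≤ w t := by
  by_contra! hneg
  have hpos : 0 < v t / (-w t) := div_pos (S.pos t ht) (by linarith)
  have h1 := S.sub_le hH0 ht (t₂ := t + v t / (-w t)) (by linarith)
  have h2 := S.pos (t + v t / (-w t)) (by linarith)
  have e : w t * (t + v t / (-w t) - t) = - v t := by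
    have : w t ≠ 0 := hneg.ne
    field_simp
    ring
  rw [e] at h1
  linarith

theorem monotoneOn (S : LogSol p h lam mu v w) (hH0 : CondH0 h) : MonotoneOn v (Ioi 0) :=
  monotoneOn_of_hasDerivAt (convex_Ioi 0) (fun t ht => S.hasDerivAt t ht)
    fun _ ht => S.slope_nonneg hH0 ht

theorem le_top (S : LogSol p h lam mu v w) (hH0 : CondH0 h) {t : ℝ} (ht : 0 < t) :
    v t ≤ mu := by
  refine ge_of_tendsto S.tendsto_top ?_
  filter_upwards [eventually_ge_atTop t] with s hs
  exact S.monotoneOn hH0 ht (mem_Ioi.2 (ht.trans_le hs)) hs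

theorem mu_pos (S : LogSol p h lam mu v w) (hH0 : CondH0 h) : 0 < mu :=
  (S.pos 1 one_pos).trans_le (S.le_top hH0 one_pos)

/-- The chord inequality for the concave v, with the left endpoint sent to 0 where v vanishes. It is
the only place where the boundary condition u(1) = 0 enters, and it later bounds absolute times. -/
theorem mul_slope_le (S : LogSol p h lam mu v w) (hH0 : CondH0 h) {t : ℝ} (ht : 0 < t) :
    w t * t ≤ v t := by
  have h1 : Tendsto (fun s => w t * (t - s)) (𝓝[>] 0) (𝓝 (w t * (t - 0))) := by
    refine Tendsto.mono_left (Continuous.tendsto (by fun_prop) 0) nhdsWithin_le_nhds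
  have h2 : Tendsto (fun s => v t - v s) (𝓝[>] 0) (𝓝 (v t - 0)) :=
    tendsto_const_nhds.sub S.tendsto_zero
  rw [sub_zero] at h1 h2
  refine le_of_tendsto_of_tendsto h1 h2 ?_
  filter_upwards [Ioc_mem_nhdsGT ht] with s hs
  exact S.le_sub hH0 hs.1 hs.2

theorem tendsto_slope (S : LogSol p h lam mu v w) (hH0 : CondH0 h) :
    Tendsto w atTop (𝓝 0) := by
  refine squeeze_zero' (g := fun t : ℝ => mu / t) ?_ ?_
    (Tendsto.const_div_atTop tendsto_id _)
  · filter_upwards [eventually_gt_atTop 0] with t ht using S.slope_nonneg hH0 ht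
  · filter_upwards [eventually_gt_atTop 0] with t ht
    rw [le_div_iff₀ ht]
    exact (S.mul_slope_le hH0 ht).trans (S.le_top hH0 ht)

theorem exists_height (S : LogSol p h lam mu v w) (hH0 : CondH0 h) {y : ℝ}
    (hy : y ∈ Ioo (0 : ℝ) 1) : ∃ t, 0 < t ∧ v t = y * mu := by
  have hmu := S.mu_pos hH0
  obtain ⟨a, ha, ha0⟩ : ∃ a, v a < y * mu ∧ 0 < a :=
    ((S.tendsto_zero.eventually_lt_const (mul_pos hy.1 hmu)).and self_mem_nhdsWithin).exists
  obtain ⟨b, hb, hb0⟩ : ∃ b, y * mu < v b ∧ a ≤ b :=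
    ((S.tendsto_top.eventually_const_lt (by nlinarith [hy.2])).and (eventually_ge_atTop a)).exists
  obtain ⟨t, ht, e⟩ := intermediate_value_Icc hb0
    (fun s hs => (S.hasDerivAt s (ha0.trans_le hs.1)).continuousAt.continuousWithinAt)
    (show y * mu ∈ Icc (v a) (v b) from ⟨ha.le, hb.le⟩)
  exact ⟨t, ha0.trans_le ht.1, e⟩

theorem lt_of_height_lt (S : LogSol p h lam mu v w) (hH0 : CondH0 h) {t₁ t₂ : ℝ}
    (h1 : 0 < t₁) (h2 : 0 < t₂) (hv : v t₁ < v t₂) : t₁ < t₂ := by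
  by_contra! hle
  exact absurd (S.monotoneOn hH0 h2 h1 hle) (not_le.2 hv)

theorem scaledSlope_nonneg (S : LogSol p h lam mu v w) (hH0 : CondH0 h) {t : ℝ} (ht : 0 < t) :
    0 ≤ scaledSlope p mu w t :=
  mul_nonneg (Real.rpow_pos_of_pos (S.mu_pos hH0) _).le (S.slope_nonneg hH0 ht)

theorem scaledSlope_anti (S : LogSol p h lam mu v w) (hH0 : CondH0 h) {t₁ t₂ : ℝ} (h1 : 0 < t₁)
    (h12 : t₁ ≤ t₂) : scaledSlope p mu w t₂ ≤ scaledSlope p mu w t₁ :=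
  mul_le_mul_of_nonneg_left (S.antitoneOn_slope hH0 h1 (mem_Ioi.2 (h1.trans_le h12)) h12)
    (Real.rpow_pos_of_pos (S.mu_pos hH0) _).le

theorem tendsto_scaledSlope (S : LogSol p h lam mu v w) (hH0 : CondH0 h) :
    Tendsto (scaledSlope p mu w) atTop (𝓝 0) := by
  have := (S.tendsto_slope hH0).const_mul (mu ^ (p - 1))
  rwa [mul_zero] at this

theorem potential_nonneg (S : LogSol p h lam mu v w) (hp : 0 < p) (hH0 : CondH0 h) {t : ℝ}
    (ht : 0 < t) : 0 ≤ potential p h lam mu v t := by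
  have h1 := S.pos t ht
  have h2 := nonlin_nonneg (p := p) hH0 h1.le
  have h3 := S.lam_pos
  unfold potential approxPrim
  positivity

theorem tendsto_potential (S : LogSol p h lam mu v w) (hp : 0 < p) (hH0 : CondH0 h) :
    Tendsto (potential p h lam mu v) atTop (𝓝 0) := by
  have hmu := S.mu_pos hH0
  have hc : ContinuousAt (approxPrim p h) mu :=
    (hasDerivAt_nonlin hH0 hmu).continuousAt.div
      (continuousAt_const.mul (Real.continuousAt_rpow_const _ _ (Or.inl hmu.ne')))
      (by positivity)
  have h1 : Tendsto (fun t => approxPrim p h (v t)) atTop (𝓝 (approxPrim p h mu)) :=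
    hc.tendsto.comp S.tendsto_top
  have h2 : Tendsto (fun t : ℝ => Real.exp (-(2 * t))) atTop (𝓝 0) :=
    Real.tendsto_exp_neg_atTop_nhds_zero.comp (tendsto_id.const_mul_atTop two_pos)
  have h3 := ((h2.const_mul lam).mul h1).const_mul ((mu ^ (p - 1)) ^ 2)
  rwa [mul_zero, zero_mul, mul_zero] at h3

theorem hasDerivAt_scaledSlope (S : LogSol p h lam mu v w) (hp : 0 < p) (hH0 : CondH0 h) {t : ℝ}
    (ht : 0 < t) : HasDerivAt (scaledSlope p mu w)
      (-(p * (v t / mu) ^ (p - 1) * potential p h lam mu v t)) t := by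
  have hmu := S.mu_pos hH0
  have hv := S.pos t ht
  refine ((S.hasDerivAt_slope t ht).const_mul (mu ^ (p - 1))).congr_deriv ?_
  have h1 : 0 < mu ^ (p - 1) := by positivity
  have h2 : 0 < v t ^ (p - 1) := by positivity
  unfold potential approxPrim
  rw [Real.div_rpow hv.le hmu.le]
  field_simp

theorem scaledSlope_deriv_nonpos (S : LogSol p h lam mu v w) (hp : 0 < p) (hH0 : CondH0 h) {t : ℝ}
    (ht : 0 < t) : -(p * (v t / mu) ^ (p - 1) * potential p h lam mu v t) ≤ 0 := by
  have hmu := S.mu_pos hH0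
  have hv := S.pos t ht
  have := S.potential_nonneg hp hH0 ht
  have : 0 ≤ p * (v t / mu) ^ (p - 1) * potential p h lam mu v t := by positivity
  linarith

/-- The factor e^{-2t} contributes -2ψ, and 2 = p y^{p-1} κ(y) by the choice of κ; the approximate
primitive contributes the slope term with relative error `relErr`. -/
theorem hasDerivAt_potential (S : LogSol p h lam mu v w) (hp : 0 < p) (hH0 : CondH0 h) {t : ℝ}
    (ht : 0 < t) (hh : 0 < h (v t)) : HasDerivAt (potential p h lam mu v)
      (-(p * (v t / mu) ^ (p - 1) * potential p h lam mu v t) *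
        (kap p (v t / mu) - (1 + relErr p h (v t)) * scaledSlope p mu w t)) t := by
  have hmu := S.mu_pos hH0
  have hv := S.pos t ht
  have h0 : HasDerivAt (fun t : ℝ => Real.exp (-(2 * t))) (Real.exp (-(2 * t)) * (-2)) t := by
    simpa using (((hasDerivAt_id t).const_mul (2 : ℝ)).neg).exp
  have h1 := ((h0.const_mul lam).mul ((hasDerivAt_approxPrim hp hH0 hv hh).comp t
    (S.hasDerivAt t ht))).const_mul ((mu ^ (p - 1)) ^ 2)
  refine h1.congr_deriv ?_
  have h1 : 0 < mu ^ (p - 1) := by positivity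
  have h2 : 0 < v t ^ (p - 1) := by positivity
  have e : (v t / mu) ^ (1 - p) = mu ^ (p - 1) / v t ^ (p - 1) := by
    rw [show 1 - p = -(p - 1) by ring, Real.rpow_neg (by positivity),
      Real.div_rpow hv.le hmu.le, inv_div]
  unfold potential approxPrim kap scaledSlope
  rw [e, Real.div_rpow hv.le hmu.le]
  simp only [Function.comp]
  field_simp
  ring

/-- The energy `b ^ 2 / 2 + ψ` varies like `κ(v / mu) db`. -/
theorem hasDerivAt_energy (S : LogSol p h lam mu v w) (hp : 0 < p) (hH0 : CondH0 h) {t : ℝ}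
    (ht : 0 < t) (hh : 0 < h (v t)) :
    HasDerivAt (fun t => scaledSlope p mu w t ^ 2 / 2 + potential p h lam mu v t)
      (-(p * (v t / mu) ^ (p - 1) * potential p h lam mu v t) *
        (kap p (v t / mu) - relErr p h (v t) * scaledSlope p mu w t)) t := by
  refine ((((S.hasDerivAt_scaledSlope hp hH0 ht).pow 2).div_const 2).add
    (S.hasDerivAt_potential hp hH0 ht hh)).congr_deriv ?_
  push_cast
  ring

/-- Since b is nonincreasing, subtracting (κ + η) b or (κ - η) b from the energy gives a function
that is monotone in one direction or the other. -/
theorem abs_energy_sub_le (S : LogSol p h lam mu v w) (hp : 0 < p) (hH0 : CondH0 h)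
    {t₁ t₂ κ η : ℝ} (h1 : 0 < t₁) (h12 : t₁ ≤ t₂)
    (hh : ∀ t ∈ Icc t₁ t₂, 0 < h (v t) ∧
      |kap p (v t / mu) - relErr p h (v t) * scaledSlope p mu w t - κ| ≤ η) :
    |(scaledSlope p mu w t₁ ^ 2 / 2 + potential p h lam mu v t₁)
      - (scaledSlope p mu w t₂ ^ 2 / 2 + potential p h lam mu v t₂)
      - κ * (scaledSlope p mu w t₁ - scaledSlope p mu w t₂)|
      ≤ η * (scaledSlope p mu w t₁ - scaledSlope p mu w t₂) := by
  have hpos : ∀ t ∈ Icc t₁ t₂, 0 < t := fun t ht => h1.trans_le ht.1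
  have m1 := monotoneOn_of_hasDerivAt (convex_Icc t₁ t₂)
    (fun t ht => (S.hasDerivAt_energy hp hH0 (hpos t ht) (hh t ht).1).sub
      ((S.hasDerivAt_scaledSlope hp hH0 (hpos t ht)).const_mul (κ + η)))
    (fun t ht => by
      have h3 := S.scaledSlope_deriv_nonpos hp hH0 (hpos t ht)
      have h4 := (abs_le.1 (hh t ht).2).2
      nlinarith) (left_mem_Icc.2 h12) (right_mem_Icc.2 h12) h12
  have m2 := antitoneOn_of_hasDerivAt (convex_Icc t₁ t₂)
    (fun t ht => (S.hasDerivAt_energy hp hH0 (hpos t ht) (hh t ht).1).sub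
      ((S.hasDerivAt_scaledSlope hp hH0 (hpos t ht)).const_mul (κ - η)))
    (fun t ht => by
      have h3 := S.scaledSlope_deriv_nonpos hp hH0 (hpos t ht)
      have h4 := (abs_le.1 (hh t ht).2).1
      nlinarith) (left_mem_Icc.2 h12) (right_mem_Icc.2 h12) h12
  simp only [Pi.sub_apply] at m1 m2
  rw [abs_le]
  constructor <;> linarith

theorem tendsto_energy (S : LogSol p h lam mu v w) (hp : 0 < p) (hH0 : CondH0 h) :
    Tendsto (fun t => scaledSlope p mu w t ^ 2 / 2 + potential p h lam mu v t) atTop (𝓝 0) := by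
  simpa using (((S.tendsto_scaledSlope hH0).pow 2).div_const 2).add (S.tendsto_potential hp hH0)

theorem abs_energy_le (S : LogSol p h lam mu v w) (hp : 0 < p) (hH0 : CondH0 h)
    {t₁ κ η : ℝ} (h1 : 0 < t₁)
    (hh : ∀ t, t₁ ≤ t → 0 < h (v t) ∧
      |kap p (v t / mu) - relErr p h (v t) * scaledSlope p mu w t - κ| ≤ η) :
    |scaledSlope p mu w t₁ ^ 2 / 2 + potential p h lam mu v t₁ - κ * scaledSlope p mu w t₁|
      ≤ η * scaledSlope p mu w t₁ := by
  have hb := S.tendsto_scaledSlope hH0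
  have l1 := ((tendsto_const_nhds (x := scaledSlope p mu w t₁ ^ 2 / 2 +
    potential p h lam mu v t₁)).sub (S.tendsto_energy hp hH0)).sub
    (((tendsto_const_nhds (x := scaledSlope p mu w t₁)).sub hb).const_mul κ)
  have l2 := ((tendsto_const_nhds (x := scaledSlope p mu w t₁)).sub hb).const_mul η
  have := le_of_tendsto_of_tendsto l1.abs l2 (by
    filter_upwards [eventually_ge_atTop t₁] with t ht
    exact S.abs_energy_sub_le hp hH0 h1 ht fun s hs => hh s hs.1)
  simpa using this

/-- The energy minus C b minus b²/4 is nondecreasing and tends to 0: the term b²/4 absorbs the error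
`relErr` · b, as |`relErr`| ≤ 1/2. Hence b²/4 + ψ ≤ C b, which bounds first b and then ψ. -/
theorem slope_and_potential_le (S : LogSol p h lam mu v w) (hp : 0 < p) (hH0 : CondH0 h)
    {t₁ C : ℝ} (hC : 0 ≤ C) (h1 : 0 < t₁)
    (hh : ∀ t, t₁ ≤ t → 0 < h (v t) ∧ kap p (v t / mu) ≤ C ∧ |relErr p h (v t)| ≤ 1 / 2) :
    scaledSlope p mu w t₁ ≤ 4 * C ∧ potential p h lam mu v t₁ ≤ 4 * C ^ 2 := by
  have hpos : ∀ t ∈ Ici t₁, 0 < t := fun t ht => h1.trans_le ht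
  have m := monotoneOn_of_hasDerivAt (convex_Ici t₁)
    (fun t ht => ((S.hasDerivAt_energy hp hH0 (hpos t ht) (hh t ht).1).sub
      ((S.hasDerivAt_scaledSlope hp hH0 (hpos t ht)).const_mul C)).sub
      (((S.hasDerivAt_scaledSlope hp hH0 (hpos t ht)).pow 2).div_const 4))
    (fun t ht => by
      have h3 := S.scaledSlope_deriv_nonpos hp hH0 (hpos t ht)
      obtain ⟨-, h4, h5⟩ := hh t ht
      have h6 := S.scaledSlope_nonneg hH0 (hpos t ht)
      have h7 := (abs_le.1 h5).1
      have h8 : kap p (v t / mu) - relErr p h (v t) * scaledSlope p mu w t - C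
        - scaledSlope p mu w t / 2 ≤ 0 := by nlinarith
      push_cast
      have := mul_nonneg_of_nonpos_of_nonpos h3 h8
      linarith)
  have hlim := ((S.tendsto_energy hp hH0).sub ((S.tendsto_scaledSlope hH0).const_mul C)).sub
    (((S.tendsto_scaledSlope hH0).pow 2).div_const 4)
  have key := ge_of_tendsto hlim (by
    filter_upwards [eventually_ge_atTop t₁] with t ht
    exact m (mem_Ici.2 le_rfl) (mem_Ici.2 ht) ht)
  simp only [Pi.sub_apply, Pi.pow_apply] at key
  norm_num at key
  have h6 := S.scaledSlope_nonneg hH0 h1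
  have h7 := S.potential_nonneg hp hH0 h1
  have h8 : scaledSlope p mu w t₁ ≤ 4 * C := by
    by_contra! hlt
    nlinarith [mul_pos (show 0 < scaledSlope p mu w t₁ by linarith) (sub_pos.2 hlt)]
  exact ⟨h8, by nlinarith [sq_nonneg (scaledSlope p mu w t₁)]⟩

theorem slope_sub_le (S : LogSol p h lam mu v w) (hp : 0 < p) (hH0 : CondH0 h)
    {t₁ t₂ A : ℝ} (h1 : 0 < t₁) (h12 : t₁ ≤ t₂)
    (hA : ∀ t ∈ Icc t₁ t₂, p * (v t / mu) ^ (p - 1) * potential p h lam mu v t ≤ A) :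
    scaledSlope p mu w t₁ - scaledSlope p mu w t₂ ≤ A * (t₂ - t₁) := by
  have m := monotoneOn_of_hasDerivAt (convex_Icc t₁ t₂)
    (fun t ht => (S.hasDerivAt_scaledSlope hp hH0 (h1.trans_le ht.1)).add
      ((hasDerivAt_id t).const_mul A))
    (fun t ht => by linarith [hA t ht]) (left_mem_Icc.2 h12) (right_mem_Icc.2 h12) h12
  simp only [Pi.add_apply, id] at m
  linarith

theorem le_slope_sub (S : LogSol p h lam mu v w) (hp : 0 < p) (hH0 : CondH0 h)
    {t₁ t₂ A : ℝ} (h1 : 0 < t₁) (h12 : t₁ ≤ t₂)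
    (hA : ∀ t ∈ Icc t₁ t₂, A ≤ p * (v t / mu) ^ (p - 1) * potential p h lam mu v t) :
    A * (t₂ - t₁) ≤ scaledSlope p mu w t₁ - scaledSlope p mu w t₂ := by
  have m := antitoneOn_of_hasDerivAt (convex_Icc t₁ t₂)
    (fun t ht => (S.hasDerivAt_scaledSlope hp hH0 (h1.trans_le ht.1)).add
      ((hasDerivAt_id t).const_mul A))
    (fun t ht => by linarith [hA t ht]) (left_mem_Icc.2 h12) (right_mem_Icc.2 h12) h12
  simp only [Pi.add_apply, id] at m
  linarith

end LogSol

/-! ### Limit profiles and reflection at a bubble -/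

theorem kap_eq {p δ : ℝ} (hδ : 0 < δ) : kap p δ = 2 / (p * δ ^ (p - 1)) := by
  rw [kap, show 1 - p = -(p - 1) by ring, Real.rpow_neg hδ.le]
  field_simp

theorem kap_pos {p δ : ℝ} (hp : 0 < p) (hδ : 0 < δ) : 0 < kap p δ := by
  unfold kap; positivity

theorem continuousAt_kap {p δ : ℝ} (hδ : 0 < δ) : ContinuousAt (kap p) δ :=
  continuousAt_const.mul (Real.continuousAt_rpow_const _ _ (Or.inl hδ.ne'))

/-- Here 2/κ(δ) = p δ^{p-1}, so κ(δ) is the critical slope: the line 2σ has slope 2/b in y, and b <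
κ(δ) or b > κ(δ) decides on which side of the curve y^p it runs just below δ. -/
theorem tendsto_slope_rpow {p δ : ℝ} (hp : 0 < p) (hδ : 0 < δ) :
    Tendsto (fun y => (δ ^ p - y ^ p) / (δ - y)) (𝓝[<] δ) (𝓝 (2 / kap p δ)) := by
  have h1 := (hasDerivAt_iff_tendsto_slope.1
    (Real.hasDerivAt_rpow_const (x := δ) (p := p) (Or.inl hδ.ne'))).mono_left
    (nhdsWithin_mono δ (fun y (hy : y < δ) => hy.ne))
  have e : 2 / kap p δ = p * δ ^ (p - 1) := by
    rw [kap_eq hδ]; field_simp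
  rw [e]
  refine h1.congr' ?_
  filter_upwards [self_mem_nhdsWithin] with y hy
  have hy : y < δ := hy
  rw [slope_def_field, ← neg_sub (δ ^ p), ← neg_sub δ, neg_div_neg_eq]

/-- The relations satisfied by the limits, as functions of the relative height `y ∈ (0, 1)`, of the
rescaled time `σ` (normalized by its value at `y = 0`), of the rescaled slope `b` and of the
potential energy `ψ`. -/
structure Profile (p : ℝ) (σ b ψ : ℝ → ℝ) : Prop where
  slope_nonneg : ∀ y, 0 < y → y < 1 → 0 ≤ b y
  potential_nonneg : ∀ y, 0 < y → y < 1 → 0 ≤ ψ y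
  anti : ∀ y₁ y₂, 0 < y₁ → y₁ < y₂ → y₂ < 1 → b y₂ ≤ b y₁
  le_sub : ∀ y₁ y₂, 0 < y₁ → y₁ < y₂ → y₂ < 1 → b y₂ * (σ y₂ - σ y₁) ≤ y₂ - y₁
  sub_le : ∀ y₁ y₂, 0 < y₁ → y₁ < y₂ → y₂ < 1 → y₂ - y₁ ≤ b y₁ * (σ y₂ - σ y₁)
  le_time : ∀ y, 0 < y → y < 1 → y ^ p ≤ 2 * σ y
  time_le : ∀ y, 0 < y → y < 1 → 2 * σ y ≤ 1
  potential_eq_zero : ∀ y, 0 < y → y < 1 → y ^ p < 2 * σ y → ψ y = 0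
  slope_eq : ∀ y₁ y₂, 0 < y₁ → y₁ < y₂ → y₂ < 1 → y₂ ^ p < 2 * σ y₁ → b y₁ = b y₂
  energy : ∀ y₁ y₂ κ η, 0 < y₁ → y₁ < y₂ → y₂ < 1 → (∀ y ∈ Icc y₁ y₂, |kap p y - κ| ≤ η) →
    |(b y₁ ^ 2 / 2 + ψ y₁) - (b y₂ ^ 2 / 2 + ψ y₂) - κ * (b y₁ - b y₂)| ≤ η * (b y₁ - b y₂)
  energy_top : ∀ y₁ κ η, 0 < y₁ → y₁ < 1 → (∀ y ∈ Icc y₁ 1, |kap p y - κ| ≤ η) →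
    |b y₁ ^ 2 / 2 + ψ y₁ - κ * b y₁| ≤ η * b y₁
  potential_le : ∀ y₀, 0 < y₀ → y₀ < 1 → ∃ C, ∀ y₁ y y₂, y₀ < y₁ → y₁ < y → y < y₂ → y₂ < 1 →
    ψ y ≤ C * (b y₁ - b y₂)

namespace Profile

variable {p : ℝ} {σ b ψ : ℝ → ℝ}

theorem slope_pos (P : Profile p σ b ψ) {y : ℝ} (h0 : 0 < y) (h1 : y < 1) : 0 < b y := by
  have h := P.sub_le y ((y + 1) / 2) h0 (by linarith) (by linarith)
  refine lt_of_le_of_ne (P.slope_nonneg y h0 h1) fun h2 => ?_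
  rw [← h2, zero_mul] at h
  linarith

theorem time_lt (P : Profile p σ b ψ) {y₁ y₂ : ℝ} (h0 : 0 < y₁) (h12 : y₁ < y₂) (h1 : y₂ < 1) :
    σ y₁ < σ y₂ := by
  have h := P.sub_le y₁ y₂ h0 h12 h1
  have hb := P.slope_pos h0 (h12.trans h1)
  by_contra! hle
  nlinarith

/-- On heights below some c < 1 the slope is at least b(c) > 0, so the chord inequality makes σ
locally Lipschitz. -/
theorem continuousAt_time (P : Profile p σ b ψ) {y : ℝ} (h0 : 0 < y) (h1 : y < 1) :
    ContinuousAt σ y := by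
  set c := (y + 1) / 2 with hc
  have hb : 0 < b c := P.slope_pos (by positivity) (by linarith)
  have key : ∀ z z', 0 < z → z < z' → z' < c → |σ z' - σ z| ≤ |z' - z| / b c := by
    intro z z' hz hzz hz'
    have h2 := P.time_lt hz hzz (by linarith)
    have h3 := P.le_sub z z' hz hzz (by linarith)
    have h4 := P.anti z' c (by linarith) hz' (by linarith)
    rw [abs_of_pos (by linarith), abs_of_pos (by linarith), le_div_iff₀ hb]
    nlinarith
  rw [ContinuousAt, tendsto_iff_dist_tendsto_zero]
  have hlim : Tendsto (fun z => |z - y| / b c) (𝓝 y) (𝓝 0) := by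
    have : Tendsto (fun z => |z - y| / b c) (𝓝 y) (𝓝 (|y - y| / b c)) :=
      Continuous.tendsto (by fun_prop) y
    simpa using this
  refine squeeze_zero' (Eventually.of_forall fun _ => dist_nonneg) ?_ hlim
  filter_upwards [Ioo_mem_nhds h0 (show y < c by linarith)] with z hz
  rw [Real.dist_eq]
  rcases lt_trichotomy z y with h | h | h
  · rw [abs_sub_comm (σ z), abs_sub_comm z]; exact key z y hz.1 h (by linarith)
  · simp [h]
  · exact key y z h0 h hz.2

/-- `slope_eq` compares the larger height with the time at the smaller one, so it applies only to
nearby heights; continuity of σ supplies the room. -/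
theorem slope_eventually_const (P : Profile p σ b ψ) {y : ℝ} (h0 : 0 < y)
    (h1 : y < 1) (hy : y ^ p < 2 * σ y) : ∀ᶠ z in 𝓝 y, b z = b y := by
  obtain ⟨m, hm1, hm2⟩ := exists_between hy
  have e1 : ∀ᶠ z : ℝ in 𝓝 y, z ^ p < m :=
    (Real.continuousAt_rpow_const y p (Or.inl h0.ne')).eventually_lt_const hm1
  have e2 : ∀ᶠ z in 𝓝 y, m < 2 * σ z :=
    ((P.continuousAt_time h0 h1).const_mul 2).eventually_const_lt hm2
  filter_upwards [e1, e2, Ioo_mem_nhds h0 h1] with z h2 h3 h4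
  rcases lt_trichotomy z y with h | h | h
  · exact P.slope_eq z y h4.1 h h1 (hm1.trans h3)
  · rw [h]
  · exact (P.slope_eq y z h0 h h4.2 (h2.trans hm2)).symm

theorem slope_const (P : Profile p σ b ψ) {α β : ℝ} (hα : 0 ≤ α) (hβ : β ≤ 1)
    (hΦ : ∀ y ∈ Ioo α β, y ^ p < 2 * σ y) {y z : ℝ} (hy : y ∈ Ioo α β) (hz : z ∈ Ioo α β) :
    b y = b z := by
  have hd : ∀ x ∈ Ioo α β, HasDerivAt b 0 x := fun x hx =>
    (hasDerivAt_const x (b x)).congr_of_eventuallyEq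
      (P.slope_eventually_const (hα.trans_lt hx.1) (hx.2.trans_le hβ) (hΦ x hx))
  exact isOpen_Ioo.is_const_of_deriv_eq_zero isPreconnected_Ioo
    (fun x hx => (hd x hx).differentiableAt.differentiableWithinAt)
    (fun x hx => (hd x hx).deriv) hy hz

theorem time_sub_eq (P : Profile p σ b ψ) {y z B : ℝ} (h0 : 0 < y) (hyz : y < z) (h1 : z < 1)
    (hy : b y = B) (hz : b z = B) : B * (σ z - σ y) = z - y :=
  le_antisymm (hz ▸ P.le_sub y z h0 hyz h1) (hy ▸ P.sub_le y z h0 hyz h1)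

theorem exists_slope_tendsto (P : Profile p σ b ψ) {δ : ℝ} (h0 : 0 < δ) (h1 : δ ≤ 1) :
    ∃ B, Tendsto b (𝓝[<] δ) (𝓝 B) ∧ 0 ≤ B ∧ ∀ y, 0 < y → y < δ → B ≤ b y := by
  have hanti : AntitoneOn b (Ioo 0 δ) := by
    intro y hy z hz hyz
    rcases hyz.eq_or_lt with h | h
    · rw [h]
    · exact P.anti y z hy.1 h (hz.2.trans_le h1)
  have hbdd : BddBelow (b '' Ioo 0 δ) :=
    ⟨0, by rintro _ ⟨y, hy, rfl⟩; exact P.slope_nonneg y hy.1 (hy.2.trans_le h1)⟩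
  refine ⟨sInf (b '' Ioo 0 δ), ?_, ?_, ?_⟩
  · have := hanti.tendsto_nhdsWithin_Ioo_left (nonempty_Ioo.2 h0) hbdd
    exact this
  · exact le_csInf ((nonempty_Ioo.2 h0).image b) (by
      rintro _ ⟨y, hy, rfl⟩; exact P.slope_nonneg y hy.1 (hy.2.trans_le h1))
  · intro y hy hyδ
    exact csInf_le hbdd (mem_image_of_mem b ⟨hy, hyδ⟩)

/-- In `potential_le` take 2y - δ and (y + δ)/2 as neighbours of y. Both tend to δ from below, so
their slopes have the same limit and the bound tends to 0. -/
theorem tendsto_potential_left (P : Profile p σ b ψ) {δ B : ℝ} (h0 : 0 < δ) (h1 : δ ≤ 1)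
    (hB : Tendsto b (𝓝[<] δ) (𝓝 B)) : Tendsto ψ (𝓝[<] δ) (𝓝 0) := by
  obtain ⟨C, hC⟩ := P.potential_le (δ / 2) (by positivity) (by linarith)
  have l1 : Tendsto (fun y => 2 * y - δ) (𝓝[<] δ) (𝓝[<] δ) := by
    refine tendsto_nhdsWithin_iff.2 ⟨?_, ?_⟩
    · have : Tendsto (fun y => 2 * y - δ) (𝓝 δ) (𝓝 (2 * δ - δ)) :=
        Continuous.tendsto (by fun_prop) δ
      rw [show 2 * δ - δ = δ by ring] at this
      exact this.mono_left nhdsWithin_le_nhds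
    · filter_upwards [self_mem_nhdsWithin] with y hy
      have : y < δ := hy
      show 2 * y - δ < δ
      linarith
  have l2 : Tendsto (fun y => (y + δ) / 2) (𝓝[<] δ) (𝓝[<] δ) := by
    refine tendsto_nhdsWithin_iff.2 ⟨?_, ?_⟩
    · have : Tendsto (fun y => (y + δ) / 2) (𝓝 δ) (𝓝 ((δ + δ) / 2)) :=
        Continuous.tendsto (by fun_prop) δ
      rw [show (δ + δ) / 2 = δ by ring] at this
      exact this.mono_left nhdsWithin_le_nhds
    · filter_upwards [self_mem_nhdsWithin] with y hy
      have : y < δ := hy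
      show (y + δ) / 2 < δ
      linarith
  have l3 := ((hB.comp l1).sub (hB.comp l2)).const_mul C
  rw [sub_self, mul_zero] at l3
  refine squeeze_zero' ?_ ?_ l3
  · filter_upwards [Ioo_mem_nhdsLT h0] with y hy
    exact P.potential_nonneg y hy.1 (hy.2.trans_le h1)
  · filter_upwards [Ioo_mem_nhdsLT (show 3 * δ / 4 < δ by linarith)] with y hy
    exact hC (2 * y - δ) y ((y + δ) / 2) (by linarith [hy.1]) (by linarith [hy.2])
      (by linarith [hy.2]) (by linarith [hy.2])

/-- A bubble at the height `δ` reflects the slope `c` into `2 κ(δ) - c`. -/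
theorem reflection (P : Profile p σ b ψ) (hp : 0 < p) {δ c : ℝ} (h0 : 0 < δ) (h1 : δ ≤ 1)
    (hc : c < kap p δ)
    (hE : ∀ η > 0, ∀ᶠ y in 𝓝[<] δ, c ≤ b y ∧
      |b y ^ 2 / 2 + ψ y - c ^ 2 / 2 - kap p δ * (b y - c)| ≤ η * (b y - c))
    (hσ : Tendsto σ (𝓝[<] δ) (𝓝 (δ ^ p / 2))) :
    ∀ᶠ y in 𝓝[<] δ, b y = 2 * kap p δ - c ∧
      2 * σ y = δ ^ p - 2 * (δ - y) / (2 * kap p δ - c) := by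
  have hκ := kap_pos hp h0
  obtain ⟨B, hB, hB0, hBle⟩ := P.exists_slope_tendsto h0 h1
  have hψ := P.tendsto_potential_left h0 h1 hB
  have hslope := tendsto_slope_rpow hp h0
  have hid : Tendsto (fun y : ℝ => y) (𝓝[<] δ) (𝓝 δ) := tendsto_id.mono_left nhdsWithin_le_nhds
  have hcB : c ≤ B := ge_of_tendsto hB ((hE 1 one_pos).mono fun _ h => h.1)
  -- The energy law in the limit, where ψ has disappeared on both sides: either B = c or B = 2κ(δ) -
  -- c.
  have hdich : B ^ 2 / 2 - c ^ 2 / 2 - kap p δ * (B - c) = 0 := by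
    have l1 : Tendsto (fun y => |b y ^ 2 / 2 + ψ y - c ^ 2 / 2 - kap p δ * (b y - c)|) (𝓝[<] δ)
        (𝓝 |B ^ 2 / 2 + 0 - c ^ 2 / 2 - kap p δ * (B - c)|) :=
      (((((hB.pow 2).div_const 2).add hψ).sub_const _).sub
        ((hB.sub_const c).const_mul _)).abs
    have h2 : ∀ η > 0, |B ^ 2 / 2 + 0 - c ^ 2 / 2 - kap p δ * (B - c)| ≤ η * (B - c) :=
      fun η hη => le_of_tendsto_of_tendsto l1 ((hB.sub_const c).const_mul η)
        ((hE η hη).mono fun _ h => h.2)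
    have h3 : |B ^ 2 / 2 + 0 - c ^ 2 / 2 - kap p δ * (B - c)| ≤ 0 := by
      refine le_of_forall_pos_le_add fun ε hε => ?_
      have hpos : 0 < B - c + 1 := by linarith
      have h4 := h2 (ε / (B - c + 1)) (by positivity)
      have h5 : ε / (B - c + 1) * (B - c) ≤ ε := by
        rw [div_mul_eq_mul_div, div_le_iff₀ hpos]; nlinarith
      linarith
    have := abs_nonpos_iff.1 h3
    linarith
  -- The chord inequality together with y^p ≤ 2σ gives 2 ≤ b(y) (δ^p - y^p)/(δ - y), whose limit is
  -- B · 2/κ(δ). This excludes B = c.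
  have hBκ : kap p δ ≤ B := by
    have l1 := hB.mul hslope
    have h2 : 2 ≤ B * (2 / kap p δ) := by
      refine ge_of_tendsto l1 ?_
      filter_upwards [Ioo_mem_nhdsLT h0] with y hy
      have l2 : δ - y ≤ b y * (δ ^ p / 2 - σ y) := by
        refine le_of_tendsto_of_tendsto (hid.sub_const y) ((hσ.sub_const (σ y)).const_mul (b y)) ?_
        filter_upwards [Ioo_mem_nhdsLT hy.2] with z hz
        exact P.sub_le y z hy.1 hz.1 (hz.2.trans_le h1)
      have h3 := P.le_time y hy.1 (hy.2.trans_le h1)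
      have h4 := P.slope_nonneg y hy.1 (hy.2.trans_le h1)
      have h5 : 0 < δ - y := by linarith [hy.2]
      rw [← mul_div_assoc, le_div_iff₀ h5]
      nlinarith
    have h3 : 2 * kap p δ ≤ B * 2 := by
      have := mul_le_mul_of_nonneg_right h2 hκ.le
      field_simp at this
      linarith
    linarith
  have hBeq : B = 2 * kap p δ - c := by
    have : (B - c) * (B - (2 * kap p δ - c)) = 0 := by linear_combination 2 * hdich
    rcases mul_eq_zero.1 this with h | h <;> linarith
  rw [← hBeq]
  have hBpos : 0 < B := by linarith
  -- As B > κ(δ), the line of slope 2/B is flatter than y^p at δ, so below δ it lies strictly above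
  -- the curve and the slope is locally constant there.
  have hΦ : ∀ᶠ y in 𝓝[<] δ, y ^ p < 2 * σ y := by
    have h2 : 2 / B < 2 / kap p δ := div_lt_div_of_pos_left two_pos hκ (by linarith)
    filter_upwards [hslope.eventually_const_lt h2, Ioo_mem_nhdsLT h0] with y h3 hy
    have l2 : B * (δ ^ p / 2 - σ y) ≤ δ - y := by
      refine le_of_tendsto_of_tendsto ((hσ.sub_const (σ y)).const_mul B) (hid.sub_const y) ?_
      filter_upwards [Ioo_mem_nhdsLT hy.2] with z hz
      have h4 := P.le_sub y z hy.1 hz.1 (hz.2.trans_le h1)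
      have h5 := P.time_lt hy.1 hz.1 (hz.2.trans_le h1)
      have h6 := hBle z (hy.1.trans hz.1) hz.2
      nlinarith
    have h5 : 0 < δ - y := by linarith [hy.2]
    rw [div_lt_div_iff₀ hBpos h5] at h3
    by_contra! hle
    nlinarith
  obtain ⟨α, hα, hαΦ⟩ := mem_nhdsLT_iff_exists_Ioo_subset.1 (hΦ.and (Ioo_mem_nhdsLT h0))
  have hα' : α < δ := hα
  have hm : ∀ y ∈ Ioo (max α 0) δ, y ^ p < 2 * σ y := fun y hy =>
    (hαΦ ⟨(le_max_left _ _).trans_lt hy.1, hy.2⟩).1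
  have hmδ : max α 0 < δ := max_lt hα' h0
  have hconst : ∀ y ∈ Ioo (max α 0) δ, b y = B := by
    intro y hy
    refine tendsto_nhds_unique (f := b) ?_ hB
    refine tendsto_const_nhds.congr' ?_
    filter_upwards [Ioo_mem_nhdsLT hmδ] with z hz
    exact P.slope_const (le_max_right _ _) h1 hm hy hz
  filter_upwards [Ioo_mem_nhdsLT hmδ] with y hy
  have hy0 : 0 < y := (le_max_right _ _).trans_lt hy.1
  refine ⟨hconst y hy, ?_⟩
  have l1 : B * (δ ^ p / 2 - σ y) = δ - y := by
    refine tendsto_nhds_unique (f := fun z => B * (σ z - σ y)) ((hσ.sub_const _).const_mul _) ?_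
    refine (hid.sub_const y).congr' ?_
    filter_upwards [Ioo_mem_nhdsLT hy.2] with z hz
    exact (P.time_sub_eq hy0 hz.1 (hz.2.trans_le h1) (hconst y hy)
      (hconst z ⟨hy.1.trans hz.1, hz.2⟩)).symm
  field_simp
  linarith

/-- Below a bubble the profile is affine as long as the exponent stays negative. -/
theorem affine_extension (P : Profile p σ b ψ) {α δ B : ℝ} (hα : 0 ≤ α)
    (hαδ : α < δ) (h1 : δ ≤ 1) (hB : 0 < B)
    (hstart : ∀ᶠ y in 𝓝[<] δ, b y = B ∧ 2 * σ y = δ ^ p - 2 * (δ - y) / B)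
    (hneg : ∀ y ∈ Ioo α δ, y ^ p < δ ^ p - 2 * (δ - y) / B) :
    ∀ y ∈ Ioo α δ, b y = B ∧ 2 * σ y = δ ^ p - 2 * (δ - y) / B := by
  set G : Set ℝ := {y | b y = B ∧ 2 * σ y = δ ^ p - 2 * (δ - y) / B} with hG
  have hsub : Ioo α δ ⊆ interior G := by
    -- Continuation by connectedness: at a limit point of the interior of G, continuity gives the
    -- formula for σ, then `hneg` makes b constant nearby, and the affine law extends to a full
    -- neighbourhood.
    refine isPreconnected_Ioo.subset_of_closure_inter_subset isOpen_interior ?_ ?_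
    · obtain ⟨γ, hγ, hγG⟩ := mem_nhdsLT_iff_exists_Ioo_subset.1 hstart
      have hm : max α γ < δ := max_lt hαδ hγ
      refine ⟨(max α γ + δ) / 2, ⟨?_, by linarith⟩, ?_⟩
      · linarith [le_max_left α γ]
      · refine interior_maximal hγG isOpen_Ioo ⟨?_, by linarith⟩
        linarith [le_max_right α γ]
    · rintro y ⟨hyc, hy⟩
      have hy0 : 0 < y := hα.trans_lt hy.1
      have hy1 : y < 1 := hy.2.trans_le h1
      have hfreq : ∃ᶠ z in 𝓝 y, z ∈ G :=
        (mem_closure_iff_frequently.1 hyc).mono fun z hz => interior_subset hz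
      have hcont := P.continuousAt_time hy0 hy1
      have hσy : 2 * σ y = δ ^ p - 2 * (δ - y) / B := by
        have l1 : Tendsto (fun z => 2 * σ z - (δ ^ p - 2 * (δ - z) / B)) (𝓝 y)
            (𝓝 (2 * σ y - (δ ^ p - 2 * (δ - y) / B))) :=
          (hcont.const_mul 2).sub (Continuous.tendsto (by fun_prop) y)
        have := l1.frequently (hfreq.mono fun z hz => show _ ∈ ({0} : Set ℝ) by
          simp [hz.2])
        have h2 : (2 * σ y - (δ ^ p - 2 * (δ - y) / B)) ∈ closure ({0} : Set ℝ) :=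
          mem_closure_iff_frequently.2 this
        rw [closure_singleton, mem_singleton_iff] at h2
        linarith
      have hev := P.slope_eventually_const hy0 hy1 (hσy ▸ hneg y hy)
      obtain ⟨z, hz, hzb⟩ := (hfreq.and_eventually hev).exists
      have hby : b y = B := hzb ▸ hz.1
      rw [mem_interior_iff_mem_nhds]
      filter_upwards [hev, Ioo_mem_nhds hy0 hy1] with z hz hz01
      have hbz : b z = B := hz.trans hby
      refine ⟨hbz, ?_⟩
      have key : B * (σ z - σ y) = z - y := by
        rcases lt_trichotomy z y with h | h | h
        · have := P.time_sub_eq hz01.1 h hy1 hbz hby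
          linarith
        · simp [h]
        · exact P.time_sub_eq hy0 h hz01.2 hby hbz
      have : σ z = σ y + (z - y) / B := by field_simp; linarith
      rw [this, mul_add, hσy]
      ring
  intro y hy
  have := interior_subset (hsub hy)
  exact this

/-- At the top the incoming slope is 0, because the energy is counted from t = ∞ where b and ψ
vanish; 2σ is squeezed between y^p and 1. -/
theorem first_reflection (P : Profile p σ b ψ) (hp : 0 < p) :
    ∀ᶠ y in 𝓝[<] 1, b y = 4 / p ∧ 2 * σ y = 1 ^ p - 2 * (1 - y) / (4 / p) := by
  have hk : kap p 1 = 2 / p := by simp [kap]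
  have key := P.reflection hp (δ := 1) (c := 0) one_pos le_rfl (kap_pos hp one_pos) ?_ ?_
  · rw [hk, show 2 * (2 / p) - 0 = 4 / p by ring] at key
    exact key
  · intro η hη
    obtain ⟨ε, hε, hball⟩ := Metric.continuousAt_iff.1 (continuousAt_kap (p := p) one_pos) η hη
    filter_upwards [Ioo_mem_nhdsLT (show max 0 (1 - ε) < 1 from max_lt one_pos (by linarith))]
      with y hy
    have hy0 : 0 < y := (le_max_left _ _).trans_lt hy.1
    have hyε : 1 - ε < y := (le_max_right _ _).trans_lt hy.1
    refine ⟨P.slope_nonneg y hy0 hy.2, ?_⟩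
    have := P.energy_top y (kap p 1) η hy0 hy.2 fun z hz => by
      have := hball (x := z) (by rw [Real.dist_eq, abs_lt]; constructor <;> linarith [hz.1, hz.2])
      exact this.le
    convert this using 2
    · ring
    · ring
  · rw [Real.one_rpow]
    have l1 : Tendsto (fun y : ℝ => y ^ p / 2) (𝓝[<] 1) (𝓝 (1 / 2)) := by
      have := ((Real.continuousAt_rpow_const (1 : ℝ) p (Or.inl one_ne_zero)).tendsto.div_const
        2).mono_left (nhdsWithin_le_nhds (s := Iio 1))
      rwa [Real.one_rpow] at this
    refine tendsto_of_tendsto_of_tendsto_of_le_of_le' l1 tendsto_const_nhds ?_ ?_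
    · filter_upwards [Ioo_mem_nhdsLT one_pos] with y hy
      linarith [P.le_time y hy.1 hy.2]
    · filter_upwards [Ioo_mem_nhdsLT one_pos] with y hy
      linarith [P.time_le y hy.1 hy.2]

/-- The energy below δ is compared with that at a point z slightly above δ. There b = c and ψ = 0
whatever z is, so z may be taken so close to δ that κ differs from κ(δ) by at most η on the
interval. -/
theorem next_reflection (P : Profile p σ b ψ) (hp : 0 < p) {δ β c : ℝ} {g : ℝ → ℝ} (h0 : 0 < δ)
    (hδβ : δ < β) (h1 : β ≤ 1) (hc : c < kap p δ) (hg : ContinuousAt g δ) (hgδ : g δ = δ ^ p)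
    (hright : ∀ y ∈ Ioo δ β, b y = c ∧ 2 * σ y = g y ∧ y ^ p < g y) :
    ∀ᶠ y in 𝓝[<] δ, b y = 2 * kap p δ - c ∧
      2 * σ y = δ ^ p - 2 * (δ - y) / (2 * kap p δ - c) := by
  have hδ1 : δ < 1 := hδβ.trans_le h1
  refine P.reflection hp h0 hδ1.le hc ?_ ?_
  · intro η hη
    obtain ⟨ε, hε, hball⟩ := Metric.continuousAt_iff.1 (continuousAt_kap (p := p) h0) η hη
    set z := min ((δ + β) / 2) (δ + ε / 2) with hz
    have hz1 : z ∈ Ioo δ β := ⟨lt_min (by linarith) (by linarith),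
      (min_le_left _ _).trans_lt (by linarith)⟩
    have hzε : z ≤ δ + ε / 2 := min_le_right _ _
    obtain ⟨hbz, hσz, hΦz⟩ := hright z hz1
    have hψz := P.potential_eq_zero z (h0.trans hz1.1) (hz1.2.trans_le h1) (hσz ▸ hΦz)
    filter_upwards [Ioo_mem_nhdsLT (show max 0 (δ - ε) < δ from max_lt h0 (by linarith))]
      with y hy
    have hy0 : 0 < y := (le_max_left _ _).trans_lt hy.1
    have hyε : δ - ε < y := (le_max_right _ _).trans_lt hy.1
    have hyz : y < z := hy.2.trans hz1.1
    refine ⟨hbz ▸ P.anti y z hy0 hyz (hz1.2.trans_le h1), ?_⟩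
    have := P.energy y z (kap p δ) η hy0 hyz (hz1.2.trans_le h1) fun x hx => by
      have := hball (x := x) (by rw [Real.dist_eq, abs_lt]; constructor <;> linarith [hx.1, hx.2])
      exact this.le
    rw [hψz, hbz] at this
    convert this using 2
    ring
  · have hcont := P.continuousAt_time h0 hδ1
    have : 2 * σ δ = δ ^ p := by
      rw [← hgδ]
      refine tendsto_nhds_unique (f := fun y => 2 * σ y) (l := 𝓝[>] δ)
        ((hcont.const_mul 2).tendsto.mono_left nhdsWithin_le_nhds) ?_
      refine (hg.tendsto.mono_left nhdsWithin_le_nhds).congr' ?_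
      filter_upwards [Ioo_mem_nhdsGT hδβ] with y hy
      exact (hright y hy).2.1.symm
    rw [← this, mul_div_cancel_left₀ _ two_ne_zero]
    exact hcont.tendsto.mono_left nhdsWithin_le_nhds

end Profile

/-! ### The bubble numbers -/

/-- The difference vanishes at 0 and has nonnegative derivative. The multipliers p and p/(p - 2)
give the two bounds on the amplitudes a_k. -/
theorem mul_sinh_le {c s : ℝ} (hc : 1 ≤ c) (hs : 0 ≤ s) : c * Real.sinh s ≤ Real.sinh (c * s) := by
  have m := monotoneOn_of_hasDerivAt (convex_Ici (0 : ℝ))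
    (g := fun s => Real.sinh (c * s) - c * Real.sinh s)
    (g' := fun s => Real.cosh (c * s) * c - c * Real.cosh s)
    (fun t _ => by
      have h1 : HasDerivAt (fun t => c * t) c t := by simpa using (hasDerivAt_id t).const_mul c
      exact h1.sinh.sub ((Real.hasDerivAt_sinh t).const_mul c))
    (fun t ht => by
      have ht : 0 ≤ t := ht
      have : Real.cosh t ≤ Real.cosh (c * t) := by
        rw [Real.cosh_le_cosh, abs_of_nonneg ht, abs_of_nonneg (by positivity)]
        nlinarith
      nlinarith) (mem_Ici.2 le_rfl) (mem_Ici.2 hs) hs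
  simp at m
  linarith

theorem isRatio_mul {p a x : ℝ} (ha : 0 < a) (hx : IsRatio p a x) :
    (2 + a) * x ^ p = 2 + a - 2 * p * (1 - x) := by
  have h := hx.2
  have : 2 + a ≠ 0 := by linarith
  field_simp at h
  linarith

/-- `a_k = 2 - x ^ (p - 1) (2 + a_{k-1})` satisfies `x ^ p a_{k-1} ≤ a_k ≤ a_{k-1}`. -/
theorem next_amplitude_bounds {p a x : ℝ} (hp : 2 < p) (ha : 0 < a) (hx : IsRatio p a x) :
    x ^ p * a ≤ 2 - x ^ (p - 1) * (2 + a) ∧ 2 - x ^ (p - 1) * (2 + a) ≤ a := by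
  have hx0 := hx.1.1
  have hx1 := hx.1.2
  have hm := isRatio_mul ha hx
  obtain ⟨s, hs, rfl⟩ : ∃ s, 0 < s ∧ x = Real.exp (-s) :=
    ⟨-Real.log x, by linarith [Real.log_neg hx0 hx1], by rw [neg_neg, Real.exp_log hx0]⟩
  set x := Real.exp (-s) with hxdef
  have hX : x ^ p = Real.exp (-(p * s)) := by rw [hxdef, ← Real.exp_mul]; ring_nf
  have hX1 : x ^ (p - 1) = x ^ p / x := by rw [Real.rpow_sub_one hx0.ne']
  set X := x ^ p with hXdef
  have hX0 : 0 < X := by positivity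
  have hXlt : X < 1 := Real.rpow_lt_one hx0.le hx1 (by linarith)
  have hxi : x * Real.exp s = 1 := by rw [hxdef, ← Real.exp_add]; simp
  have hXi : X * Real.exp (p * s) = 1 := by rw [hX, ← Real.exp_add]; simp
  have i1 := mul_sinh_le (c := p) (by linarith) hs.le
  rw [Real.sinh_eq, Real.sinh_eq, ← hX, ← hxdef] at i1
  have i2 := mul_sinh_le (c := p / (p - 2)) (s := (p - 2) * s / 2)
    (by rw [le_div_iff₀ (by linarith)]; linarith) (by have : 0 < p - 2 := by linarith
                                                      positivity)
  have hp2 : p - 2 ≠ 0 := by linarith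
  rw [show p / (p - 2) * ((p - 2) * s / 2) = p * s / 2 by field_simp, div_mul_eq_mul_div,
    div_le_iff₀ (by linarith)] at i2
  have e1 : x = Real.exp (-(p * s / 2)) * Real.exp ((p - 2) * s / 2) := by
    rw [← Real.exp_add, hxdef]; ring_nf
  have e2 : X / x = Real.exp (-(p * s / 2)) * Real.exp (-((p - 2) * s / 2)) := by
    rw [hX, hxdef, ← Real.exp_sub, ← Real.exp_add]; ring_nf
  have e3 : 1 = Real.exp (-(p * s / 2)) * Real.exp (p * s / 2) := by
    rw [← Real.exp_add]; simp
  have e4 : X = Real.exp (-(p * s / 2)) * Real.exp (-(p * s / 2)) := by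
    rw [hX, ← Real.exp_add]; ring_nf
  -- This is p sinh s ≤ sinh(ps) multiplied by 2X, where X = x^p = e^{-ps}.
  have k1 : 0 ≤ 1 - p * (X / x) + p * X * x - X ^ 2 := by
    have h1 : X / x = X * Real.exp s := by
      rw [div_eq_iff hx0.ne', mul_assoc, mul_comm (Real.exp s), hxi, mul_one]
    rw [h1]
    have : 0 ≤ X * (Real.exp (p * s) - X - p * (Real.exp s - x)) :=
      mul_nonneg hX0.le (by linarith)
    nlinarith
  -- This is p sinh((p-2)s/2) ≤ (p-2) sinh(ps/2) multiplied by 2e^{-ps/2}.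
  have k2 : p * (x - X / x) ≤ (p - 2) * (1 - X) := by
    rw [Real.sinh_eq, Real.sinh_eq] at i2
    have h1 : x - X / x = Real.exp (-(p * s / 2)) *
        (Real.exp ((p - 2) * s / 2) - Real.exp (-((p - 2) * s / 2))) := by
      rw [mul_sub, ← e2, ← e1]
    have h2 : 1 - X = Real.exp (-(p * s / 2)) *
        (Real.exp (p * s / 2) - Real.exp (-(p * s / 2))) := by
      rw [mul_sub, ← e3, ← e4]
    rw [h1, h2]
    have := mul_le_mul_of_nonneg_left i2 (Real.exp_pos (-(p * s / 2))).le
    linarith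
  have hXx : X / x * x = X := div_mul_cancel₀ _ hx0.ne'
  rw [hX1]
  generalize X / x = Y at *
  have hq : 0 < 1 - X := by linarith
  have hA : (2 + a) * (1 - X) = 2 * p * (1 - x) := by linarith
  constructor
  -- Multiplying by 1 - X allows a to be eliminated through (2 + a)(1 - X) = 2p(1 - x); what remains
  -- is twice `k1` here and twice `k2` in the other bound.
  · have : 0 ≤ (1 - X) * (2 - Y * (2 + a) - X * a) := by
      have e : (1 - X) * (2 - Y * (2 + a) - X * a) =
          2 * (1 - X) - (Y + X) * ((2 + a) * (1 - X)) + 2 * X * (1 - X) := by ring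
      rw [e, hA]
      nlinarith
    have := nonneg_of_mul_nonneg_right this hq
    linarith
  · have : 0 ≤ (1 - X) * (a - (2 - Y * (2 + a))) := by
      have e : (1 - X) * (a - (2 - Y * (2 + a))) =
          (1 + Y) * ((2 + a) * (1 - X)) - 4 * (1 - X) := by ring
      rw [e, hA]
      nlinarith
    have := nonneg_of_mul_nonneg_right this hq
    linarith

section Numbers

variable {p : ℝ}

theorem deltaSeq_succ_lt (hp : 2 < p) (k : ℕ) : deltaSeq p (k + 1) < deltaSeq p k :=
  (bubble_numbers_spec hp k).1.2

theorem deltaSeq_le_one (hp : 2 < p) (k : ℕ) : deltaSeq p k ≤ 1 := by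
  induction k with
  | zero => exact le_rfl
  | succ k ih => exact (deltaSeq_succ_lt hp k).le.trans ih

theorem aSeq_succ_bounds (hp : 2 < p) (k : ℕ) :
    ratio p (aSeq p k) ^ p * aSeq p k ≤ aSeq p (k + 1) ∧ aSeq p (k + 1) ≤ aSeq p k :=
  next_amplitude_bounds hp (aSeq_mem hp k).1 (isRatio_ratio hp (aSeq_mem hp k))

/-- Equality holds at k = 0, and in each step a loses at most the factor by which δ^p shrinks. This
keeps a_k away from 0 as long as δ_k is. -/
theorem two_mul_deltaSeq_rpow_le (hp : 2 < p) (k : ℕ) : 2 * deltaSeq p k ^ p ≤ aSeq p k := by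
  induction k with
  | zero => simp [deltaSeq, aSeq]
  | succ k ih =>
    have hx := (isRatio_ratio hp (aSeq_mem hp k)).1.1
    refine le_trans ?_ (aSeq_succ_bounds hp k).1
    rw [deltaSeq, Real.mul_rpow hx.le (deltaSeq_pos hp k).le]
    have : 0 < ratio p (aSeq p k) ^ p := by positivity
    nlinarith

/-- If the limit L were positive, the ratios would tend to 1; but a_{k+1} > 0 means ratio^{p-1} (2 +
a_k) < 2, while a_k ≥ 2L^p, and the limit reads 2 + 2L^p ≤ 2. -/
theorem tendsto_deltaSeq (hp : 2 < p) : Tendsto (deltaSeq p) atTop (𝓝 0) := by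
  have hanti : Antitone (deltaSeq p) := antitone_nat_of_succ_le fun k => (deltaSeq_succ_lt hp k).le
  have hL := tendsto_atTop_ciInf hanti ⟨0, by rintro _ ⟨k, rfl⟩; exact (deltaSeq_pos hp k).le⟩
  set L := ⨅ k, deltaSeq p k with hLdef
  have hL0 : 0 ≤ L := ge_of_tendsto' hL fun k => (deltaSeq_pos hp k).le
  have hLk : ∀ k, L ≤ deltaSeq p k := fun k => hanti.le_of_tendsto hL k
  rcases hL0.eq_or_lt with h | hpos
  · rwa [← h] at hL
  exfalso
  have hr : Tendsto (fun k => deltaSeq p (k + 1) / deltaSeq p k) atTop (𝓝 (L / L)) :=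
    (hL.comp (tendsto_add_atTop_nat 1)).div hL hpos.ne'
  rw [div_self hpos.ne'] at hr
  have hrp : Tendsto (fun k => (deltaSeq p (k + 1) / deltaSeq p k) ^ (p - 1)) atTop (𝓝 (1 ^ (p - 1))) :=
    hr.rpow_const (Or.inl one_ne_zero)
  rw [Real.one_rpow] at hrp
  have hlim := hrp.mul_const (2 + 2 * L ^ p)
  have : 1 * (2 + 2 * L ^ p) ≤ 2 := by
    refine le_of_tendsto' hlim fun k => ?_
    have h1 := (bubble_numbers_spec hp k).2.2.2
    have h2 := (aSeq_mem hp (k + 1)).1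
    have h3 := two_mul_deltaSeq_rpow_le hp k
    have h4 : L ^ p ≤ deltaSeq p k ^ p := Real.rpow_le_rpow hL0 (hLk k) (by linarith)
    have h5 : 0 < (deltaSeq p (k + 1) / deltaSeq p k) ^ (p - 1) :=
      Real.rpow_pos_of_pos (div_pos (deltaSeq_pos hp _) (deltaSeq_pos hp _)) _
    nlinarith
  have h6 : 0 < L ^ p := by positivity
  linarith

/-- The rescaled slope between the `k`-th and the `(k+1)`-st bubble. -/
noncomputable def bubbleSlope (p : ℝ) (k : ℕ) : ℝ :=
  (2 + aSeq p k) / (p * deltaSeq p k ^ (p - 1))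

theorem bubbleSlope_pos (hp : 2 < p) (k : ℕ) : 0 < bubbleSlope p k := by
  have h1 := (aSeq_mem hp k).1
  have h2 := deltaSeq_pos hp k
  unfold bubbleSlope
  positivity

/-- The same slope seen from the lower bubble. In units of 1/(p δ^{p-1}) the critical slope is 2,
the outgoing slope at a bubble is 2 + a and the incoming one is 2 - a, so a_k measures the jump. -/
theorem bubbleSlope_eq (hp : 2 < p) (k : ℕ) :
    bubbleSlope p k = (2 - aSeq p (k + 1)) / (p * deltaSeq p (k + 1) ^ (p - 1)) := by
  have hx := (isRatio_ratio hp (aSeq_mem hp k)).1.1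
  have hd := deltaSeq_pos hp k
  have : 0 < ratio p (aSeq p k) ^ (p - 1) := by positivity
  rw [bubbleSlope, deltaSeq, aSeq, Real.mul_rpow hx.le hd.le]
  field_simp
  ring

theorem bubbleSlope_lt_kap (hp : 2 < p) (k : ℕ) :
    bubbleSlope p k < kap p (deltaSeq p (k + 1)) := by
  have hd := deltaSeq_pos hp (k + 1)
  rw [bubbleSlope_eq hp, kap_eq hd]
  have := (aSeq_mem hp (k + 1)).1
  gcongr
  linarith

theorem kap_lt_bubbleSlope (hp : 2 < p) (k : ℕ) : kap p (deltaSeq p k) < bubbleSlope p k := by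
  have hd := deltaSeq_pos hp k
  rw [bubbleSlope, kap_eq hd]
  have := (aSeq_mem hp k).1
  gcongr
  linarith

theorem bubbleSlope_succ (hp : 2 < p) (k : ℕ) :
    2 * kap p (deltaSeq p (k + 1)) - bubbleSlope p k = bubbleSlope p (k + 1) := by
  have hd := deltaSeq_pos hp (k + 1)
  rw [bubbleSlope_eq hp, kap_eq hd, bubbleSlope]
  field_simp
  ring

/-- Twice the limit of the rescaled time between the `k`-th and the `(k+1)`-st bubble. -/
noncomputable def bubbleTime (p : ℝ) (k : ℕ) (y : ℝ) : ℝ :=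
  deltaSeq p k ^ p - 2 * (deltaSeq p k - y) / bubbleSlope p k

theorem bubbleTime_eq (hp : 2 < p) (k : ℕ) (y : ℝ) :
    bubbleTime p k y = deltaSeq p k ^ p *
      (2 + aSeq p k - 2 * p * (1 - y / deltaSeq p k)) / (2 + aSeq p k) := by
  have hd := deltaSeq_pos hp k
  have ha := (aSeq_mem hp k).1
  have e : deltaSeq p k ^ p = deltaSeq p k ^ (p - 1) * deltaSeq p k := by
    rw [← Real.rpow_add_one hd.ne']; ring_nf
  unfold bubbleTime bubbleSlope
  rw [e]
  field_simp

/-- The equation for the ratio δ_{k+1}/δ_k says precisely that the line leaving the bubble at δ_k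
meets the curve y^p at δ_{k+1}. -/
theorem bubbleTime_left (hp : 2 < p) (k : ℕ) :
    bubbleTime p k (deltaSeq p (k + 1)) = deltaSeq p (k + 1) ^ p := by
  have hd := deltaSeq_pos hp k
  have ha := (aSeq_mem hp k).1
  have hx := isRatio_ratio hp (aSeq_mem hp k)
  have hm := isRatio_mul ha hx
  rw [bubbleTime_eq hp, deltaSeq, mul_div_cancel_right₀ _ hd.ne', ← hm,
    Real.mul_rpow hx.1.1.le hd.le]
  field_simp

theorem bubbleTime_right (k : ℕ) : bubbleTime p k (deltaSeq p k) = deltaSeq p k ^ p := by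
  simp [bubbleTime]

/-- `bubbleTime` is the chord of the strictly convex function y^p over [δ_{k+1}, δ_k]. -/
theorem rpow_lt_bubbleTime (hp : 2 < p) (k : ℕ) {y : ℝ}
    (hy : y ∈ Ioo (deltaSeq p (k + 1)) (deltaSeq p k)) : y ^ p < bubbleTime p k y := by
  have hd := deltaSeq_pos hp (k + 1)
  have hs := (strictConvexOn_rpow (show 1 < p by linarith)).slope_strict_mono_adjacent
    (mem_Ici.2 hd.le) (mem_Ici.2 (deltaSeq_pos hp k).le) hy.1 hy.2
  have h1 := bubbleTime_left hp k
  have h2 := bubbleTime_right (p := p) k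
  have hc := bubbleSlope_pos hp k
  rw [div_lt_div_iff₀ (by linarith [hy.1]) (by linarith [hy.2]), ← h1, ← h2] at hs
  unfold bubbleTime at hs ⊢
  generalize bubbleSlope p k = c at *
  generalize deltaSeq p (k + 1) = x at *
  generalize deltaSeq p k = z at *
  generalize y ^ p = Y at *
  generalize z ^ p = Z at *
  have e : 2 * (z - y) / c = 2 / c * (z - y) := by ring
  have e' : 2 * (z - x) / c = 2 / c * (z - x) := by ring
  have e2 : 2 * (z - z) / c = 0 := by simp
  rw [e', e2] at hs
  rw [e]
  have hxz : 0 < z - x := by linarith [hy.1, hy.2]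
  by_contra! hle
  nlinarith

/-- For p ≤ 1 the curve lies below its tangent at 1, of slope p, which decreases twice as fast as
this line. For 1 < p ≤ 2 one has y^p < y, and the line lies above the diagonal because p/2 ≤ 1. -/
theorem rpow_lt_affine (hp0 : 0 < p) (hp : p ≤ 2) {y : ℝ} (h0 : 0 < y) (h1 : y < 1) :
    y ^ p < 1 ^ p - 2 * (1 - y) / (4 / p) := by
  have e : 2 * (1 - y) / (4 / p) = p / 2 * (1 - y) := by field_simp; ring
  rw [e, Real.one_rpow]
  rcases le_or_gt p 1 with hle | hgt
  · have := rpow_one_add_le_one_add_mul_self (s := y - 1) (by linarith) hp0.le hle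
    rw [show 1 + (y - 1) = y by ring] at this
    nlinarith
  · have : y ^ p < y ^ (1 : ℝ) := Real.rpow_lt_rpow_of_exponent_gt h0 h1 hgt
    rw [Real.rpow_one] at this
    nlinarith

end Numbers

/-! ### Uniqueness of the profile -/

namespace Profile

variable {p : ℝ} {σ b ψ : ℝ → ℝ}

theorem eq_of_le_two (P : Profile p σ b ψ) (hp0 : 0 < p) (hp : p ≤ 2) :
    ∀ y ∈ Ioo (0 : ℝ) 1, b y = 4 / p ∧ 2 * σ y = 1 - p / 2 * (1 - y) := by
  have := P.affine_extension le_rfl one_pos le_rfl (by positivity) (P.first_reflection hp0)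
    fun y hy => rpow_lt_affine hp0 hp hy.1 hy.2
  intro y hy
  obtain ⟨h1, h2⟩ := this y hy
  refine ⟨h1, h2.trans ?_⟩
  rw [Real.one_rpow]
  field_simp
  ring

theorem eq_of_two_lt (P : Profile p σ b ψ) (hp : 2 < p) (k : ℕ) :
    ∀ y ∈ Ioo (deltaSeq p (k + 1)) (deltaSeq p k),
      b y = bubbleSlope p k ∧ 2 * σ y = bubbleTime p k y := by
  induction k with
  | zero =>
    have h0 : bubbleSlope p 0 = 4 / p := by norm_num [bubbleSlope, aSeq, deltaSeq]
    have hs := P.first_reflection (by linarith)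
    rw [← h0] at hs
    exact P.affine_extension (deltaSeq_pos hp 1).le (deltaSeq_succ_lt hp 0) le_rfl
      (bubbleSlope_pos hp 0) hs fun y hy => rpow_lt_bubbleTime hp 0 hy
  | succ k ih =>
    have hs := P.next_reflection (by linarith) (deltaSeq_pos hp (k + 1)) (deltaSeq_succ_lt hp k)
      (deltaSeq_le_one hp k) (bubbleSlope_lt_kap hp k) (g := bubbleTime p k)
      (by unfold bubbleTime; fun_prop) (bubbleTime_left hp k)
      fun y hy => ⟨(ih y hy).1, (ih y hy).2, rpow_lt_bubbleTime hp k hy⟩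
    rw [bubbleSlope_succ hp] at hs
    exact P.affine_extension (deltaSeq_pos hp (k + 1 + 1)).le (deltaSeq_succ_lt hp (k + 1))
      (deltaSeq_le_one hp _) (bubbleSlope_pos hp (k + 1)) hs
      fun y hy => rpow_lt_bubbleTime hp (k + 1) hy

end Profile

/-! ### The minimum values of β_k -/

section Stars

variable {p : ℝ}

/-- The lower bound is equivalent to a_{k+1} > 0 once x^p is eliminated by the equation for the
ratio x. -/
theorem deltaStar_mem (hp : 2 < p) (k : ℕ) :
    deltaStar p k ∈ Ioo (deltaSeq p (k + 1)) (deltaSeq p k) := by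
  have hd := deltaSeq_pos hp k
  have ha := aSeq_mem hp k
  have hx := isRatio_ratio hp ha
  have hm := isRatio_mul ha.1 hx
  have ha' := (aSeq_mem hp (k + 1)).1
  rw [aSeq] at ha'
  have hx0 := hx.1.1
  have e : ratio p (aSeq p k) ^ p = ratio p (aSeq p k) ^ (p - 1) * ratio p (aSeq p k) := by
    rw [← Real.rpow_add_one hx0.ne']; ring_nf
  have hlt : ratio p (aSeq p k) < 1 - aSeq p k / (2 * (p - 1)) := by
    rw [lt_sub_iff_add_lt, ← lt_sub_iff_add_lt', div_lt_iff₀ (by linarith)]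
    rw [e] at hm
    nlinarith
  constructor
  · rw [deltaSeq, deltaStar]
    exact mul_lt_mul_of_pos_right hlt hd
  · rw [deltaStar]
    have : 0 < aSeq p k / (2 * (p - 1)) := div_pos ha.1 (by linarith)
    nlinarith

/-- Thus β_k(y) = β means y^p = β L(y) with L = `bubbleTime`/2, the crossing condition at relative
height y. -/
theorem betaFun_eq (hp : 2 < p) (k : ℕ) {y : ℝ} (hy : 0 ≤ y) :
    betaFun p k y = 2 * y ^ p / bubbleTime p k y := by
  have hd := deltaSeq_pos hp k
  have ha := (aSeq_mem hp k).1
  rw [bubbleTime_eq hp, betaFun, Real.div_rpow hy hd.le]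
  have : deltaSeq p k ^ p ≠ 0 := (Real.rpow_pos_of_pos hd p).ne'
  field_simp

theorem betaStar_eq (hp : 2 < p) (k : ℕ) :
    betaStar p k = (2 + aSeq p k) * (1 - aSeq p k / (2 * (p - 1))) ^ (p - 1) := by
  have hd := deltaSeq_pos hp k
  have ha := aSeq_mem hp k
  have hα : 0 < 1 - aSeq p k / (2 * (p - 1)) := by
    rw [sub_pos, div_lt_one (by linarith)]; linarith [ha.2]
  rw [betaStar, betaFun, deltaStar, mul_div_cancel_right₀ _ hd.ne', Real.rpow_sub_one hα.ne']
  have e : 2 + aSeq p k - 2 * p * (1 - (1 - aSeq p k / (2 * (p - 1))))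
      = 2 * (1 - aSeq p k / (2 * (p - 1))) := by
    have : p - 1 ≠ 0 := by linarith
    field_simp
    ring
  rw [e]
  field_simp

/-- The closed form of β_k^* is nonincreasing in a_k, and a_k is nonincreasing in k. Bernoulli's
inequality for (x'/x)^{p-1} replaces differentiation in a. -/
theorem betaStar_mono (hp : 2 < p) : Monotone (betaStar p) := by
  refine monotone_nat_of_le_succ fun k => ?_
  have ha := aSeq_mem hp k
  have ha' := aSeq_mem hp (k + 1)
  have hle := (aSeq_succ_bounds hp k).2
  rw [betaStar_eq hp, betaStar_eq hp]
  generalize aSeq p k = a at *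
  generalize aSeq p (k + 1) = a' at *
  have hp1 : 0 < 2 * (p - 1) := by linarith
  have hα : 0 < 1 - a / (2 * (p - 1)) := by
    rw [sub_pos, div_lt_one (by linarith)]; linarith [ha.2]
  have hα' : 0 < 1 - a' / (2 * (p - 1)) := by
    rw [sub_pos, div_lt_one (by linarith)]; linarith [ha'.2]
  set x := 1 - a / (2 * (p - 1)) with hx
  set x' := 1 - a' / (2 * (p - 1)) with hx'
  have hdiff : x' - x = (a - a') / (2 * (p - 1)) := by rw [hx, hx']; ring
  have hxx : 0 ≤ x' / x - 1 := by
    rw [sub_nonneg, le_div_iff₀ hα]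
    have : 0 ≤ (a - a') / (2 * (p - 1)) := div_nonneg (by linarith) hp1.le
    linarith
  have hb := one_add_mul_self_le_rpow_one_add (s := x' / x - 1) (p := p - 1) (by linarith)
    (by linarith)
  rw [show 1 + (x' / x - 1) = x' / x by ring, Real.div_rpow hα'.le hα.le,
    le_div_iff₀ (Real.rpow_pos_of_pos hα _)] at hb
  have e : (p - 1) * (x' / x - 1) = (a - a') / (2 * x) := by
    have e1 : x' / x - 1 = (a - a') / (2 * (p - 1)) / x := by rw [← hdiff]; field_simp
    have : p - 1 ≠ 0 := by linarith
    rw [e1]; field_simp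
  rw [e] at hb
  have hx1 : x ≤ 1 := by
    have : 0 ≤ a / (2 * (p - 1)) := div_nonneg ha.1.le hp1.le
    linarith
  have h2 : (2 + a) ≤ (2 + a') * (1 + (a - a') / (2 * x)) := by
    have : (a - a') / 2 ≤ (a - a') / (2 * x) :=
      div_le_div_of_nonneg_left (by linarith) (by linarith) (by linarith)
    nlinarith [ha'.1]
  have hxp := Real.rpow_pos_of_pos hα (p - 1)
  calc (2 + a) * x ^ (p - 1) ≤ (2 + a') * (1 + (a - a') / (2 * x)) * x ^ (p - 1) := by gcongr
    _ = (2 + a') * ((1 + (a - a') / (2 * x)) * x ^ (p - 1)) := by ring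
    _ ≤ (2 + a') * x' ^ (p - 1) := by
      have := ha'.1
      gcongr

end Stars

/-! ### Uniform estimates along a sequence of solutions -/

/-- Replace f(v) by its maximum f(μ) and integrate the equation twice from t = ∞. -/
theorem LogSol.slope_le_of_max {p : ℝ} {h : ℝ → ℝ} {lam mu : ℝ} {v w : ℝ → ℝ}
    (S : LogSol p h lam mu v w) (hH0 : CondH0 h)
    (hmax : ∀ x ∈ Icc 0 mu, nonlin p h x ≤ nonlin p h mu) {t : ℝ} (ht : 0 < t) :
    w t ≤ lam * nonlin p h mu * Real.exp (-(2 * t)) / 2 ∧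
      mu - v t ≤ lam * nonlin p h mu * Real.exp (-(2 * t)) / 4 := by
  have hexp : ∀ t : ℝ, HasDerivAt (fun t : ℝ => Real.exp (-(2 * t)))
      (Real.exp (-(2 * t)) * (-2)) t := fun t => by
    simpa using (((hasDerivAt_id t).const_mul (2 : ℝ)).neg).exp
  have hlim : Tendsto (fun t : ℝ => Real.exp (-(2 * t))) atTop (𝓝 0) :=
    Real.tendsto_exp_neg_atTop_nhds_zero.comp (tendsto_id.const_mul_atTop two_pos)
  set A := lam * nonlin p h mu with hA
  have h1 : ∀ t, 0 < t → w t ≤ A * Real.exp (-(2 * t)) / 2 := by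
    intro t ht
    have m := monotoneOn_of_hasDerivAt (convex_Ioi (0 : ℝ))
      (fun s hs => (S.hasDerivAt_slope s hs).sub (((hexp s).const_mul A).div_const 2))
      (fun s hs => by
        have h2 := hmax (v s) ⟨(S.pos s hs).le, S.le_top hH0 hs⟩
        have h3 := mul_nonneg (mul_pos S.lam_pos (Real.exp_pos (-(2 * s)))).le (sub_nonneg.2 h2)
        rw [hA]
        nlinarith)
    have l := (S.tendsto_slope hH0).sub ((hlim.const_mul A).div_const 2)
    have := ge_of_tendsto l (by
      filter_upwards [eventually_ge_atTop t] with s hs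
      exact m (mem_Ioi.2 ht) (mem_Ioi.2 (ht.trans_le hs)) hs)
    simp only [Pi.sub_apply] at this
    norm_num at this
    exact this
  refine ⟨h1 t ht, ?_⟩
  have m := antitoneOn_of_hasDerivAt (convex_Ioi (0 : ℝ))
    (fun s hs => (S.hasDerivAt s hs).add (((hexp s).const_mul A).div_const 4))
    (fun s hs => by linarith [h1 s hs])
  have l := S.tendsto_top.add ((hlim.const_mul A).div_const 4)
  have := le_of_tendsto l (by
    filter_upwards [eventually_ge_atTop t] with s hs
    exact m (mem_Ioi.2 ht) (mem_Ioi.2 (ht.trans_le hs)) hs)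
  simp only [Pi.add_apply] at this
  norm_num at this
  linarith

theorem rpow_sub_one_mul_self {p x : ℝ} (hx : 0 < x) : x ^ (p - 1) * x = x ^ p := by
  rw [← Real.rpow_add_one hx.ne']; ring_nf

/-- A sequence of solutions with heights `mu n → ∞`; `T n y` is a time at which the relative
height `y` is attained. -/
structure Family (p : ℝ) (h : ℝ → ℝ) (lam mu : ℕ → ℝ) (v w : ℕ → ℝ → ℝ) (T : ℕ → ℝ → ℝ) :
    Prop where
  p_pos : 0 < p
  condH0 : CondH0 h
  condH1 : CondH1 p h
  sol : ∀ n, LogSol p h (lam n) (mu n) (v n) (w n)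
  tendsto_mu : Tendsto mu atTop atTop
  time_pos : ∀ n y, 0 < y → y < 1 → 0 < T n y
  height : ∀ n y, 0 < y → y < 1 → v n (T n y) = y * mu n

/-- Rescaled time, normalized by its value for `log φ = 0` at height zero. -/
noncomputable def scaledTime (p : ℝ) (lam mu t : ℝ) : ℝ := (t - Real.log lam / 2) / mu ^ p

/-- The time `log (1 / γ)` of the first bubble. -/
noncomputable def firstTime (p : ℝ) (h : ℝ → ℝ) (lam mu : ℝ) : ℝ :=
  Real.log (p * lam * mu ^ (p - 1) * nonlin p h mu) / 2

namespace Family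

variable {p : ℝ} {h : ℝ → ℝ} {lam mu : ℕ → ℝ} {v w : ℕ → ℝ → ℝ} {T : ℕ → ℝ → ℝ}

theorem mu_pos (F : Family p h lam mu v w T) (n : ℕ) : 0 < mu n := (F.sol n).mu_pos F.condH0

theorem time_lt (F : Family p h lam mu v w T) (n : ℕ) {y₁ y₂ : ℝ} (h0 : 0 < y₁) (h12 : y₁ < y₂)
    (h1 : y₂ < 1) : T n y₁ < T n y₂ := by
  refine (F.sol n).lt_of_height_lt F.condH0 (F.time_pos n y₁ h0 (h12.trans h1))
    (F.time_pos n y₂ (h0.trans h12) h1) ?_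
  rw [F.height n y₁ h0 (h12.trans h1), F.height n y₂ (h0.trans h12) h1]
  exact mul_lt_mul_of_pos_right h12 (F.mu_pos n)

theorem tendsto_mu_rpow (F : Family p h lam mu v w T) :
    Tendsto (fun n => mu n ^ p) atTop atTop :=
  (tendsto_rpow_atTop F.p_pos).comp F.tendsto_mu

/-- Transfers a property valid at infinity to all times of relative height at least δ, uniformly in
t. -/
theorem eventually_height (F : Family p h lam mu v w T) {δ : ℝ} (hδ : 0 < δ) {R : ℝ → Prop}
    (hR : ∀ᶠ s in atTop, R s) : ∀ᶠ n in atTop, ∀ t, δ * mu n ≤ v n t → R (v n t) := by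
  obtain ⟨M, hM⟩ := eventually_atTop.1 hR
  filter_upwards [F.tendsto_mu.eventually_ge_atTop (M / δ)] with n hn t ht
  rw [div_le_iff₀ hδ] at hn
  exact hM _ (by linarith)

theorem eventually_h_pos (F : Family p h lam mu v w T) : ∀ᶠ s in atTop, 0 < h s := by
  obtain ⟨t₀, -, h0⟩ := F.condH0.eventually_pos
  filter_upwards [eventually_ge_atTop t₀] with s hs using h0 s hs

theorem exists_kap_le {p δ : ℝ} (hδ : 0 < δ) :
    ∃ C, 0 < C ∧ ∀ y ∈ Icc δ 1, kap p y ≤ C := by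
  obtain ⟨C, hC⟩ := (isCompact_Icc (a := δ) (b := 1)).bddAbove_image (f := kap p)
    fun y hy => (continuousAt_kap (hδ.trans_le hy.1)).continuousWithinAt
  refine ⟨max C 1, by positivity, fun y hy => (hC (mem_image_of_mem _ hy)).trans (le_max_left _ _)⟩

theorem exists_weight_bounds {p δ : ℝ} (hp : 0 < p) (hδ : 0 < δ) :
    ∃ c C, 0 < c ∧ 0 < C ∧ ∀ y ∈ Icc δ 1, c ≤ p * y ^ (p - 1) ∧ p * y ^ (p - 1) ≤ C := by
  have hcont : ContinuousOn (fun y : ℝ => p * y ^ (p - 1)) (Icc δ 1) := fun y hy =>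
    (continuousAt_const.mul (Real.continuousAt_rpow_const _ _
      (Or.inl (hδ.trans_le hy.1).ne'))).continuousWithinAt
  obtain ⟨C, hC⟩ := (isCompact_Icc (a := δ) (b := 1)).bddAbove_image hcont
  obtain ⟨C', hC', hk⟩ := exists_kap_le hδ
  refine ⟨2 / C', max C 1, by positivity, by positivity, fun y hy => ⟨?_,
    (hC (mem_image_of_mem _ hy)).trans (le_max_left _ _)⟩⟩
  have hy0 : 0 < y := hδ.trans_le hy.1
  have h1 := hk y hy
  rw [kap_eq hy0, div_le_iff₀ (by positivity)] at h1
  rw [div_le_iff₀ hC']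
  linarith

theorem exists_bound (F : Family p h lam mu v w T) {δ : ℝ} (hδ : 0 < δ) :
    ∃ C, 0 < C ∧ ∀ᶠ n in atTop, ∀ t, 0 < t → δ * mu n ≤ v n t →
      scaledSlope p (mu n) (w n) t ≤ C ∧ potential p h (lam n) (mu n) (v n) t ≤ C := by
  obtain ⟨C, hC, hk⟩ := exists_kap_le hδ
  refine ⟨max (4 * C) (4 * C ^ 2), by positivity, ?_⟩
  filter_upwards [F.eventually_height hδ F.eventually_h_pos, F.eventually_height hδ
    ((tendsto_relErr F.p_pos F.condH1).eventually (Metric.closedBall_mem_nhds 0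
      (show (0 : ℝ) < 1 / 2 by norm_num)))] with n h1 h2 t ht hv
  have hmu := F.mu_pos n
  obtain ⟨h3, h4⟩ := (F.sol n).slope_and_potential_le F.p_pos F.condH0 hC.le ht fun s hs => by
    have hs0 := ht.trans_le hs
    have hvs : δ * mu n ≤ v n s := hv.trans ((F.sol n).monotoneOn F.condH0 ht hs0 hs)
    refine ⟨h1 s hvs, hk _ ⟨?_, ?_⟩, by simpa using h2 s hvs⟩
    · rwa [le_div_iff₀ hmu]
    · rw [div_le_one hmu]; exact (F.sol n).le_top F.condH0 hs0
  exact ⟨h3.trans (le_max_left _ _), h4.trans (le_max_right _ _)⟩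

theorem eventually_kap_close (F : Family p h lam mu v w T) {y₁ y₂ κ η η' : ℝ} (h0 : 0 < y₁)
    (hη : η < η') (hk : ∀ y ∈ Icc y₁ y₂, |kap p y - κ| ≤ η) :
    ∀ᶠ n in atTop, ∀ t, 0 < t → y₁ * mu n ≤ v n t → v n t ≤ y₂ * mu n →
      0 < h (v n t) ∧
        |kap p (v n t / mu n) - relErr p h (v n t) * scaledSlope p (mu n) (w n) t - κ| ≤ η' := by
  obtain ⟨C, hC, hb⟩ := F.exists_bound h0
  have hpos : 0 < (η' - η) / C := div_pos (by linarith) hC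
  filter_upwards [hb, F.eventually_height h0 F.eventually_h_pos, F.eventually_height h0
    ((tendsto_relErr F.p_pos F.condH1).eventually (Metric.closedBall_mem_nhds 0 hpos))]
    with n h1 h2 h3 t ht hv1 hv2
  have hmu := F.mu_pos n
  refine ⟨h2 t hv1, ?_⟩
  have k1 := hk (v n t / mu n) ⟨by rwa [le_div_iff₀ hmu], by rwa [div_le_iff₀ hmu]⟩
  have k2 : |relErr p h (v n t)| ≤ (η' - η) / C := by simpa using h3 t hv1
  have k3 := (h1 t ht hv1).1
  have k4 := (F.sol n).scaledSlope_nonneg F.condH0 ht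
  have k5 : |relErr p h (v n t) * scaledSlope p (mu n) (w n) t| ≤ η' - η := by
    rw [abs_mul, abs_of_nonneg k4]
    calc _ ≤ (η' - η) / C * C := by gcongr
      _ = η' - η := by field_simp
  have := abs_sub (kap p (v n t / mu n) - κ) (relErr p h (v n t) * scaledSlope p (mu n) (w n) t)
  rw [show kap p (v n t / mu n) - relErr p h (v n t) * scaledSlope p (mu n) (w n) t - κ =
    kap p (v n t / mu n) - κ - relErr p h (v n t) * scaledSlope p (mu n) (w n) t by ring]
  linarith

theorem eventually_energy (F : Family p h lam mu v w T) {y₁ y₂ κ η η' : ℝ} (h0 : 0 < y₁)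
    (hη : η < η') (hk : ∀ y ∈ Icc y₁ y₂, |kap p y - κ| ≤ η) :
    ∀ᶠ n in atTop, ∀ t₁ t₂, 0 < t₁ → t₁ ≤ t₂ → y₁ * mu n ≤ v n t₁ → v n t₂ ≤ y₂ * mu n →
      |(scaledSlope p (mu n) (w n) t₁ ^ 2 / 2 + potential p h (lam n) (mu n) (v n) t₁)
        - (scaledSlope p (mu n) (w n) t₂ ^ 2 / 2 + potential p h (lam n) (mu n) (v n) t₂)
        - κ * (scaledSlope p (mu n) (w n) t₁ - scaledSlope p (mu n) (w n) t₂)|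
        ≤ η' * (scaledSlope p (mu n) (w n) t₁ - scaledSlope p (mu n) (w n) t₂) := by
  filter_upwards [F.eventually_kap_close h0 hη hk] with n hn t₁ t₂ ht1 ht12 hv1 hv2
  refine (F.sol n).abs_energy_sub_le F.p_pos F.condH0 ht1 ht12 fun t ht => ?_
  have ht0 : 0 < t := ht1.trans_le ht.1
  exact hn t ht0 (hv1.trans ((F.sol n).monotoneOn F.condH0 ht1 ht0 ht.1))
    (((F.sol n).monotoneOn F.condH0 ht0 (ht0.trans_le ht.2) ht.2).trans hv2)

theorem eventually_energy_top (F : Family p h lam mu v w T) {y₁ κ η η' : ℝ} (h0 : 0 < y₁)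
    (hη : η < η') (hk : ∀ y ∈ Icc y₁ 1, |kap p y - κ| ≤ η) :
    ∀ᶠ n in atTop, ∀ t₁, 0 < t₁ → y₁ * mu n ≤ v n t₁ →
      |scaledSlope p (mu n) (w n) t₁ ^ 2 / 2 + potential p h (lam n) (mu n) (v n) t₁
        - κ * scaledSlope p (mu n) (w n) t₁| ≤ η' * scaledSlope p (mu n) (w n) t₁ := by
  filter_upwards [F.eventually_kap_close h0 hη hk] with n hn t₁ ht1 hv1
  refine (F.sol n).abs_energy_le F.p_pos F.condH0 ht1 fun t ht => ?_
  have ht0 : 0 < t := ht1.trans_le ht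
  exact hn t ht0 (hv1.trans ((F.sol n).monotoneOn F.condH0 ht1 ht0 ht))
    (by rw [one_mul]; exact (F.sol n).le_top F.condH0 ht0)

theorem tendsto_log_mu_div (F : Family p h lam mu v w T) :
    Tendsto (fun n => Real.log (mu n) / mu n ^ p) atTop (𝓝 0) :=
  (isLittleO_log_rpow_atTop F.p_pos).tendsto_div_nhds_zero.comp F.tendsto_mu

/-- All factors of ψ other than λ, e^{-2t} and e^{v^p} are powers of μ and v, a constant, and h(v);
on relative heights at least δ their logarithms are o(μ^p). -/
theorem eventually_log_potential (F : Family p h lam mu v w T) {δ η : ℝ} (hδ : 0 < δ)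
    (hη : 0 < η) : ∀ᶠ n in atTop, ∀ t, 0 < t → δ * mu n ≤ v n t →
      0 < potential p h (lam n) (mu n) (v n) t ∧
      |Real.log (potential p h (lam n) (mu n) (v n) t)
        - (Real.log (lam n) - 2 * t + v n t ^ p)| ≤ η * mu n ^ p := by
  have hp := F.p_pos
  have e1 : ∀ᶠ n in atTop, 2 * |p - 1| * (Real.log (mu n) / mu n ^ p) +
      |Real.log p| / mu n ^ p ≤ η / 2 := by
    have l := (F.tendsto_log_mu_div.const_mul (2 * |p - 1|)).add
      (Tendsto.const_div_atTop F.tendsto_mu_rpow |Real.log p|)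
    rw [mul_zero, add_zero] at l
    exact l.eventually_le_const (by positivity)
  filter_upwards [e1, F.eventually_height hδ F.eventually_h_pos,
    F.eventually_height hδ (eventually_ge_atTop 1), F.eventually_height hδ
    ((tendsto_log_div_rpow hp F.condH0 F.condH1).eventually (Metric.closedBall_mem_nhds 0
      (half_pos hη)))] with n h1 h2 h3 h4 t ht hv
  have hmu := F.mu_pos n
  have hK : 0 < mu n ^ p := by positivity
  have hv1 := h3 t hv
  have hv0 : 0 < v n t := by linarith
  have hh := h2 t hv
  have hlam := (F.sol n).lam_pos
  have hle := (F.sol n).le_top F.condH0 ht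
  have hlog : |Real.log (h (v n t))| ≤ η / 2 * mu n ^ p := by
    have : |Real.log (h (v n t)) / v n t ^ p| ≤ η / 2 := by
      have := h4 t hv
      rwa [dist_zero_right, Real.norm_eq_abs] at this
    rw [abs_div, abs_of_pos (Real.rpow_pos_of_pos hv0 p), div_le_iff₀ (by positivity)] at this
    refine this.trans ?_
    gcongr
  have hm : 0 < mu n ^ (p - 1) := by positivity
  have hvp : 0 < v n t ^ (p - 1) := by positivity
  refine ⟨by unfold potential approxPrim nonlin; positivity, ?_⟩
  have e : Real.log (potential p h (lam n) (mu n) (v n) t) =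
      2 * ((p - 1) * Real.log (mu n)) + (Real.log (lam n) + -(2 * t) +
        (Real.log (h (v n t)) + v n t ^ p - (Real.log p + (p - 1) * Real.log (v n t)))) := by
    unfold potential approxPrim nonlin
    rw [Real.log_mul (by positivity) (by positivity), Real.log_mul (by positivity) (by positivity),
      Real.log_mul hlam.ne' (Real.exp_pos _).ne', Real.log_div (by positivity) (by positivity),
      Real.log_mul hh.ne' (Real.exp_pos _).ne', Real.log_mul hp.ne' hvp.ne', Real.log_exp,
      Real.log_exp, Real.log_pow, Real.log_rpow hmu, Real.log_rpow hv0]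
    push_cast
    ring
  rw [e]
  have l0 : 0 ≤ Real.log (v n t) := Real.log_nonneg hv1
  have l1 : Real.log (v n t) ≤ Real.log (mu n) := Real.log_le_log hv0 hle
  have h5 : |(p - 1) * (2 * Real.log (mu n) - Real.log (v n t))| ≤
      2 * |p - 1| * Real.log (mu n) := by
    rw [abs_mul, abs_of_nonneg (by linarith : 0 ≤ 2 * Real.log (mu n) - Real.log (v n t))]
    nlinarith [abs_nonneg (p - 1)]
  have h6 : 2 * |p - 1| * Real.log (mu n) + |Real.log p| ≤ η / 2 * mu n ^ p := by
    have := mul_le_mul_of_nonneg_right h1 hK.le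
    rw [add_mul, div_mul_cancel₀ _ hK.ne', mul_assoc, div_mul_cancel₀ _ hK.ne'] at this
    exact this
  rw [abs_le] at hlog h5 ⊢
  have h7 := abs_le.1 (le_refl |Real.log p|)
  constructor <;> linarith

theorem tendsto_firstTime (F : Family p h lam mu v w T) :
    Tendsto (fun n => scaledTime p (lam n) (mu n) (firstTime p h (lam n) (mu n))) atTop
      (𝓝 (1 / 2)) := by
  have hp := F.p_pos
  have l := ((((F.tendsto_log_mu_div.const_mul (p - 1)).add
    (Tendsto.const_div_atTop F.tendsto_mu_rpow (Real.log p))).add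
    ((tendsto_log_div_rpow hp F.condH0 F.condH1).comp F.tendsto_mu)).add_const 1).div_const 2
  rw [mul_zero, add_zero, add_zero, zero_add] at l
  refine l.congr' ?_
  filter_upwards [F.tendsto_mu.eventually F.eventually_h_pos] with n hn
  have hmu := F.mu_pos n
  have hlam := (F.sol n).lam_pos
  have hm : 0 < mu n ^ (p - 1) := by positivity
  have hK : 0 < mu n ^ p := by positivity
  unfold scaledTime firstTime nonlin
  rw [Real.log_mul (by positivity) (by positivity), Real.log_mul (by positivity) (by positivity),
      Real.log_mul hp.ne' hlam.ne',
      Real.log_mul hn.ne' (Real.exp_pos _).ne', Real.log_exp, Real.log_rpow hmu]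
  simp only [Function.comp]
  field_simp
  ring

/-- Near the top, `4 p mu ^ p (1 - v / mu) ≤ exp (2 (firstTime - t))`. -/
theorem eventually_top (F : Family p h lam mu v w T) : ∀ᶠ n in atTop,
    0 < nonlin p h (mu n) ∧ (∀ x ∈ Icc 0 (mu n), nonlin p h x ≤ nonlin p h (mu n)) ∧
    ∀ t, 0 < t → 2 * p * scaledSlope p (mu n) (w n) t ≤
        Real.exp (2 * (firstTime p h (lam n) (mu n) - t)) ∧
      4 * p * mu n ^ p * (1 - v n t / mu n) ≤
        Real.exp (2 * (firstTime p h (lam n) (mu n) - t)) := by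
  have hp := F.p_pos
  filter_upwards [F.tendsto_mu.eventually (eventually_nonlin_le hp F.condH0 F.condH1),
    F.tendsto_mu.eventually F.eventually_h_pos] with n hn hn2
  have hmu := F.mu_pos n
  have hlam := (F.sol n).lam_pos
  have hm : 0 < mu n ^ (p - 1) := by positivity
  have hf : 0 < nonlin p h (mu n) := mul_pos hn2 (Real.exp_pos _)
  refine ⟨hf, hn, fun t ht => ?_⟩
  obtain ⟨h1, h2⟩ := (F.sol n).slope_le_of_max F.condH0 hn ht
  have e : Real.exp (2 * (firstTime p h (lam n) (mu n) - t)) =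
      p * mu n ^ (p - 1) * (lam n * nonlin p h (mu n) * Real.exp (-(2 * t))) := by
    rw [show 2 * (firstTime p h (lam n) (mu n) - t) =
      Real.log (p * lam n * mu n ^ (p - 1) * nonlin p h (mu n)) + -(2 * t) by
        unfold firstTime; ring, Real.exp_add, Real.exp_log (by positivity)]
    ring
  have hpm : 0 < p * mu n ^ (p - 1) := by positivity
  rw [e]
  constructor
  · unfold scaledSlope
    have := mul_le_mul_of_nonneg_left h1 hpm.le
    linarith
  · have e2 : 4 * p * mu n ^ p * (1 - v n t / mu n) =
        4 * (p * mu n ^ (p - 1) * (mu n - v n t)) := by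
      rw [← rpow_sub_one_mul_self hmu]; field_simp
    rw [e2]
    have := mul_le_mul_of_nonneg_left h2 hpm.le
    linarith

/-- At a fixed y < 1 the quantity 4p μ^p (1 - y) exceeds 1 for large n, so the estimate near the top
puts the time before `firstTime`, whose rescaled value tends to 1/2. -/
theorem eventually_time_le (F : Family p h lam mu v w T) {y η : ℝ} (h0 : 0 < y) (h1 : y < 1)
    (hη : 0 < η) : ∀ᶠ n in atTop, 2 * scaledTime p (lam n) (mu n) (T n y) ≤ 1 + η := by
  have hp := F.p_pos
  have hq : 0 < 4 * p * (1 - y) := mul_pos (by positivity) (by linarith)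
  filter_upwards [F.eventually_top, F.tendsto_mu_rpow.eventually_ge_atTop (1 / (4 * p * (1 - y))),
    F.tendsto_firstTime.eventually_le_const (show 1 / 2 < (1 + η) / 2 by linarith)] with n hn hK hf
  have hmu := F.mu_pos n
  have hKpos : 0 < mu n ^ p := by positivity
  have h2 := (hn.2.2 _ (F.time_pos n y h0 h1)).2
  rw [F.height n y h0 h1, mul_div_cancel_right₀ _ hmu.ne'] at h2
  rw [div_le_iff₀ hq] at hK
  have h3 : 1 ≤ Real.exp (2 * (firstTime p h (lam n) (mu n) - T n y)) := by nlinarith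
  rw [Real.one_le_exp_iff] at h3
  have h4 : scaledTime p (lam n) (mu n) (T n y) ≤
      scaledTime p (lam n) (mu n) (firstTime p h (lam n) (mu n)) := by
    unfold scaledTime
    gcongr
    linarith
  linarith

theorem log_eq (F : Family p h lam mu v w T) (n : ℕ) {y : ℝ} (h0 : 0 < y) (h1 : y < 1) :
    Real.log (lam n) - 2 * T n y + v n (T n y) ^ p =
      (y ^ p - 2 * scaledTime p (lam n) (mu n) (T n y)) * mu n ^ p := by
  have hmu := F.mu_pos n
  have hKpos : 0 < mu n ^ p := by positivity
  rw [F.height n y h0 h1, Real.mul_rpow h0.le hmu.le]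
  unfold scaledTime
  field_simp
  ring

/-- ψ is bounded, while log ψ = (y^p - 2σ) μ^p + o(μ^p); a positive exponent would make ψ blow up.
-/
theorem eventually_le_time (F : Family p h lam mu v w T) {y η : ℝ} (h0 : 0 < y) (h1 : y < 1)
    (hη : 0 < η) : ∀ᶠ n in atTop, y ^ p - η ≤ 2 * scaledTime p (lam n) (mu n) (T n y) := by
  obtain ⟨C, hC, hb⟩ := F.exists_bound h0
  filter_upwards [hb, F.eventually_log_potential h0 (half_pos hη),
    F.tendsto_mu_rpow.eventually_ge_atTop (Real.log C / (η / 2))] with n hn1 hn2 hK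
  have hmu := F.mu_pos n
  have hKpos : 0 < mu n ^ p := by positivity
  have hT := F.time_pos n y h0 h1
  have hv := (F.height n y h0 h1).ge
  obtain ⟨k1, k2⟩ := hn2 _ hT hv
  have k3 := Real.log_le_log k1 (hn1 _ hT hv).2
  rw [F.log_eq n h0 h1] at k2
  rw [div_le_iff₀ (half_pos hη)] at hK
  have k4 := (abs_le.1 k2).1
  by_contra! hlt
  nlinarith

theorem mul_scaledTime_sub (F : Family p h lam mu v w T) (n : ℕ) (t₁ t₂ : ℝ) :
    t₂ - t₁ = mu n ^ p * (scaledTime p (lam n) (mu n) t₂ - scaledTime p (lam n) (mu n) t₁) := by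
  have hmu := F.mu_pos n
  have hKpos : 0 < mu n ^ p := by positivity
  unfold scaledTime
  field_simp
  ring

theorem sub_le (F : Family p h lam mu v w T) (n : ℕ) {y₁ y₂ : ℝ} (h0 : 0 < y₁) (h12 : y₁ < y₂)
    (h1 : y₂ < 1) : y₂ - y₁ ≤ scaledSlope p (mu n) (w n) (T n y₁) *
      (scaledTime p (lam n) (mu n) (T n y₂) - scaledTime p (lam n) (mu n) (T n y₁)) := by
  have hmu := F.mu_pos n
  have h2 := (F.sol n).sub_le F.condH0 (F.time_pos n y₁ h0 (h12.trans h1))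
    (F.time_lt n h0 h12 h1).le
  rw [F.height n y₁ h0 (h12.trans h1), F.height n y₂ (h0.trans h12) h1,
    F.mul_scaledTime_sub n (T n y₁), ← rpow_sub_one_mul_self hmu] at h2
  unfold scaledSlope
  refine le_of_mul_le_mul_right ?_ hmu
  linarith

theorem le_sub (F : Family p h lam mu v w T) (n : ℕ) {y₁ y₂ : ℝ} (h0 : 0 < y₁) (h12 : y₁ < y₂)
    (h1 : y₂ < 1) : scaledSlope p (mu n) (w n) (T n y₂) *
      (scaledTime p (lam n) (mu n) (T n y₂) - scaledTime p (lam n) (mu n) (T n y₁)) ≤ y₂ - y₁ := by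
  have hmu := F.mu_pos n
  have h2 := (F.sol n).le_sub F.condH0 (F.time_pos n y₁ h0 (h12.trans h1))
    (F.time_lt n h0 h12 h1).le
  rw [F.height n y₁ h0 (h12.trans h1), F.height n y₂ (h0.trans h12) h1,
    F.mul_scaledTime_sub n (T n y₁), ← rpow_sub_one_mul_self hmu] at h2
  unfold scaledSlope
  refine le_of_mul_le_mul_right ?_ hmu
  linarith

/-- If `ψ` is exponentially small between two heights then the slope does not change. -/
theorem tendsto_slope_sub (F : Family p h lam mu v w T) {y₁ y₂ c : ℝ} (h0 : 0 < y₁)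
    (h12 : y₁ < y₂) (h1 : y₂ < 1) {U : Filter ℕ} (hU : U ≤ atTop) (hc : 0 < c)
    (hneg : ∀ᶠ n in U, y₂ ^ p - 2 * scaledTime p (lam n) (mu n) (T n y₁) ≤ -(2 * c)) :
    Tendsto (fun n => scaledSlope p (mu n) (w n) (T n y₁) - scaledSlope p (mu n) (w n) (T n y₂))
      U (𝓝 0) := by
  have hp := F.p_pos
  obtain ⟨_, C, _, hC, hw⟩ := exists_weight_bounds hp h0
  have hlim : Tendsto (fun n => C * 2 * (mu n ^ p * Real.exp (-c * mu n ^ p))) atTop (𝓝 0) := by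
    have l := (tendsto_rpow_mul_exp_neg_mul_atTop_nhds_zero 1 c hc).comp F.tendsto_mu_rpow
    simpa using l.const_mul (C * 2)
  refine squeeze_zero' ?_ ?_ (hlim.mono_left hU)
  · exact Eventually.of_forall fun n => sub_nonneg.2
      ((F.sol n).scaledSlope_anti F.condH0 (F.time_pos n y₁ h0 (h12.trans h1))
        (F.time_lt n h0 h12 h1).le)
  · filter_upwards [hneg, hU (F.eventually_log_potential h0 hc),
      hU (F.eventually_le_time h0 (h12.trans h1) one_pos),
      hU (F.eventually_time_le (h0.trans h12) h1 one_pos)] with n hn1 hn2 hn3 hn4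
    have hmu := F.mu_pos n
    have hKpos : 0 < mu n ^ p := by positivity
    have hT1 := F.time_pos n y₁ h0 (h12.trans h1)
    have hT12 := F.time_lt n h0 h12 h1
    have hT2 := hT1.trans hT12
    have key := (F.sol n).slope_sub_le hp F.condH0 (A := C * Real.exp (-c * mu n ^ p))
      hT1 hT12.le fun t ht => by
        have ht0 := hT1.trans_le ht.1
        have hv1 : y₁ * mu n ≤ v n t := by
          rw [← F.height n y₁ h0 (h12.trans h1)]
          exact (F.sol n).monotoneOn F.condH0 hT1 ht0 ht.1
        have hv2 : v n t ≤ y₂ * mu n := by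
          rw [← F.height n y₂ (h0.trans h12) h1]
          exact (F.sol n).monotoneOn F.condH0 ht0 hT2 ht.2
        obtain ⟨k1, k2⟩ := hn2 t ht0 hv1
        have k3 := hw (v n t / mu n) ⟨by rwa [le_div_iff₀ hmu], by
          rw [div_le_one hmu]; exact (F.sol n).le_top F.condH0 ht0⟩
        have k4 : v n t ^ p ≤ y₂ ^ p * mu n ^ p := by
          rw [← Real.mul_rpow (h0.trans h12).le hmu.le]
          exact Real.rpow_le_rpow ((F.sol n).pos t ht0).le hv2 hp.le
        have k5 : potential p h (lam n) (mu n) (v n) t ≤ Real.exp (-c * mu n ^ p) := by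
          rw [← Real.log_le_iff_le_exp k1]
          have k6 := (abs_le.1 k2).2
          have k7 : 2 * T n y₁ - Real.log (lam n) =
              2 * scaledTime p (lam n) (mu n) (T n y₁) * mu n ^ p := by
            unfold scaledTime; field_simp
          have k8 := mul_le_mul_of_nonneg_right hn1 hKpos.le
          linarith [ht.1]
        exact mul_le_mul k3.2 k5 k1.le hC.le
    refine key.trans ?_
    rw [F.mul_scaledTime_sub n]
    have h5 : scaledTime p (lam n) (mu n) (T n y₂) - scaledTime p (lam n) (mu n) (T n y₁) ≤ 2 := by
      have : 0 < y₁ ^ p := by positivity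
      linarith
    calc _ ≤ C * Real.exp (-c * mu n ^ p) * (mu n ^ p * 2) := by gcongr
      _ = _ := by ring

end Family

/-! ### Passage to the limit along ultrafilters -/

theorem exists_tendsto_ultrafilter (U : Ultrafilter ℕ) {x : ℕ → ℝ} {a b : ℝ}
    (hx : ∀ᶠ n in (U : Filter ℕ), x n ∈ Icc a b) : ∃ l, Tendsto x U (𝓝 l) := by
  obtain ⟨l, -, hl⟩ := (isCompact_Icc (a := a) (b := b)).ultrafilter_le_nhds (U.map x)
    (le_principal_iff.2 hx)
  exact ⟨l, hl⟩

theorem le_mul_of_forall_pos_add {X D η : ℝ} (hX : ∀ ε > 0, X ≤ (η + ε) * D) : X ≤ η * D := by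
  have l : Tendsto (fun ε : ℝ => (η + ε) * D) (𝓝[>] 0) (𝓝 ((η + 0) * D)) :=
    (Continuous.tendsto (by fun_prop) 0).mono_left nhdsWithin_le_nhds
  rw [add_zero] at l
  refine ge_of_tendsto l ?_
  filter_upwards [self_mem_nhdsWithin] with ε hε using hX ε hε

namespace Family

variable {p : ℝ} {h : ℝ → ℝ} {lam mu : ℕ → ℝ} {v w : ℕ → ℝ → ℝ} {T : ℕ → ℝ → ℝ}

/-- The energy law bounds the oscillation of ψ between the two heights by a multiple of the slope
difference. If ψ at the middle height exceeded this by A > 0, then ψ ≥ A throughout a time interval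
of length at least of order μ^p; the slope would drop by at least a multiple of A μ^p, yet it is
bounded, so A = O(μ^{-p}). -/
theorem potential_le_slope_sub (F : Family p h lam mu v w T) {y₀ : ℝ} (h0 : 0 < y₀) :
    ∃ C, ∀ (U : Filter ℕ) [U.NeBot], U ≤ atTop → ∀ y₁ y y₂, y₀ < y₁ → y₁ < y → y < y₂ → y₂ < 1 →
      ∀ ψ b₁ b₂,
      Tendsto (fun n => potential p h (lam n) (mu n) (v n) (T n y)) U (𝓝 ψ) →
      Tendsto (fun n => scaledSlope p (mu n) (w n) (T n y₁)) U (𝓝 b₁) →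
      Tendsto (fun n => scaledSlope p (mu n) (w n) (T n y₂)) U (𝓝 b₂) →
      ψ ≤ C * (b₁ - b₂) := by
  have hp := F.p_pos
  obtain ⟨M, hM, hk⟩ := exists_kap_le (p := p) h0
  obtain ⟨c, _, hc, _, hw⟩ := exists_weight_bounds hp h0
  obtain ⟨C, hC, hb⟩ := F.exists_bound h0
  refine ⟨M + 1 + C, fun U _ hU y₁ y y₂ hy0 hy1 hy2 hy3 ψ b₁ b₂ lψ l1 l2 => ?_⟩
  have hy1pos := h0.trans hy0
  have hypos := hy1pos.trans hy1
  -- A crude use of the energy law, with κ = 0 and tolerance M + 1: only the size of the change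
  -- matters here.
  have hE := F.eventually_energy (y₁ := y₀) (y₂ := 1) (κ := 0) (η := M) (η' := M + 1) h0
    (by linarith) fun z hz => by
      rw [sub_zero, abs_of_pos (kap_pos hp (h0.trans_le hz.1))]; exact hk z hz
  have lK : Tendsto (fun n => C * C / (c * (y₂ - y₁)) / mu n ^ p) U (𝓝 0) :=
    (Tendsto.const_div_atTop F.tendsto_mu_rpow _).mono_left hU
  have lA := lψ.sub ((l1.sub l2).const_mul (M + 1 + C))
  have key := le_of_tendsto_of_tendsto lA lK ?_
  · linarith
  filter_upwards [hU hE, hU hb] with n hE hb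
  have hmu := F.mu_pos n
  have hKpos : 0 < mu n ^ p := by positivity
  have hT1 := F.time_pos n y₁ hy1pos (by linarith)
  have hTy := F.time_lt n hy1pos hy1 (by linarith)
  have hTy2 := F.time_lt n hypos hy2 hy3
  have hT2 := hT1.trans (hTy.trans hTy2)
  have hle : ∀ t, 0 < t → v n t ≤ 1 * mu n := fun t ht => by
    rw [one_mul]; exact (F.sol n).le_top F.condH0 ht
  have hge : ∀ t, T n y₁ ≤ t → y₀ * mu n ≤ v n t := fun t ht => by
    have h2 := (F.sol n).monotoneOn F.condH0 hT1 (mem_Ioi.2 (hT1.trans_le ht)) ht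
    rw [F.height n y₁ hy1pos (by linarith)] at h2
    nlinarith
  set B : ℝ → ℝ := scaledSlope p (mu n) (w n) with hB
  set Ψ : ℝ → ℝ := potential p h (lam n) (mu n) (v n) with hΨ
  have hanti : ∀ s t, 0 < s → s ≤ t → B t ≤ B s := fun s t hs hst =>
    (F.sol n).scaledSlope_anti F.condH0 hs hst
  have hBC : ∀ t, T n y₁ ≤ t → 0 ≤ B t ∧ B t ≤ C := fun t ht =>
    ⟨(F.sol n).scaledSlope_nonneg F.condH0 (hT1.trans_le ht),
      (hb t (hT1.trans_le ht) (hge t ht)).1⟩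
  set A := Ψ (T n y) - (M + 1 + C) * (B (T n y₁) - B (T n y₂)) with hA
  have hpair : ∀ s t, T n y₁ ≤ s → s ≤ t → t ≤ T n y₂ →
      |Ψ s - Ψ t| ≤ (M + 1 + C) * (B (T n y₁) - B (T n y₂)) := by
    intro s t hs hst ht
    have hs0 := hT1.trans_le hs
    have h2 := hE s t hs0 hst (hge s hs) (hle t (hs0.trans_le hst))
    have h3 := hanti s t hs0 hst
    have h4 := hanti _ s hT1 hs
    have h5 := hanti t _ (hs0.trans_le hst) ht
    have h6 := hBC s hs
    have h7 := hBC t (hs.trans hst)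
    rw [zero_mul, sub_zero, abs_le] at h2
    have h8 : |B s ^ 2 / 2 - B t ^ 2 / 2| ≤ C * (B s - B t) := by
      rw [show B s ^ 2 / 2 - B t ^ 2 / 2 = (B s + B t) / 2 * (B s - B t) by ring, abs_mul,
        abs_of_nonneg (by linarith : 0 ≤ (B s + B t) / 2),
        abs_of_nonneg (by linarith : 0 ≤ B s - B t)]
      have : 0 ≤ B s - B t := by linarith
      gcongr
      linarith
    rw [abs_le] at h8 ⊢
    have h9 : (M + 1 + C) * (B s - B t) ≤ (M + 1 + C) * (B (T n y₁) - B (T n y₂)) := by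
      gcongr
    constructor <;> linarith [h8.1, h8.2]
  have hlow : ∀ t ∈ Icc (T n y₁) (T n y₂), A ≤ Ψ t := by
    intro t ht
    rcases le_total t (T n y) with h2 | h2
    · have := (abs_le.1 (hpair t _ ht.1 h2 hTy2.le)).1
      linarith
    · have := (abs_le.1 (hpair _ t hTy.le h2 ht.2)).2
      linarith
  rcases le_or_gt A 0 with hneg | hpos
  · refine le_trans hneg ?_
    have : 0 < y₂ - y₁ := by linarith
    positivity
  have h2 := (F.sol n).le_slope_sub hp F.condH0 (A := c * A) hT1 (hTy.trans hTy2).le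
    fun t ht => by
      have ht0 := hT1.trans_le ht.1
      have h3 := (hw (v n t / mu n) ⟨by rw [le_div_iff₀ hmu]; exact hge t ht.1, by
        rw [div_le_one hmu]; exact (F.sol n).le_top F.condH0 ht0⟩).1
      exact mul_le_mul h3 (hlow t ht) hpos.le (hc.le.trans h3)
  rw [F.mul_scaledTime_sub n] at h2
  have h3 := F.sub_le n hy1pos (hy1.trans hy2) hy3
  have h4 := hBC (T n y₁) le_rfl
  have h5 := hBC (T n y₂) (hTy.trans hTy2).le
  set D := scaledTime p (lam n) (mu n) (T n y₂) - scaledTime p (lam n) (mu n) (T n y₁) with hD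
  have hD0 : 0 ≤ D := by
    by_contra! hlt
    nlinarith
  have h6 : y₂ - y₁ ≤ C * D := h3.trans (by gcongr; exact h4.2)
  have h7 : c * A * (mu n ^ p * D) ≤ C := by
    refine h2.trans ?_
    show B (T n y₁) - B (T n y₂) ≤ C
    linarith
  rw [div_div, le_div_iff₀ (by have : 0 < y₂ - y₁ := by linarith
                               positivity)]
  have h8 : 0 ≤ c * A * mu n ^ p := by positivity
  calc A * (c * (y₂ - y₁) * mu n ^ p) = c * A * mu n ^ p * (y₂ - y₁) := by ring
    _ ≤ c * A * mu n ^ p * (C * D) := by gcongr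
    _ = C * (c * A * (mu n ^ p * D)) := by ring
    _ ≤ C * C := by gcongr

/-- An ultrafilter yields limits at all the uncountably many heights at once, whereas a diagonal
subsequence would reach only countably many. Each field is a finite-n estimate passed to the limit.
-/
theorem exists_profile (F : Family p h lam mu v w T) (U : Ultrafilter ℕ)
    (hU : (U : Filter ℕ) ≤ atTop) :
    ∃ σ b ψ : ℝ → ℝ, Profile p σ b ψ ∧ ∀ y, 0 < y → y < 1 →
      Tendsto (fun n => scaledTime p (lam n) (mu n) (T n y)) U (𝓝 (σ y)) ∧
      Tendsto (fun n => scaledSlope p (mu n) (w n) (T n y)) U (𝓝 (b y)) ∧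
      Tendsto (fun n => potential p h (lam n) (mu n) (v n) (T n y)) U (𝓝 (ψ y)) := by
  have hp := F.p_pos
  have exσ : ∀ y, ∃ l, 0 < y → y < 1 →
      Tendsto (fun n => scaledTime p (lam n) (mu n) (T n y)) U (𝓝 l) := by
    intro y
    by_cases hy : 0 < y ∧ y < 1
    · obtain ⟨l, hl⟩ := exists_tendsto_ultrafilter U (a := (y ^ p - 1) / 2) (b := 1)
        (x := fun n => scaledTime p (lam n) (mu n) (T n y)) (by
          filter_upwards [hU (F.eventually_le_time hy.1 hy.2 one_pos),
            hU (F.eventually_time_le hy.1 hy.2 one_pos)] with n h1 h2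
          constructor <;> linarith)
      exact ⟨l, fun _ _ => hl⟩
    · exact ⟨0, fun h1 h2 => absurd ⟨h1, h2⟩ hy⟩
  have exb : ∀ y, ∃ l, 0 < y → y < 1 →
      Tendsto (fun n => scaledSlope p (mu n) (w n) (T n y)) U (𝓝 l) := by
    intro y
    by_cases hy : 0 < y ∧ y < 1
    · obtain ⟨C, -, hb⟩ := F.exists_bound hy.1
      obtain ⟨l, hl⟩ := exists_tendsto_ultrafilter U (a := 0) (b := C)
        (x := fun n => scaledSlope p (mu n) (w n) (T n y)) (by
          filter_upwards [hU hb] with n h1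
          have ht := F.time_pos n y hy.1 hy.2
          exact ⟨(F.sol n).scaledSlope_nonneg F.condH0 ht, (h1 _ ht (F.height n y hy.1 hy.2).ge).1⟩)
      exact ⟨l, fun _ _ => hl⟩
    · exact ⟨0, fun h1 h2 => absurd ⟨h1, h2⟩ hy⟩
  have exψ : ∀ y, ∃ l, 0 < y → y < 1 →
      Tendsto (fun n => potential p h (lam n) (mu n) (v n) (T n y)) U (𝓝 l) := by
    intro y
    by_cases hy : 0 < y ∧ y < 1
    · obtain ⟨C, -, hb⟩ := F.exists_bound hy.1
      obtain ⟨l, hl⟩ := exists_tendsto_ultrafilter U (a := 0) (b := C)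
        (x := fun n => potential p h (lam n) (mu n) (v n) (T n y)) (by
          filter_upwards [hU hb] with n h1
          have ht := F.time_pos n y hy.1 hy.2
          exact ⟨(F.sol n).potential_nonneg hp F.condH0 ht,
            (h1 _ ht (F.height n y hy.1 hy.2).ge).2⟩)
      exact ⟨l, fun _ _ => hl⟩
    · exact ⟨0, fun h1 h2 => absurd ⟨h1, h2⟩ hy⟩
  choose σ hσ using exσ
  choose b hb using exb
  choose ψ hψ using exψ
  refine ⟨σ, b, ψ, ?_, fun y h0 h1 => ⟨hσ y h0 h1, hb y h0 h1, hψ y h0 h1⟩⟩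
  refine ⟨?_, ?_, ?_, ?_, ?_, ?_, ?_, ?_, ?_, ?_, ?_, ?_⟩
  · exact fun y h0 h1 => ge_of_tendsto' (hb y h0 h1) fun n =>
      (F.sol n).scaledSlope_nonneg F.condH0 (F.time_pos n y h0 h1)
  · exact fun y h0 h1 => ge_of_tendsto' (hψ y h0 h1) fun n =>
      (F.sol n).potential_nonneg hp F.condH0 (F.time_pos n y h0 h1)
  · intro y₁ y₂ h0 h12 h1
    exact le_of_tendsto_of_tendsto' (hb y₂ (h0.trans h12) h1) (hb y₁ h0 (h12.trans h1)) fun n =>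
      (F.sol n).scaledSlope_anti F.condH0 (F.time_pos n y₁ h0 (h12.trans h1))
        (F.time_lt n h0 h12 h1).le
  · intro y₁ y₂ h0 h12 h1
    exact le_of_tendsto' ((hb y₂ (h0.trans h12) h1).mul
      ((hσ y₂ (h0.trans h12) h1).sub (hσ y₁ h0 (h12.trans h1)))) fun n => F.le_sub n h0 h12 h1
  · intro y₁ y₂ h0 h12 h1
    exact ge_of_tendsto' ((hb y₁ h0 (h12.trans h1)).mul
      ((hσ y₂ (h0.trans h12) h1).sub (hσ y₁ h0 (h12.trans h1)))) fun n => F.sub_le n h0 h12 h1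
  · intro y h0 h1
    refine le_of_forall_pos_le_add fun ε hε => ?_
    have := ge_of_tendsto ((hσ y h0 h1).const_mul 2) (hU (F.eventually_le_time h0 h1 hε))
    linarith
  · intro y h0 h1
    exact le_of_forall_pos_le_add fun ε hε =>
      le_of_tendsto ((hσ y h0 h1).const_mul 2) (hU (F.eventually_time_le h0 h1 hε))
  · intro y h0 h1 hlt
    set c := (2 * σ y - y ^ p) / 3 with hc
    have hc0 : 0 < c := by rw [hc]; linarith
    have hlim : Tendsto (fun n => Real.exp (-(c * mu n ^ p))) U (𝓝 0) :=
      (Real.tendsto_exp_neg_atTop_nhds_zero.comp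
        (F.tendsto_mu_rpow.const_mul_atTop hc0)).mono_left hU
    refine tendsto_nhds_unique (hψ y h0 h1) (squeeze_zero' ?_ ?_ hlim)
    · exact Eventually.of_forall fun n =>
        (F.sol n).potential_nonneg hp F.condH0 (F.time_pos n y h0 h1)
    · filter_upwards [hU (F.eventually_log_potential h0 hc0),
        ((hσ y h0 h1).const_mul 2).eventually_const_lt
          (show y ^ p + 2 * c < 2 * σ y by rw [hc]; linarith)] with n h2 h3
      obtain ⟨k1, k2⟩ := h2 _ (F.time_pos n y h0 h1) (F.height n y h0 h1).ge
      rw [← Real.log_le_iff_le_exp k1]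
      rw [F.log_eq n h0 h1] at k2
      have hK := Real.rpow_pos_of_pos (F.mu_pos n) p
      have := (abs_le.1 k2).2
      nlinarith
  · intro y₁ y₂ h0 h12 h1 hlt
    set c := (2 * σ y₁ - y₂ ^ p) / 3 with hc
    have hc0 : 0 < c := by rw [hc]; linarith
    have := tendsto_nhds_unique ((hb y₁ h0 (h12.trans h1)).sub (hb y₂ (h0.trans h12) h1))
      (F.tendsto_slope_sub h0 h12 h1 hU hc0 (by
        filter_upwards [((hσ y₁ h0 (h12.trans h1)).const_mul 2).eventually_const_lt
          (show y₂ ^ p + 2 * c < 2 * σ y₁ by rw [hc]; linarith)] with n h2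
        linarith))
    linarith
  · intro y₁ y₂ κ η h0 h12 h1 hk
    refine le_mul_of_forall_pos_add fun ε hε => ?_
    have b1 := hb y₁ h0 (h12.trans h1)
    have b2 := hb y₂ (h0.trans h12) h1
    have p1 := hψ y₁ h0 (h12.trans h1)
    have p2 := hψ y₂ (h0.trans h12) h1
    refine le_of_tendsto_of_tendsto (((((b1.pow 2).div_const 2).add p1).sub
      (((b2.pow 2).div_const 2).add p2)).sub ((b1.sub b2).const_mul κ)).abs
      ((b1.sub b2).const_mul (η + ε)) ?_
    filter_upwards [hU (F.eventually_energy h0 (show η < η + ε by linarith) hk)] with n hn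
    exact hn _ _ (F.time_pos n y₁ h0 (h12.trans h1)) (F.time_lt n h0 h12 h1).le
      (F.height n y₁ h0 (h12.trans h1)).ge (F.height n y₂ (h0.trans h12) h1).le
  · intro y₁ κ η h0 h1 hk
    refine le_mul_of_forall_pos_add fun ε hε => ?_
    have b1 := hb y₁ h0 h1
    have p1 := hψ y₁ h0 h1
    refine le_of_tendsto_of_tendsto ((((b1.pow 2).div_const 2).add p1).sub (b1.const_mul κ)).abs
      (b1.const_mul (η + ε)) ?_
    filter_upwards [hU (F.eventually_energy_top h0 (show η < η + ε by linarith) hk)] with n hn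
    exact hn _ (F.time_pos n y₁ h0 h1) (F.height n y₁ h0 h1).ge
  · intro y₀ h0 h1
    obtain ⟨C, hC⟩ := F.potential_le_slope_sub h0
    refine ⟨C, fun y₁ y y₂ hy0 hy1 hy2 hy3 => ?_⟩
    exact hC U hU y₁ y y₂ hy0 hy1 hy2 hy3 _ _ _ (hψ y (by linarith) (by linarith))
      (hb y₁ (by linarith) (by linarith)) (hb y₂ (by linarith) hy3)

/-- Limits of the profile that do not depend on the ultrafilter are limits along `atTop`. -/
theorem tendsto_of_profile (F : Family p h lam mu v w T) {y s B : ℝ} (h0 : 0 < y) (h1 : y < 1)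
    (hs : ∀ σ b ψ, Profile p σ b ψ → b y = B ∧ 2 * σ y = s) (hneg : y ^ p < s) :
    Tendsto (fun n => scaledTime p (lam n) (mu n) (T n y)) atTop (𝓝 (s / 2)) ∧
      Tendsto (fun n => scaledSlope p (mu n) (w n) (T n y)) atTop (𝓝 B) ∧
      Tendsto (fun n => potential p h (lam n) (mu n) (v n) (T n y)) atTop (𝓝 0) := by
  refine ⟨?_, ?_, ?_⟩ <;> rw [tendsto_iff_ultrafilter] <;> intro U hU <;>
    obtain ⟨σ, b, ψ, P, hlim⟩ := F.exists_profile U hU <;>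
    obtain ⟨l1, l2, l3⟩ := hlim y h0 h1 <;> obtain ⟨e1, e2⟩ := hs σ b ψ P
  · rwa [← e2, mul_div_cancel_left₀ _ two_ne_zero]
  · rwa [← e1]
  · rwa [← P.potential_eq_zero y h0 h1 (e2 ▸ hneg)]

/-! ### The limit of log λ and absolute times -/

/-- The quantity equals T/μ^p - σ, and 0 < T ≤ v/v' traps T/μ^p between 0 and y/b. The trap closes
as the height y tends to 0. -/
theorem tendsto_log_lam (F : Family p h lam mu v w T) {ℓ : ℝ}
    (H : ∀ ε > 0, ∃ y s B, 0 < y ∧ y < 1 ∧ 0 < B ∧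
      Tendsto (fun n => scaledTime p (lam n) (mu n) (T n y)) atTop (𝓝 s) ∧
      Tendsto (fun n => scaledSlope p (mu n) (w n) (T n y)) atTop (𝓝 B) ∧
      ℓ - ε < -s ∧ y / B - s < ℓ + ε) :
    Tendsto (fun n => Real.log (lam n) / 2 / mu n ^ p) atTop (𝓝 ℓ) := by
  rw [Metric.tendsto_nhds]
  intro ε hε
  obtain ⟨y, s, B, h0, h1, hB, ls, lB, hlo, hhi⟩ := H ε hε
  have l1 := ls.neg
  have l2 := ((tendsto_const_nhds (x := y)).div lB hB.ne').sub ls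
  filter_upwards [l1.eventually_const_lt hlo, l2.eventually_lt_const hhi,
    lB.eventually_const_lt hB] with n k1 k2 k3
  have hmu := F.mu_pos n
  have hK : 0 < mu n ^ p := by positivity
  have hT := F.time_pos n y h0 h1
  have e : Real.log (lam n) / 2 / mu n ^ p =
      T n y / mu n ^ p - scaledTime p (lam n) (mu n) (T n y) := by
    unfold scaledTime; ring
  have k4 : 0 < T n y / mu n ^ p := by positivity
  have k5 : T n y / mu n ^ p ≤ y / scaledSlope p (mu n) (w n) (T n y) := by
    rw [div_le_div_iff₀ hK k3]
    have := (F.sol n).mul_slope_le F.condH0 hT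
    rw [F.height n y h0 h1] at this
    have h2 := mul_le_mul_of_nonneg_left this (Real.rpow_pos_of_pos hmu (p - 1)).le
    rw [← rpow_sub_one_mul_self hmu]
    unfold scaledSlope
    linarith
  simp only [Pi.div_apply] at k2
  rw [Real.dist_eq, e, abs_lt]
  constructor <;> linarith

theorem tendsto_div_rpow {ℓ s : ℝ} {t : ℕ → ℝ}
    (hℓ : Tendsto (fun n => Real.log (lam n) / 2 / mu n ^ p) atTop (𝓝 ℓ))
    (ht : Tendsto (fun n => scaledTime p (lam n) (mu n) (t n)) atTop (𝓝 s)) :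
    Tendsto (fun n => t n / mu n ^ p) atTop (𝓝 (s + ℓ)) := by
  refine (ht.add hℓ).congr fun n => ?_
  unfold scaledTime
  ring

theorem limits_of_le_two (F : Family p h lam mu v w T) (hp2 : p ≤ 2) {y : ℝ} (h0 : 0 < y)
    (h1 : y < 1) :
    Tendsto (fun n => scaledTime p (lam n) (mu n) (T n y)) atTop
        (𝓝 ((1 - p / 2 * (1 - y)) / 2)) ∧
      Tendsto (fun n => scaledSlope p (mu n) (w n) (T n y)) atTop (𝓝 (4 / p)) := by
  have hp := F.p_pos
  obtain ⟨l1, l2, -⟩ := F.tendsto_of_profile h0 h1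
    (fun σ b ψ P => P.eq_of_le_two F.p_pos hp2 y ⟨h0, h1⟩) (by
      have := rpow_lt_affine hp hp2 h0 h1
      rw [Real.one_rpow] at this
      convert this using 2
      field_simp; ring)
  exact ⟨l1, l2⟩

theorem log_lam_of_le_two (F : Family p h lam mu v w T) (hp2 : p ≤ 2) :
    Tendsto (fun n => Real.log (lam n) / 2 / mu n ^ p) atTop (𝓝 (p / 4 - 1 / 2)) := by
  have hp := F.p_pos
  refine F.tendsto_log_lam fun ε hε => ?_
  -- The height must be below 1 and small enough that y/b → p y/4 is at most ε/4.
  have hy0 : 0 < min (1 / 2) (ε / p) := by positivity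
  have hy1 : min (1 / 2) (ε / p) < 1 := (min_le_left _ _).trans_lt (by norm_num)
  have hyε : p * min (1 / 2) (ε / p) ≤ ε := by
    calc p * min (1 / 2) (ε / p) ≤ p * (ε / p) := by gcongr; exact min_le_right _ _
      _ = ε := by field_simp
  obtain ⟨l1, l2⟩ := F.limits_of_le_two hp2 hy0 hy1
  refine ⟨_, _, _, hy0, hy1, by positivity, l1, l2, by linarith, ?_⟩
  rw [show min (1 / 2) (ε / p) / (4 / p) = p * min (1 / 2) (ε / p) / 4 by field_simp]
  linarith

theorem time_of_le_two (F : Family p h lam mu v w T) (hp2 : p ≤ 2) {y : ℝ} (h0 : 0 < y)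
    (h1 : y < 1) : Tendsto (fun n => T n y / mu n ^ p) atTop (𝓝 (p / 4 * y)) := by
  have := tendsto_div_rpow (F.log_lam_of_le_two hp2) (F.limits_of_le_two hp2 h0 h1).1
  convert this using 2
  ring

theorem firstTime_of_le_two (F : Family p h lam mu v w T) (hp2 : p ≤ 2) :
    Tendsto (fun n => firstTime p h (lam n) (mu n) / mu n ^ p) atTop (𝓝 (p / 4)) := by
  have := tendsto_div_rpow (F.log_lam_of_le_two hp2) F.tendsto_firstTime
  convert this using 2
  ring

theorem limits_of_two_lt (F : Family p h lam mu v w T) (hp2 : 2 < p) (k : ℕ) {y : ℝ}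
    (hy : y ∈ Ioo (deltaSeq p (k + 1)) (deltaSeq p k)) :
    Tendsto (fun n => scaledTime p (lam n) (mu n) (T n y)) atTop (𝓝 (bubbleTime p k y / 2)) ∧
      Tendsto (fun n => scaledSlope p (mu n) (w n) (T n y)) atTop (𝓝 (bubbleSlope p k)) ∧
      Tendsto (fun n => potential p h (lam n) (mu n) (v n) (T n y)) atTop (𝓝 0) :=
  F.tendsto_of_profile ((deltaSeq_pos hp2 _).trans hy.1) (hy.2.trans_le (deltaSeq_le_one hp2 k))
    (fun _ _ _ P => P.eq_of_two_lt hp2 k y hy) (rpow_lt_bubbleTime hp2 k hy)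

/-- Between consecutive bubbles both 2σ and y/b are at most a multiple of δ_k^p, and δ_k tends to 0:
the accumulation of bubbles at height zero forces the limit 0. -/
theorem log_lam_of_two_lt (F : Family p h lam mu v w T) (hp2 : 2 < p) :
    Tendsto (fun n => Real.log (lam n) / 2 / mu n ^ p) atTop (𝓝 0) := by
  have hp := F.p_pos
  refine F.tendsto_log_lam fun ε hε => ?_
  have l : Tendsto (fun k => p * deltaSeq p k ^ p) atTop (𝓝 (p * 0 ^ p)) :=
    ((tendsto_deltaSeq hp2).rpow_const (Or.inr hp.le)).const_mul p
  rw [Real.zero_rpow hp.ne', mul_zero] at l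
  obtain ⟨k, hk⟩ := (l.eventually_lt_const hε).exists
  obtain ⟨y, hy⟩ := exists_between (deltaSeq_succ_lt hp2 k)
  have hd := deltaSeq_pos hp2 k
  have ha := (aSeq_mem hp2 k).1
  have hc := bubbleSlope_pos hp2 k
  have hy0 : 0 < y := (deltaSeq_pos hp2 _).trans hy.1
  obtain ⟨l1, l2, -⟩ := F.limits_of_two_lt hp2 k hy
  have hlt := rpow_lt_bubbleTime hp2 k hy
  have hyp : 0 < y ^ p := by positivity
  have hle : bubbleTime p k y ≤ deltaSeq p k ^ p := by
    unfold bubbleTime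
    have : 0 ≤ 2 * (deltaSeq p k - y) / bubbleSlope p k :=
      div_nonneg (by linarith [hy.2]) hc.le
    linarith
  have hdp : 0 < deltaSeq p k ^ p := by positivity
  refine ⟨y, _, _, hy0, hy.2.trans_le (deltaSeq_le_one hp2 k), hc, l1, l2, by nlinarith, ?_⟩
  have : y / bubbleSlope p k ≤ p * deltaSeq p k ^ p := by
    rw [div_le_iff₀ hc, bubbleSlope, ← rpow_sub_one_mul_self hd]
    field_simp
    nlinarith [hy.2]
  linarith

theorem time_of_two_lt (F : Family p h lam mu v w T) (hp2 : 2 < p) (k : ℕ) {y : ℝ}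
    (hy : y ∈ Ioo (deltaSeq p (k + 1)) (deltaSeq p k)) :
    Tendsto (fun n => T n y / mu n ^ p) atTop (𝓝 (bubbleTime p k y / 2)) := by
  simpa using tendsto_div_rpow (F.log_lam_of_two_lt hp2) (F.limits_of_two_lt hp2 k hy).1

theorem firstTime_of_two_lt (F : Family p h lam mu v w T) (hp2 : 2 < p) :
    Tendsto (fun n => firstTime p h (lam n) (mu n) / mu n ^ p) atTop (𝓝 (1 / 2)) := by
  simpa using tendsto_div_rpow (F.log_lam_of_two_lt hp2) F.tendsto_firstTime

end Family

/-! ### The first bubble at unit scale -/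

namespace Family

variable {p : ℝ} {h : ℝ → ℝ} {lam mu : ℕ → ℝ} {v w : ℕ → ℝ → ℝ} {T : ℕ → ℝ → ℝ}

theorem tendsto_firstTime_atTop (F : Family p h lam mu v w T) :
    Tendsto (fun n => firstTime p h (lam n) (mu n)) atTop atTop := by
  have hp := F.p_pos
  obtain ⟨c, hc, l⟩ : ∃ c, 0 < c ∧
      Tendsto (fun n => firstTime p h (lam n) (mu n) / mu n ^ p) atTop (𝓝 c) := by
    rcases le_or_gt p 2 with h2 | h2
    · exact ⟨_, by positivity, F.firstTime_of_le_two h2⟩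
    · exact ⟨_, by norm_num, F.firstTime_of_two_lt h2⟩
  refine (l.pos_mul_atTop hc F.tendsto_mu_rpow).congr fun n => ?_
  have := Real.rpow_pos_of_pos (F.mu_pos n) p
  field_simp

/-- In this window 1 - v/μ ≤ ρ/(4p μ^p) with ρ = e^{2(`firstTime` - t)}. A function differentiable
at 1 is Lipschitz at that point, and the factor μ^{-p} beats any constant. -/
theorem eventually_near_top (F : Family p h lam mu v w T) {g : ℝ → ℝ} {g' η : ℝ}
    (hg : HasDerivAt g g' 1) (hη : 0 < η) : ∀ᶠ n in atTop, ∀ t, 0 < t →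
      firstTime p h (lam n) (mu n) - Real.log 8 / 2 ≤ t →
      |g (v n t / mu n) - g 1| ≤ η * Real.exp (2 * (firstTime p h (lam n) (mu n) - t)) := by
  have hp := F.p_pos
  obtain ⟨L, hL⟩ := hg.isBigO_sub.bound
  obtain ⟨ε, hε, hball⟩ := Metric.eventually_nhds_iff.1 hL
  filter_upwards [F.eventually_top, F.tendsto_mu_rpow.eventually_gt_atTop (8 / (4 * p * ε)),
    F.tendsto_mu_rpow.eventually_ge_atTop (|L| / (4 * p * η))] with n h1 h2 h3 t ht htt
  have hmu := F.mu_pos n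
  have hK : 0 < mu n ^ p := by positivity
  set ρ := Real.exp (2 * (firstTime p h (lam n) (mu n) - t)) with hρ
  have hρ0 : 0 < ρ := Real.exp_pos _
  have hρ8 : ρ ≤ 8 := by
    rw [hρ, ← Real.le_log_iff_exp_le (by norm_num)]; linarith
  have h4 := (h1.2.2 t ht).2
  have hy1 : v n t / mu n ≤ 1 := by rw [div_le_one hmu]; exact (F.sol n).le_top F.condH0 ht
  have h5 : 1 - v n t / mu n ≤ ρ / (4 * p * mu n ^ p) := by
    rw [le_div_iff₀ (by positivity)]; linarith
  have hdist : |v n t / mu n - 1| = 1 - v n t / mu n := by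
    rw [abs_sub_comm, abs_of_nonneg (by linarith)]
  have h6 : 1 - v n t / mu n < ε := by
    refine h5.trans_lt ?_
    rw [div_lt_iff₀ (by positivity)] at h2 ⊢
    linarith
  have h7 := hball (y := v n t / mu n) (by rw [Real.dist_eq, hdist]; exact h6)
  rw [Real.norm_eq_abs, Real.norm_eq_abs, hdist] at h7
  rw [div_le_iff₀ (by positivity)] at h3
  calc |g (v n t / mu n) - g 1| ≤ L * (1 - v n t / mu n) := h7
    _ ≤ |L| * (ρ / (4 * p * mu n ^ p)) :=
      mul_le_mul (le_abs_self L) h5 (by linarith) (abs_nonneg L)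
    _ ≤ mu n ^ p * (4 * p * η) * (ρ / (4 * p * mu n ^ p)) := by gcongr
    _ = η * ρ := by field_simp

/-- The estimates near the first bubble in terms of `ρ = exp (2 (firstTime - t))`. -/
theorem eventually_first_bubble (F : Family p h lam mu v w T) {η : ℝ} (hη : 0 < η) :
    ∀ᶠ n in atTop, ∀ t, 0 < t → firstTime p h (lam n) (mu n) - Real.log 8 / 2 ≤ t →
      0 < h (v n t) ∧ |relErr p h (v n t)| ≤ η ∧ (v n t / mu n) ^ (p - 1) ≤ 2 ∧
      |(v n t / mu n) ^ (p - 1) - 1| ≤ η * Real.exp (2 * (firstTime p h (lam n) (mu n) - t)) ∧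
      0 < potential p h (lam n) (mu n) (v n) t ∧ 0 < scaledSlope p (mu n) (w n) t ∧
      2 * p * scaledSlope p (mu n) (w n) t ≤
        Real.exp (2 * (firstTime p h (lam n) (mu n) - t)) ∧
      |scaledSlope p (mu n) (w n) t ^ 2 / 2 + potential p h (lam n) (mu n) (v n) t
        - 2 / p * scaledSlope p (mu n) (w n) t| ≤
        η * Real.exp (2 * (firstTime p h (lam n) (mu n) - t)) * scaledSlope p (mu n) (w n) t := by
  have hp := F.p_pos
  have d1 : HasDerivAt (kap p) (2 / p * ((1 - p) * 1 ^ (1 - p - 1))) 1 :=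
    (Real.hasDerivAt_rpow_const (Or.inl one_ne_zero)).const_mul _
  have d2 : HasDerivAt (fun y : ℝ => y ^ (p - 1)) ((p - 1) * 1 ^ (p - 1 - 1)) 1 :=
    Real.hasDerivAt_rpow_const (Or.inl one_ne_zero)
  have hrel : ∀ ε > 0, ∀ᶠ s in atTop, |relErr p h s| ≤ ε := fun ε hε => by
    filter_upwards [(tendsto_relErr hp F.condH1).eventually (Metric.closedBall_mem_nhds 0 hε)]
      with s hs
    rwa [dist_zero_right, Real.norm_eq_abs] at hs
  have hhalf : ∀ᶠ n in atTop, ∀ t, 0 < t → firstTime p h (lam n) (mu n) - Real.log 8 / 2 ≤ t →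
      1 / 2 * mu n ≤ v n t := by
    filter_upwards [F.eventually_near_top (hasDerivAt_id 1) (show (0 : ℝ) < 1 / 16 by norm_num)]
      with n hn t ht htt
    have h1 := hn t ht htt
    have hmu := F.mu_pos n
    have hρ8 : Real.exp (2 * (firstTime p h (lam n) (mu n) - t)) ≤ 8 := by
      rw [← Real.le_log_iff_exp_le (by norm_num)]; linarith
    rw [← le_div_iff₀ hmu]
    have := (abs_le.1 h1).1
    simp only [id] at this
    linarith
  -- The bound pη on `relErr`, together with 2p b ≤ ρ, makes `relErr` · b at most ηρ/2.
  have hm : 0 < min η (p * η) := by positivity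
  filter_upwards [hhalf, F.eventually_height (by norm_num : (0 : ℝ) < 1 / 2) F.eventually_h_pos,
    F.eventually_height (by norm_num : (0 : ℝ) < 1 / 2) (hrel _ hm),
    F.eventually_log_potential (by norm_num : (0 : ℝ) < 1 / 2) one_pos,
    F.eventually_near_top d1 (half_pos hη), F.eventually_near_top d2 hη,
    F.eventually_near_top d2 (show (0 : ℝ) < 1 / 8 by norm_num), F.eventually_top]
    with n h1 h2 h3 h4 h5 h6 h7 h8 t ht htt
  have hmu := F.mu_pos n
  set τ := firstTime p h (lam n) (mu n) with hτ
  have hρ8 : Real.exp (2 * (τ - t)) ≤ 8 := by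
    rw [← Real.le_log_iff_exp_le (by norm_num)]; linarith
  have hv := h1 t ht htt
  have hψ := (h4 t ht hv).1
  have hE := (F.sol n).abs_energy_le hp F.condH0 (κ := 2 / p)
    (η := η * Real.exp (2 * (τ - t))) ht fun s hs => by
      have hs0 := ht.trans_le hs
      have hvs := h1 s hs0 (htt.trans hs)
      refine ⟨h2 s hvs, ?_⟩
      have k1 := h5 s hs0 (htt.trans hs)
      have hk1 : kap p 1 = 2 / p := by simp [kap]
      rw [hk1] at k1
      have k2 := (h3 s hvs).trans (min_le_right _ _)
      have k3 := (h8.2.2 s hs0).1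
      have k4 := (F.sol n).scaledSlope_nonneg F.condH0 hs0
      have k5 : |relErr p h (v n s) * scaledSlope p (mu n) (w n) s| ≤
          η / 2 * Real.exp (2 * (τ - s)) := by
        rw [abs_mul, abs_of_nonneg k4]
        calc _ ≤ p * η * scaledSlope p (mu n) (w n) s := by gcongr
          _ = η / 2 * (2 * p * scaledSlope p (mu n) (w n) s) := by ring
          _ ≤ _ := by gcongr
      have k6 : Real.exp (2 * (τ - s)) ≤ Real.exp (2 * (τ - t)) := by
        apply Real.exp_le_exp.2; linarith
      have k7 := abs_sub (kap p (v n s / mu n) - 2 / p)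
        (relErr p h (v n s) * scaledSlope p (mu n) (w n) s)
      rw [show kap p (v n s / mu n) - relErr p h (v n s) * scaledSlope p (mu n) (w n) s - 2 / p =
        kap p (v n s / mu n) - 2 / p - relErr p h (v n s) * scaledSlope p (mu n) (w n) s by ring]
      nlinarith
  have hb0 := (F.sol n).scaledSlope_nonneg F.condH0 ht
  have hbpos : 0 < scaledSlope p (mu n) (w n) t := by
    refine lt_of_le_of_ne hb0 fun h0 => ?_
    rw [← h0] at hE
    norm_num at hE
    linarith
  have k6 := h6 t ht htt
  have k7 := h7 t ht htt
  rw [Real.one_rpow] at k6 k7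
  refine ⟨h2 t hv, (h3 t hv).trans (min_le_left _ _), ?_, k6, hψ, hbpos, (h8.2.2 t ht).1, hE⟩
  linarith [(abs_le.1 k7).2]

/-- As t → ∞ the energy law gives ψ/b → 2/p, and ψ/ρ → 1/p² by the definition of `firstTime`; the
quotient is (ψ/ρ)/(ψ/b)². -/
theorem tendsto_liouville_atTop (F : Family p h lam mu v w T) {n : ℕ}
    (hf : 0 < nonlin p h (mu n))
    (hE : ∀ᶠ t in atTop, 0 < scaledSlope p (mu n) (w n) t ∧
      |scaledSlope p (mu n) (w n) t ^ 2 / 2 + potential p h (lam n) (mu n) (v n) t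
        - 2 / p * scaledSlope p (mu n) (w n) t| ≤
        Real.exp (2 * (firstTime p h (lam n) (mu n) - t)) * scaledSlope p (mu n) (w n) t) :
    Tendsto (fun t => scaledSlope p (mu n) (w n) t ^ 2 /
      (potential p h (lam n) (mu n) (v n) t *
        Real.exp (2 * (firstTime p h (lam n) (mu n) - t)))) atTop (𝓝 (1 / 4)) := by
  have hp := F.p_pos
  have hmu := F.mu_pos n
  have hlam := (F.sol n).lam_pos
  have hm : 0 < mu n ^ (p - 1) := by positivity
  set τ := firstTime p h (lam n) (mu n) with hτ
  have hρ : Tendsto (fun t => Real.exp (2 * (τ - t))) atTop (𝓝 0) := by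
    refine Real.tendsto_exp_atBot.comp (Tendsto.const_mul_atBot two_pos ?_)
    exact tendsto_const_nhds.add_atBot tendsto_neg_atTop_atBot
  have hb := (F.sol n).tendsto_scaledSlope F.condH0
  have l1 : Tendsto (fun t => potential p h (lam n) (mu n) (v n) t /
      scaledSlope p (mu n) (w n) t) atTop (𝓝 (2 / p)) := by
    have l0 : Tendsto (fun t => potential p h (lam n) (mu n) (v n) t /
      scaledSlope p (mu n) (w n) t + scaledSlope p (mu n) (w n) t / 2 - 2 / p) atTop (𝓝 0) := by
      refine squeeze_zero_norm' ?_ hρ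
      filter_upwards [hE] with t ⟨h1, h2⟩
      rw [Real.norm_eq_abs, ← mul_le_mul_iff_left₀ h1]
      refine le_trans (le_of_eq ?_) h2
      have habs : ∀ x, |x| * scaledSlope p (mu n) (w n) t = |x * scaledSlope p (mu n) (w n) t| :=
        fun x => by rw [abs_mul, abs_of_pos h1]
      rw [habs]
      congr 1
      field_simp
      ring
    have := (l0.add_const (2 / p)).sub (hb.div_const 2)
    rw [zero_add, zero_div, sub_zero] at this
    refine this.congr fun t => ?_
    ring
  have hc : ContinuousAt (approxPrim p h) (mu n) :=
    (hasDerivAt_nonlin F.condH0 hmu).continuousAt.div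
      (continuousAt_const.mul (Real.continuousAt_rpow_const _ _ (Or.inl hmu.ne'))) (by positivity)
  have l2 : Tendsto (fun t => potential p h (lam n) (mu n) (v n) t / Real.exp (2 * (τ - t)))
      atTop (𝓝 (1 / p ^ 2)) := by
    have l := ((hc.tendsto.comp (F.sol n).tendsto_top).const_mul
      (mu n ^ (p - 1) / (p * nonlin p h (mu n))))
    have e : mu n ^ (p - 1) / (p * nonlin p h (mu n)) * approxPrim p h (mu n) = 1 / p ^ 2 := by
      unfold approxPrim; field_simp
    rw [e] at l
    refine l.congr fun t => ?_
    have e2 : Real.exp (2 * (τ - t)) =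
        p * lam n * mu n ^ (p - 1) * nonlin p h (mu n) * Real.exp (-(2 * t)) := by
      rw [show 2 * (τ - t) = Real.log (p * lam n * mu n ^ (p - 1) * nonlin p h (mu n)) + -(2 * t) by
        rw [hτ, firstTime]; ring, Real.exp_add, Real.exp_log (by positivity)]
    rw [e2, potential]
    have := Real.exp_pos (-(2 * t))
    simp only [Function.comp]
    field_simp
  have l3 := l2.div (l1.pow 2) (by positivity)
  have e : 1 / p ^ 2 / (2 / p) ^ 2 = 1 / 4 := by field_simp; norm_num
  rw [e] at l3
  refine l3.congr' ?_
  have hψ0 : ∀ᶠ t in atTop, potential p h (lam n) (mu n) (v n) t /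
      scaledSlope p (mu n) (w n) t ≠ 0 := l1.eventually_ne (by positivity)
  filter_upwards [hE, hψ0] with t ⟨h1, _⟩ h2
  have h3 : potential p h (lam n) (mu n) (v n) t ≠ 0 := fun h0 => h2 (by rw [h0, zero_div])
  simp only [Pi.div_apply]
  have := (Real.exp_pos (2 * (τ - t))).ne'
  field_simp

/-- For the limiting Liouville equation b²/(ψρ) is a conserved quantity. Here its logarithm has
derivative O(ερ), and ρ is integrable at infinity, so the value at ρ = 8 is close to the limit 1/4.
-/
theorem eventually_liouville (F : Family p h lam mu v w T) {η : ℝ} (hη : 0 < η) :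
    ∀ᶠ n in atTop, |Real.log (scaledSlope p (mu n) (w n)
        (firstTime p h (lam n) (mu n) - Real.log 8 / 2) ^ 2 /
      (potential p h (lam n) (mu n) (v n) (firstTime p h (lam n) (mu n) - Real.log 8 / 2) * 8))
      - Real.log (1 / 4)| ≤ η := by
  have hp := F.p_pos
  -- The logarithmic derivative is bounded by (5 + 4p) ε ρ, and ρ integrates to 8/2 = 4 over the
  -- window.
  set ε := min (η / (4 * (5 + 4 * p))) 1 with hε
  have hε0 : 0 < ε := by positivity
  have hε1 : ε ≤ 1 := min_le_right _ _
  have hεη : (5 + 4 * p) * ε * 4 ≤ η := by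
    have : ε ≤ η / (4 * (5 + 4 * p)) := min_le_left _ _
    rw [le_div_iff₀ (by positivity)] at this
    linarith
  filter_upwards [F.eventually_first_bubble hε0, F.eventually_top,
    F.tendsto_firstTime_atTop.eventually_gt_atTop (Real.log 8 / 2)] with n hn hf hpos
  have hmu := F.mu_pos n
  set τ := firstTime p h (lam n) (mu n) with hτ
  set t₀ := τ - Real.log 8 / 2 with ht₀
  have ht0 : 0 < t₀ := by linarith
  set b : ℝ → ℝ := scaledSlope p (mu n) (w n) with hb
  set ψ : ℝ → ℝ := potential p h (lam n) (mu n) (v n) with hψ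
  set G : ℝ → ℝ := fun t => 2 * Real.log (b t) - Real.log (ψ t) - 2 * (τ - t) with hG
  -- The derivative of G, using p y^{p-1} κ(y) = 2, written as a sum of three errors: height below
  -- the top, `relErr`, and defect in the energy law.
  set G' : ℝ → ℝ := fun t => 4 * (1 - (v n t / mu n) ^ (p - 1))
    - p * (v n t / mu n) ^ (p - 1) * relErr p h (v n t) * b t
    - 2 * p * (v n t / mu n) ^ (p - 1) *
      ((b t ^ 2 / 2 + ψ t - 2 / p * b t) / b t) with hG'
  have dG : ∀ t ∈ Ici t₀, HasDerivAt G (G' t) t := by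
    intro t ht
    have ht' : 0 < t := ht0.trans_le ht
    obtain ⟨h1, h2, h3, h4, h5, h6, h7, h8⟩ := hn t ht' ht
    have d1 := ((F.sol n).hasDerivAt_scaledSlope hp F.condH0 ht').log h6.ne'
    have d2 := ((F.sol n).hasDerivAt_potential hp F.condH0 ht' h1).log h5.ne'
    have d3 : HasDerivAt (fun t => 2 * (τ - t)) (-2) t := by
      simpa using ((hasDerivAt_id t).const_sub τ).const_mul 2
    refine (((d1.const_mul 2).sub d2).sub d3).congr_deriv ?_
    have hy : 0 < v n t / mu n := div_pos ((F.sol n).pos t ht') hmu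
    have hb0 : b t ≠ 0 := h6.ne'
    have hψ0 : ψ t ≠ 0 := h5.ne'
    have hyp : 0 < (v n t / mu n) ^ (p - 1) := by positivity
    rw [hG']
    simp only
    change 2 * (-(p * (v n t / mu n) ^ (p - 1) * ψ t) / b t) -
      (-(p * (v n t / mu n) ^ (p - 1) * ψ t) *
        (kap p (v n t / mu n) - (1 + relErr p h (v n t)) * b t)) / ψ t - -2 = _
    rw [kap_eq hy]
    generalize (v n t / mu n) ^ (p - 1) = Y at *
    field_simp
    ring
  have hρd : ∀ t : ℝ, HasDerivAt (fun t => (5 + 4 * p) * ε / 2 * Real.exp (2 * (τ - t)))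
      (-((5 + 4 * p) * ε * Real.exp (2 * (τ - t)))) t := fun t => by
    have d3 : HasDerivAt (fun t => 2 * (τ - t)) (-2) t := by
      simpa using ((hasDerivAt_id t).const_sub τ).const_mul 2
    exact (d3.exp.const_mul _).congr_deriv (by ring)
  have bG : ∀ t ∈ Ici t₀, |G' t| ≤ (5 + 4 * p) * ε * Real.exp (2 * (τ - t)) := by
    intro t ht
    have ht' : 0 < t := ht0.trans_le ht
    obtain ⟨h1, h2, h3, h4, h5, h6, h7, h8⟩ := hn t ht' ht
    have hy : 0 < v n t / mu n := div_pos ((F.sol n).pos t ht') hmu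
    have hyp : 0 < (v n t / mu n) ^ (p - 1) := by positivity
    set ρ := Real.exp (2 * (τ - t)) with hρ
    have hρ0 : 0 < ρ := Real.exp_pos _
    have k1 : |4 * (1 - (v n t / mu n) ^ (p - 1))| ≤ 4 * (ε * ρ) := by
      rw [abs_mul, abs_of_pos (by norm_num : (0 : ℝ) < 4), abs_sub_comm]
      linarith
    have k2 : |p * (v n t / mu n) ^ (p - 1) * relErr p h (v n t) * b t| ≤ ε * ρ := by
      rw [abs_mul, abs_mul, abs_of_pos (show 0 < p * (v n t / mu n) ^ (p - 1) by positivity),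
        abs_of_pos (show 0 < b t from h6)]
      have h6' : 0 < b t := h6
      calc _ ≤ p * 2 * ε * b t := by gcongr
        _ = ε * (2 * p * b t) := by ring
        _ ≤ _ := by gcongr
    have k3 : |2 * p * (v n t / mu n) ^ (p - 1) * ((b t ^ 2 / 2 + ψ t - 2 / p * b t) / b t)| ≤
        4 * p * (ε * ρ) := by
      rw [abs_mul, abs_div, abs_of_pos (show 0 < 2 * p * (v n t / mu n) ^ (p - 1) by positivity),
        abs_of_pos (show 0 < b t from h6)]
      have : |b t ^ 2 / 2 + ψ t - 2 / p * b t| / b t ≤ ε * ρ := by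
        rw [div_le_iff₀ (show 0 < b t from h6)]; exact h8
      calc _ ≤ 2 * p * 2 * (ε * ρ) := by gcongr
        _ = _ := by ring
    rw [hG']
    simp only
    rw [abs_le] at k1 k2 k3 ⊢
    constructor <;> linarith
  have m1 := antitoneOn_of_hasDerivAt (convex_Ici t₀) (fun t ht => (dG t ht).add (hρd t))
    fun t ht => by linarith [(abs_le.1 (bG t ht)).2]
  have m2 := monotoneOn_of_hasDerivAt (convex_Ici t₀) (fun t ht => (dG t ht).sub (hρd t))
    fun t ht => by linarith [(abs_le.1 (bG t ht)).1]
  have hlogG : ∀ t ∈ Ici t₀, G t = Real.log (b t ^ 2 / (ψ t * Real.exp (2 * (τ - t)))) := by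
    intro t ht
    obtain ⟨h1, h2, h3, h4, h5, h6, h7, h8⟩ := hn t (ht0.trans_le ht) ht
    have h5' : ψ t ≠ 0 := h5.ne'
    have h6' : b t ≠ 0 := h6.ne'
    rw [Real.log_div (by positivity) (mul_ne_zero h5' (Real.exp_pos _).ne'), Real.log_mul h5'
      (Real.exp_pos _).ne', Real.log_exp, Real.log_pow]
    push_cast
    rw [hG]
    ring
  have lG : Tendsto G atTop (𝓝 (Real.log (1 / 4))) := by
    have := (F.tendsto_liouville_atTop (n := n) hf.1 (by
      filter_upwards [eventually_ge_atTop t₀] with t ht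
      obtain ⟨h1, h2, h3, h4, h5, h6, h7, h8⟩ := hn t (ht0.trans_le ht) ht
      refine ⟨h6, h8.trans ?_⟩
      have := Real.exp_pos (2 * (τ - t))
      have := mul_pos this h6
      rw [mul_assoc]
      nlinarith)).log (by norm_num)
    refine this.congr' ?_
    filter_upwards [eventually_ge_atTop t₀] with t ht
    exact (hlogG t ht).symm
  have lρ : Tendsto (fun t => (5 + 4 * p) * ε / 2 * Real.exp (2 * (τ - t))) atTop (𝓝 0) := by
    have : Tendsto (fun t => Real.exp (2 * (τ - t))) atTop (𝓝 0) := by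
      refine Real.tendsto_exp_atBot.comp (Tendsto.const_mul_atBot two_pos ?_)
      exact tendsto_const_nhds.add_atBot tendsto_neg_atTop_atBot
    simpa using this.const_mul ((5 + 4 * p) * ε / 2)
  have r1 := le_of_tendsto (lG.add lρ) (by
    filter_upwards [eventually_ge_atTop t₀] with t ht
    exact m1 (mem_Ici.2 le_rfl) (mem_Ici.2 ht) ht)
  have r2 := ge_of_tendsto (lG.sub lρ) (by
    filter_upwards [eventually_ge_atTop t₀] with t ht
    exact m2 (mem_Ici.2 le_rfl) (mem_Ici.2 ht) ht)
  have e8 : Real.exp (2 * (τ - t₀)) = 8 := by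
    rw [ht₀, show 2 * (τ - (τ - Real.log 8 / 2)) = Real.log 8 by ring, Real.exp_log (by norm_num)]
  simp only [Pi.add_apply, Pi.sub_apply, e8] at r1 r2
  rw [hlogG t₀ (mem_Ici.2 le_rfl), e8] at r1 r2
  rw [abs_le]
  constructor <;> linarith

/-- At ρ = 8 the conserved quantity gives b²/ψ → 2, and the energy law gives b/2 + ψ/b → 2/p;
together b → 2/p and ψ → 2/p². -/
theorem tendsto_potential_first (F : Family p h lam mu v w T) :
    Tendsto (fun n => p ^ 2 * potential p h (lam n) (mu n) (v n)
      (firstTime p h (lam n) (mu n) - Real.log 8 / 2)) atTop (𝓝 2) := by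
  have hp := F.p_pos
  set t : ℕ → ℝ := fun n => firstTime p h (lam n) (mu n) - Real.log 8 / 2 with ht
  set b : ℕ → ℝ := fun n => scaledSlope p (mu n) (w n) (t n) with hb
  set ψ : ℕ → ℝ := fun n => potential p h (lam n) (mu n) (v n) (t n) with hψ
  have hpos : ∀ᶠ n in atTop, 0 < t n := by
    filter_upwards [F.tendsto_firstTime_atTop.eventually_gt_atTop (Real.log 8 / 2)] with n hn
    rw [ht]; simp only; linarith
  have e8 : ∀ n, Real.exp (2 * (firstTime p h (lam n) (mu n) - t n)) = 8 := fun n => by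
    rw [ht]
    simp only
    rw [show ∀ x : ℝ, 2 * (x - (x - Real.log 8 / 2)) = Real.log 8 by intro x; ring,
      Real.exp_log (by norm_num)]
  have hsign : ∀ᶠ n in atTop, 0 < b n ∧ 0 < ψ n := by
    filter_upwards [F.eventually_first_bubble one_pos, hpos] with n hn h0
    obtain ⟨h1, h2, h3, h4, h5, h6, h7, h8⟩ := hn (t n) h0 le_rfl
    exact ⟨h6, h5⟩
  have lr : Tendsto (fun n => b n ^ 2 / ψ n) atTop (𝓝 2) := by
    have l0 : Tendsto (fun n => Real.log (b n ^ 2 / (ψ n * 8))) atTop (𝓝 (Real.log (1 / 4))) := by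
      rw [Metric.tendsto_nhds]
      intro η hη
      filter_upwards [F.eventually_liouville (half_pos hη)] with n hn
      rw [Real.dist_eq]
      exact hn.trans_lt (by linarith)
    have l1 := ((Real.continuous_exp.tendsto _).comp l0).mul_const 8
    rw [Real.exp_log (by norm_num)] at l1
    norm_num at l1
    refine l1.congr' ?_
    filter_upwards [hsign] with n ⟨h1, h2⟩
    change Real.exp (Real.log (b n ^ 2 / (ψ n * 8))) * 8 = b n ^ 2 / ψ n
    rw [Real.exp_log (by positivity)]
    field_simp
  have ls : Tendsto (fun n => b n / 2 + ψ n / b n) atTop (𝓝 (2 / p)) := by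
    rw [Metric.tendsto_nhds]
    intro η hη
    filter_upwards [F.eventually_first_bubble (show 0 < η / 16 by positivity), hpos, hsign]
      with n hn h0 hs
    obtain ⟨h1, h2, h3, h4, h5, h6, h7, h8⟩ := hn (t n) h0 le_rfl
    rw [e8] at h8
    have h8' : |b n ^ 2 / 2 + ψ n - 2 / p * b n| ≤ η / 16 * 8 * b n := h8
    have hbn := hs.1
    rw [Real.dist_eq, ← mul_lt_mul_iff_left₀ hbn]
    have habs : ∀ x, |x| * b n = |x * b n| := fun x => by rw [abs_mul, abs_of_pos hbn]
    rw [habs]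
    have e : (b n / 2 + ψ n / b n - 2 / p) * b n = b n ^ 2 / 2 + ψ n - 2 / p * b n := by
      field_simp
    rw [e]
    nlinarith
  have lq : Tendsto (fun n => ψ n / b n) atTop (𝓝 (1 / p)) := by
    -- Uses b/2 + ψ/b = (ψ/b)(b²/(2ψ) + 1).
    have l1 := ls.div ((lr.div_const 2).add_const 1) (by norm_num)
    rw [show 2 / p / (2 / 2 + 1) = 1 / p by field_simp; norm_num] at l1
    refine l1.congr' ?_
    filter_upwards [hsign] with n ⟨h1, h2⟩
    simp only [Pi.div_apply]
    have : b n ^ 2 + ψ n * 2 ≠ 0 := by positivity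
    field_simp
  have l2 := (lr.mul (lq.pow 2)).const_mul (p ^ 2)
  rw [show p ^ 2 * (2 * (1 / p) ^ 2) = 2 by field_simp] at l2
  refine l2.congr' ?_
  filter_upwards [hsign] with n ⟨h1, h2⟩
  change p ^ 2 * (b n ^ 2 / ψ n * (ψ n / b n) ^ 2) = p ^ 2 * ψ n
  field_simp

theorem tendsto_height_first (F : Family p h lam mu v w T) :
    Tendsto (fun n => v n (firstTime p h (lam n) (mu n) - Real.log 8 / 2) / mu n) atTop (𝓝 1) := by
  rw [Metric.tendsto_nhds]
  intro η hη
  filter_upwards [F.eventually_near_top (hasDerivAt_id 1) (show 0 < η / 16 by positivity),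
    F.tendsto_firstTime_atTop.eventually_gt_atTop (Real.log 8 / 2)] with n hn h0
  have := hn _ (by linarith) le_rfl
  rw [show ∀ x : ℝ, 2 * (x - (x - Real.log 8 / 2)) = Real.log 8 by intro x; ring,
      Real.exp_log (by norm_num)] at this
  simp only [id] at this
  rw [Real.dist_eq]
  linarith

end Family

/-! ### Choice of sequences, zero counts and crossing criteria -/

/-- Diagonal choice of a sequence. -/
theorem exists_seq_tendsto {P Q : ℕ → ℝ → Prop} {f : ℕ → ℝ → ℝ} {a : ℝ} (hQ : ∀ n, ∃ x, Q n x)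
    (H : ∀ ε > 0, ∀ᶠ n in atTop, ∃ x, Q n x ∧ P n x ∧ |f n x - a| < ε) :
    ∃ s : ℕ → ℝ, (∀ n, Q n (s n)) ∧ (∀ᶠ n in atTop, P n (s n)) ∧
      Tendsto (fun n => f n (s n)) atTop (𝓝 a) := by
  -- For each n take a minimizer of |f - a| up to 1/(n+1) among admissible points; this single
  -- choice serves every ε.
  have key : ∀ n : ℕ, ∃ x, Q n x ∧ ∀ x', Q n x' → P n x' →
      P n x ∧ |f n x - a| < |f n x' - a| + 1 / ((n : ℝ) + 1) := by
    intro n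
    by_cases hne : ∃ x, Q n x ∧ P n x
    · set S : Set ℝ := (fun x => |f n x - a|) '' {x | Q n x ∧ P n x} with hS
      have hSne : S.Nonempty := Set.Nonempty.image _ hne
      have hSb : BddBelow S := ⟨0, by rintro _ ⟨x, _, rfl⟩; exact abs_nonneg _⟩
      have hpos : (0 : ℝ) < 1 / ((n : ℝ) + 1) := by positivity
      obtain ⟨_, ⟨x, hx, rfl⟩, hlt⟩ := exists_lt_of_csInf_lt hSne
        (show sInf S < sInf S + 1 / ((n : ℝ) + 1) by linarith)
      refine ⟨x, hx.1, fun x' h1 h2 => ⟨hx.2, hlt.trans_le ?_⟩⟩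
      gcongr
      exact csInf_le hSb ⟨x', ⟨h1, h2⟩, rfl⟩
    · obtain ⟨x, hx⟩ := hQ n
      exact ⟨x, hx, fun x' h1 h2 => absurd ⟨x', h1, h2⟩ hne⟩
  choose s hs hs' using key
  refine ⟨s, hs, ?_, ?_⟩
  · filter_upwards [H 1 one_pos] with n ⟨x, h1, h2, _⟩ using (hs' n x h1 h2).1
  · rw [Metric.tendsto_nhds]
    intro ε hε
    filter_upwards [H (ε / 2) (half_pos hε), tendsto_one_div_add_atTop_nhds_zero_nat.eventually_lt_const
      (half_pos hε)] with n ⟨x, h1, h2, h3⟩ h4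
    have := (hs' n x h1 h2).2
    rw [Real.dist_eq]
    linarith

theorem curveU_eq {p β t x : ℝ} (hp : 0 < p) (hx : 0 < x) (h : x ^ p = β * t) :
    x = curveU p β (Real.exp (-t)) := by
  rw [curveU, one_div, ← Real.exp_neg, neg_neg, Real.log_exp, ← h, ← Real.rpow_mul hx.le,
    mul_one_div_cancel hp.ne', Real.rpow_one]

theorem zeroCount_mono {g : ℝ → ℝ} {a b : ℝ} (hab : a ≤ b) :
    zeroCount (Ioc 0 a) g ≤ zeroCount (Ioc 0 b) g :=
  encard_le_encard fun _ hr => ⟨⟨hr.1.1, hr.1.2.trans hab⟩, hr.2⟩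

theorem zeroCount_add_one_le {g : ℝ → ℝ} {a b : ℝ} (hab : a < b) (hb : 0 < b) (hg : g b = 0) :
    zeroCount (Ioc 0 a) g + 1 ≤ zeroCount (Ioc 0 b) g := by
  have hnot : b ∉ {r | r ∈ Ioc 0 a ∧ g r = 0} := fun h => absurd h.1.2 (not_le.2 hab)
  rw [zeroCount, ← encard_insert_of_notMem hnot]
  refine encard_le_encard ?_
  rintro r (rfl | hr)
  · exact ⟨⟨hb, le_rfl⟩, hg⟩
  · exact ⟨⟨hr.1.1, hr.1.2.trans hab.le⟩, hr.2⟩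

theorem one_le_zeroCount {g : ℝ → ℝ} {b z : ℝ} (hz : 0 < z) (hzb : z ≤ b) (hg : g z = 0) :
    1 ≤ zeroCount (Ioc 0 b) g :=
  one_le_encard_iff_nonempty.2 ⟨z, ⟨hz, hzb⟩, hg⟩

theorem exists_zero_of_convexOn_of_neg_of_pos {g : ℝ → ℝ} {a b : ℝ} (hab : a < b)
    (hg : ConvexOn ℝ (Icc a b) g) (hcont : ContinuousOn g (Icc a b)) (ha : g a < 0)
    (hb : 0 < g b) :
    ∃ δ ∈ Ioo a b, g δ = 0 ∧ (∀ y ∈ Ioo a δ, g y < 0) ∧ ∀ y ∈ Ioo δ b, 0 < g y := by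
  obtain ⟨δ, hδ, h0⟩ := intermediate_value_Ioo hab.le hcont (show (0 : ℝ) ∈ _ from ⟨ha, hb⟩)
  refine ⟨δ, hδ, h0, fun y hy => ?_, fun y hy => ?_⟩
  · have := hg.slope_mono_adjacent (left_mem_Icc.2 hab.le) (Ioo_subset_Icc_self hδ) hy.1 hy.2
    rw [h0, div_le_div_iff₀ (by linarith [hy.1]) (by linarith [hy.2])] at this
    by_contra! hle
    nlinarith [hy.1, hy.2]
  · have := hg.slope_mono_adjacent (left_mem_Icc.2 hab.le)
      (show y ∈ Icc a b from ⟨(hδ.1.trans hy.1).le, hy.2.le⟩) hδ.1 hy.1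
    rw [h0, div_le_div_iff₀ (by linarith [hδ.1]) (by linarith [hy.1])] at this
    by_contra! hle
    nlinarith [hy.1, hδ.1]

theorem exists_zero_of_convexOn_of_pos_of_neg {g : ℝ → ℝ} {a b : ℝ} (hab : a < b)
    (hg : ConvexOn ℝ (Icc a b) g) (hcont : ContinuousOn g (Icc a b)) (ha : 0 < g a)
    (hb : g b < 0) :
    ∃ δ ∈ Ioo a b, g δ = 0 ∧ (∀ y ∈ Ioo a δ, 0 < g y) ∧ ∀ y ∈ Ioo δ b, g y < 0 := by
  obtain ⟨δ, hδ, h0⟩ := intermediate_value_Ioo' hab.le hcont (show (0 : ℝ) ∈ _ from ⟨hb, ha⟩)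
  refine ⟨δ, hδ, h0, fun y hy => ?_, fun y hy => ?_⟩
  · have := hg.slope_mono_adjacent
      (show y ∈ Icc a b from ⟨hy.1.le, (hy.2.trans hδ.2).le⟩) (right_mem_Icc.2 hab.le) hy.2 hδ.2
    rw [h0, div_le_div_iff₀ (by linarith [hy.2]) (by linarith [hδ.2])] at this
    by_contra! hle
    nlinarith [hy.2, hδ.2]
  · have := hg.slope_mono_adjacent (Ioo_subset_Icc_self hδ) (right_mem_Icc.2 hab.le) hy.1 hy.2
    rw [h0, div_le_div_iff₀ (by linarith [hy.1]) (by linarith [hy.2])] at this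
    by_contra! hle
    nlinarith [hy.1, hy.2]

/-- The function y^p - β `bubbleTime`/2 is convex. It is positive at both ends because `bubbleTime`
= y^p there and β < 2, and negative at δ_k^* because β > β_k^*; convexity fixes its sign on either
side of each root. -/
theorem bubble_roots {p : ℝ} (hp : 2 < p) (k : ℕ) {β : ℝ} (h1 : betaStar p k < β) (h2 : β < 2) :
    ∃ δ δ' : ℝ, δ ∈ Ioo (deltaStar p k) (deltaSeq p k) ∧
      δ' ∈ Ioo (deltaSeq p (k + 1)) (deltaStar p k) ∧
      betaFun p k δ = β ∧ betaFun p k δ' = β ∧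
      (∀ y ∈ Ioo (deltaStar p k) δ, y ^ p - β * (bubbleTime p k y / 2) < 0) ∧
      (∀ y ∈ Ioo δ (deltaSeq p k), 0 < y ^ p - β * (bubbleTime p k y / 2)) ∧
      (∀ y ∈ Ioo (deltaSeq p (k + 1)) δ', 0 < y ^ p - β * (bubbleTime p k y / 2)) ∧
      (∀ y ∈ Ioo δ' (deltaStar p k), y ^ p - β * (bubbleTime p k y / 2) < 0) := by
  have hs := deltaStar_mem hp k
  have hd := deltaSeq_pos hp k
  have hd' := deltaSeq_pos hp (k + 1)
  set g : ℝ → ℝ := fun y => y ^ p - β * (bubbleTime p k y / 2) with hg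
  have hconv : ConvexOn ℝ (Ici 0) g := by
    have ha : ConvexOn ℝ (Ici (0 : ℝ)) fun y => -(β * (bubbleTime p k y / 2)) := by
      refine ⟨convex_Ici 0, fun x _ y _ a b _ _ hab => le_of_eq ?_⟩
      obtain rfl : b = 1 - a := by linarith
      simp only [smul_eq_mul, bubbleTime]
      ring
    refine ((convexOn_rpow (show 1 ≤ p by linarith)).add ha).congr fun y _ => ?_
    simp [hg, sub_eq_add_neg]
  have hcont : Continuous g := by
    have : Continuous fun y : ℝ => y ^ p := Real.continuous_rpow_const (by linarith)
    have h3 : Continuous (bubbleTime p k) := by unfold bubbleTime; fun_prop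
    exact this.sub (continuous_const.mul (h3.div_const 2))
  have hR : 0 < g (deltaSeq p k) := by
    simp only [hg]
    rw [bubbleTime_right]
    have : 0 < deltaSeq p k ^ p := by positivity
    nlinarith
  have hL : 0 < g (deltaSeq p (k + 1)) := by
    simp only [hg]
    rw [bubbleTime_left hp]
    have : 0 < deltaSeq p (k + 1) ^ p := by positivity
    nlinarith
  have hbt : ∀ y ∈ Ioo (deltaSeq p (k + 1)) (deltaSeq p k), 0 < y ∧ 0 < bubbleTime p k y := by
    intro y hy
    have hy0 : 0 < y := hd'.trans hy.1
    exact ⟨hy0, (Real.rpow_pos_of_pos hy0 p).trans (rpow_lt_bubbleTime hp k hy)⟩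
  have hM : g (deltaStar p k) < 0 := by
    obtain ⟨h3, h4⟩ := hbt _ hs
    rw [betaStar, betaFun_eq hp k h3.le, div_lt_iff₀ h4] at h1
    simp only [hg]
    linarith
  have hroot : ∀ y ∈ Ioo (deltaSeq p (k + 1)) (deltaSeq p k), g y = 0 → betaFun p k y = β := by
    intro y hy h0
    obtain ⟨h3, h4⟩ := hbt y hy
    rw [betaFun_eq hp k h3.le, div_eq_iff h4.ne']
    simp only [hg] at h0
    linarith
  obtain ⟨δ, hδ, e1, s1, s2⟩ := exists_zero_of_convexOn_of_neg_of_pos hs.2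
    (hconv.subset (fun y hy => (hd'.trans hs.1).le.trans hy.1) (convex_Icc _ _))
    hcont.continuousOn hM hR
  obtain ⟨δ', hδ', e2, s3, s4⟩ := exists_zero_of_convexOn_of_pos_of_neg hs.1
    (hconv.subset (fun y hy => hd'.le.trans hy.1) (convex_Icc _ _)) hcont.continuousOn hL hM
  exact ⟨δ, δ', hδ, hδ', hroot δ ⟨hs.1.trans hδ.1, hδ.2⟩ e1,
    hroot δ' ⟨hδ'.1, hδ'.2.trans hs.2⟩ e2, s1, s2, s3, s4⟩

/-- v^p is bounded by μ^p while βt is unbounded, so v^p > βt at some time forces a later crossing.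
-/
theorem LogSol.exists_cross_above {p : ℝ} {h : ℝ → ℝ} {lam mu : ℝ} {v w : ℝ → ℝ}
    (S : LogSol p h lam mu v w) (hp : 0 < p) (hH0 : CondH0 h) {β t₀ : ℝ} (hβ : 0 < β)
    (h0 : 0 < t₀) (hlt : β * t₀ < v t₀ ^ p) : ∃ t, t₀ ≤ t ∧ v t ^ p = β * t := by
  have l : Tendsto (fun t : ℝ => β * t) atTop atTop := tendsto_id.const_mul_atTop hβ
  obtain ⟨t₁, h1, h2⟩ := ((l.eventually_gt_atTop (mu ^ p)).and (eventually_ge_atTop t₀)).exists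
  have hv1 : v t₁ ^ p - β * t₁ ≤ 0 := by
    have := Real.rpow_le_rpow (S.pos t₁ (h0.trans_le h2)).le (S.le_top hH0 (h0.trans_le h2)) hp.le
    linarith
  obtain ⟨t, ht, e⟩ := intermediate_value_Icc' (f := fun t => v t ^ p - β * t) h2
    (fun t ht => (((S.hasDerivAt t (h0.trans_le ht.1)).continuousAt.rpow_const (Or.inr hp.le)).sub
      (continuousAt_const.mul continuousAt_id)).continuousWithinAt)
    (show (0 : ℝ) ∈ _ from ⟨hv1, by linarith⟩)
  exact ⟨t, ht.1, by simp only at e; linarith⟩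

theorem LogSol.exists_cross_between {p : ℝ} {h : ℝ → ℝ} {lam mu : ℝ} {v w : ℝ → ℝ}
    (S : LogSol p h lam mu v w) (hp : 0 < p) {β t₁ t₂ : ℝ} (h0 : 0 < t₁) (h12 : t₁ ≤ t₂)
    (hlt : (v t₁ ^ p - β * t₁) * (v t₂ ^ p - β * t₂) < 0) :
    ∃ t ∈ Icc t₁ t₂, v t ^ p = β * t := by
  have hcont : ContinuousOn (fun t => v t ^ p - β * t) (uIcc t₁ t₂) := by
    rw [uIcc_of_le h12]
    exact fun t ht => (((S.hasDerivAt t (h0.trans_le ht.1)).continuousAt.rpow_const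
      (Or.inr hp.le)).sub (continuousAt_const.mul continuousAt_id)).continuousWithinAt
  obtain ⟨t, ht, e⟩ := intermediate_value_uIcc hcont (show (0 : ℝ) ∈ _ by
    rw [mem_uIcc]
    rcases mul_neg_iff.1 hlt with h | h
    · exact Or.inr ⟨h.2.le, h.1.le⟩
    · exact Or.inl ⟨h.1.le, h.2.le⟩)
  rw [uIcc_of_le h12] at ht
  exact ⟨t, ht, by simp only at e; linarith⟩

/-! ### Crossings and later centers in the variable t -/

namespace Family

variable {p : ℝ} {h : ℝ → ℝ} {lam mu : ℕ → ℝ} {v w : ℕ → ℝ → ℝ} {T : ℕ → ℝ → ℝ}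

/-- The rescaled sign of `u - U_β` at a given relative height. -/
theorem tendsto_defect (F : Family p h lam mu v w T) {t : ℕ → ℝ} {y L β : ℝ} (hy : 0 < y)
    (hv : Tendsto (fun n => v n (t n) / mu n) atTop (𝓝 y)) (hpos : ∀ᶠ n in atTop, 0 < t n)
    (hL : Tendsto (fun n => t n / mu n ^ p) atTop (𝓝 L)) :
    Tendsto (fun n => (v n (t n) ^ p - β * t n) / mu n ^ p) atTop (𝓝 (y ^ p - β * L)) := by
  refine ((hv.rpow_const (p := p) (Or.inl hy.ne')).sub (hL.const_mul β)).congr' ?_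
  filter_upwards [hpos] with n hn
  rw [Real.div_rpow ((F.sol n).pos _ hn).le (F.mu_pos n).le]
  ring

theorem tendsto_defect_height (F : Family p h lam mu v w T) {y L β : ℝ} (h0 : 0 < y) (h1 : y < 1)
    (hL : Tendsto (fun n => T n y / mu n ^ p) atTop (𝓝 L)) :
    Tendsto (fun n => (v n (T n y) ^ p - β * T n y) / mu n ^ p) atTop (𝓝 (y ^ p - β * L)) := by
  refine F.tendsto_defect h0 ?_ (Eventually.of_forall fun n => F.time_pos n y h0 h1) hL
  refine tendsto_const_nhds.congr fun n => ?_
  rw [F.height n y h0 h1, mul_div_cancel_right₀ _ (F.mu_pos n).ne']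

theorem eventually_cross_above (F : Family p h lam mu v w T) {t : ℕ → ℝ} {y L β : ℝ} (hy : 0 < y)
    (hβ : 0 < β) (hv : Tendsto (fun n => v n (t n) / mu n) atTop (𝓝 y))
    (hpos : ∀ᶠ n in atTop, 0 < t n)
    (hL : Tendsto (fun n => t n / mu n ^ p) atTop (𝓝 L)) (hlt : 0 < y ^ p - β * L) :
    ∀ᶠ n in atTop, ∃ s, t n ≤ s ∧ v n s ^ p = β * s := by
  filter_upwards [(F.tendsto_defect (β := β) hy hv hpos hL).eventually_const_lt hlt, hpos]
    with n hn h0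
  have hK := Real.rpow_pos_of_pos (F.mu_pos n) p
  rw [lt_div_iff₀ hK, zero_mul, sub_pos] at hn
  exact (F.sol n).exists_cross_above F.p_pos F.condH0 hβ h0 hn

/-- A sign change of `y ^ p - β L(y)` at `δ` produces crossings at relative heights near `δ`. -/
theorem eventually_cross_of_sign (F : Family p h lam mu v w T) {L : ℝ → ℝ} {a b δ β : ℝ}
    (ha : 0 ≤ a) (hb : b ≤ 1) (haδ : a < δ) (hδb : δ < b)
    (hL : ∀ y ∈ Ioo a b, Tendsto (fun n => T n y / mu n ^ p) atTop (𝓝 (L y)))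
    (hsign : ∀ y₁ ∈ Ioo a δ, ∀ y₂ ∈ Ioo δ b, (y₁ ^ p - β * L y₁) * (y₂ ^ p - β * L y₂) < 0)
    {ε : ℝ} (hε : 0 < ε) :
    ∀ᶠ n in atTop, ∃ t, 0 < t ∧ v n t ^ p = β * t ∧ |v n t / mu n - δ| < ε := by
  obtain ⟨y₁, h1, h1'⟩ := exists_between (show max a (δ - ε) < δ from max_lt haδ (by linarith))
  obtain ⟨y₂, h2, h2'⟩ := exists_between (show δ < min b (δ + ε) from lt_min hδb (by linarith))
  have h1a : a < y₁ := (le_max_left _ _).trans_lt h1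
  have h1e : δ - ε < y₁ := (le_max_right _ _).trans_lt h1
  have h2b : y₂ < b := h2'.trans_le (min_le_left _ _)
  have h2e : y₂ < δ + ε := h2'.trans_le (min_le_right _ _)
  have h10 : 0 < y₁ := ha.trans_lt h1a
  have h12 : y₁ < y₂ := h1'.trans h2
  have h21 : y₂ < 1 := h2b.trans_le hb
  have l := (F.tendsto_defect_height (β := β) h10 (h12.trans h21)
    (hL y₁ ⟨h1a, h12.trans h2b⟩)).mul
    (F.tendsto_defect_height (β := β) (h10.trans h12) h21 (hL y₂ ⟨h1a.trans h12, h2b⟩))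
  filter_upwards [l.eventually_lt_const (hsign y₁ ⟨h1a, h1'⟩ y₂ ⟨h2, h2b⟩)] with n hn
  have hmu := F.mu_pos n
  have hK := Real.rpow_pos_of_pos hmu p
  rw [div_mul_div_comm, div_lt_iff₀ (by positivity), zero_mul] at hn
  have hT1 := F.time_pos n y₁ h10 (h12.trans h21)
  have hT12 := F.time_lt n h10 h12 h21
  obtain ⟨t, ht, e⟩ := (F.sol n).exists_cross_between F.p_pos hT1 hT12.le hn
  have ht0 := hT1.trans_le ht.1
  have k1 := (F.sol n).monotoneOn F.condH0 hT1 ht0 ht.1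
  have k2 := (F.sol n).monotoneOn F.condH0 ht0 (ht0.trans_le ht.2) ht.2
  rw [F.height n y₁ h10 (h12.trans h21), ← le_div_iff₀ hmu] at k1
  rw [F.height n y₂ (h10.trans h12) h21, ← div_le_iff₀ hmu] at k2
  exact ⟨t, ht0, e, by rw [abs_lt]; constructor <;> linarith⟩

/-- Near each later bubble there is a point where the slope is critical. -/
theorem eventually_center (F : Family p h lam mu v w T) (hp2 : 2 < p) (k : ℕ) {ε : ℝ}
    (hε : 0 < ε) : ∀ᶠ n in atTop, ∃ t, 0 < t ∧
      |v n t / mu n - deltaSeq p (k + 1)| < ε ∧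
      |potential p h (lam n) (mu n) (v n) t -
        (kap p (deltaSeq p (k + 1)) - bubbleSlope p k) ^ 2 / 2| < ε := by
  set δ := deltaSeq p (k + 1) with hδ
  have hd : 0 < δ := deltaSeq_pos hp2 (k + 1)
  have hκ := kap_pos F.p_pos hd
  set κ := kap p δ with hκdef
  have hη : 0 < ε / (8 * κ) := by positivity
  obtain ⟨ζ, hζ, hball⟩ := Metric.continuousAt_iff.1 (continuousAt_kap (p := p) hd) _ hη
  have hlt1 : deltaSeq p (k + 1 + 1) < δ := deltaSeq_succ_lt hp2 (k + 1)
  have hlt2 : δ < deltaSeq p k := deltaSeq_succ_lt hp2 k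
  have hm : 0 < min ζ ε := lt_min hζ hε
  obtain ⟨y₁, h1, h1'⟩ := exists_between
    (show max (deltaSeq p (k + 1 + 1)) (δ - min ζ ε) < δ from max_lt hlt1 (by linarith))
  obtain ⟨y₂, h2, h2'⟩ := exists_between
    (show δ < min (deltaSeq p k) (δ + min ζ ε) from lt_min hlt2 (by linarith))
  have h1a : deltaSeq p (k + 1 + 1) < y₁ := (le_max_left _ _).trans_lt h1
  have h1e : δ - min ζ ε < y₁ := (le_max_right _ _).trans_lt h1
  have h2b : y₂ < deltaSeq p k := h2'.trans_le (min_le_left _ _)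
  have h2e : y₂ < δ + min ζ ε := h2'.trans_le (min_le_right _ _)
  have h10 : 0 < y₁ := (deltaSeq_pos hp2 _).trans h1a
  have h12 : y₁ < y₂ := h1'.trans h2
  have h21 : y₂ < 1 := h2b.trans_le (deltaSeq_le_one hp2 k)
  have hmζ := min_le_left ζ ε
  have hmε := min_le_right ζ ε
  obtain ⟨-, b1, -⟩ := F.limits_of_two_lt hp2 (k + 1) ⟨h1a, h1'⟩
  obtain ⟨-, b2, p2⟩ := F.limits_of_two_lt hp2 k ⟨h2, h2b⟩
  -- With this tolerance the energy error is at most ε/4, as the slope changes by at most κ between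
  -- t and the upper height.
  have hE := F.eventually_energy (y₁ := y₁) (y₂ := y₂) (κ := κ) (η := ε / (8 * κ))
    (η' := 2 * (ε / (8 * κ))) h10 (by linarith) fun z hz => by
      have := hball (x := z) (by
        rw [Real.dist_eq, abs_lt]; constructor <;> linarith [hz.1, hz.2])
      exact this.le
  have l := (((b2.const_sub κ).pow 2).div_const 2).add p2
  rw [add_zero] at l
  filter_upwards [hE, b1.eventually_const_lt (kap_lt_bubbleSlope hp2 (k + 1)),
    b2.eventually_lt_const (bubbleSlope_lt_kap hp2 k),
    (Metric.tendsto_nhds.1 l) (ε / 2) (half_pos hε)] with n hE hb1 hb2 hl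
  have hmu := F.mu_pos n
  have hT1 := F.time_pos n y₁ h10 (h12.trans h21)
  have hT12 := F.time_lt n h10 h12 h21
  -- The slope passes from above κ (outgoing) to below κ (incoming slope c). Where it equals κ the
  -- energy law gives ψ ≈ (κ - c)²/2.
  obtain ⟨t, ht, e⟩ := intermediate_value_Icc' (f := scaledSlope p (mu n) (w n)) hT12.le
    (fun t ht => ((F.sol n).hasDerivAt_scaledSlope F.p_pos F.condH0
      (hT1.trans_le ht.1)).continuousAt.continuousWithinAt)
    (show κ ∈ _ from ⟨hb2.le, hb1.le⟩)
  have ht0 := hT1.trans_le ht.1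
  have k1 := (F.sol n).monotoneOn F.condH0 hT1 ht0 ht.1
  have k2 := (F.sol n).monotoneOn F.condH0 ht0 (ht0.trans_le ht.2) ht.2
  rw [F.height n y₁ h10 (h12.trans h21)] at k1
  have hE' := hE t (T n y₂) ht0 ht.2 k1 (F.height n y₂ (h10.trans h12) h21).le
  rw [← le_div_iff₀ hmu] at k1
  rw [F.height n y₂ (h10.trans h12) h21, ← div_le_iff₀ hmu] at k2
  refine ⟨t, ht0, by rw [abs_lt]; constructor <;> linarith, ?_⟩
  have hb2' := (F.sol n).scaledSlope_nonneg F.condH0 (ht0.trans_le ht.2)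
  rw [e] at hE'
  have k3 : 2 * (ε / (8 * κ)) * (κ - scaledSlope p (mu n) (w n) (T n y₂)) ≤ ε / 4 := by
    calc _ ≤ 2 * (ε / (8 * κ)) * κ := by gcongr; linarith
      _ = ε / 4 := by field_simp; norm_num
  rw [Real.dist_eq, abs_lt] at hl
  have k4 := abs_le.1 (hE'.trans k3)
  rw [abs_lt]
  constructor <;> nlinarith [hl.1, hl.2, k4.1, k4.2]

end Family

/-! ### Return to the variable r: centers and zero counts -/

theorem phi_eq {p : ℝ} {h : ℝ → ℝ} {lam mu t : ℝ} {u : ℝ → ℝ} (hp : 0 < p) (hmu : 0 < mu)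
    (hu : 0 < u (Real.exp (-t))) : phi p h lam u (Real.exp (-t)) =
      p ^ 2 * ((u (Real.exp (-t)) / mu) ^ (p - 1)) ^ 2 *
        potential p h lam mu (fun t => u (Real.exp (-t))) t := by
  have e2 : Real.exp (-(2 * t)) = Real.exp (-t) ^ 2 := by
    rw [← Real.exp_nat_mul]; push_cast; ring_nf
  have h1 : 0 < mu ^ (p - 1) := by positivity
  have h2 : 0 < u (Real.exp (-t)) ^ (p - 1) := by positivity
  unfold phi potential approxPrim
  rw [Real.div_rpow hu.le hmu.le, e2]
  field_simp

theorem gammaZero_eq {p : ℝ} {h : ℝ → ℝ} {lam mu : ℝ}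
    (hpos : 0 < p * lam * mu ^ (p - 1) * nonlin p h mu) :
    gammaZero p h lam mu = Real.exp (-firstTime p h lam mu) := by
  rw [gammaZero, firstTime, Real.exp_neg, Real.sqrt_eq_rpow, Real.rpow_def_of_pos hpos]
  ring_nf

/-- Translates r_0 = 2√2 γ_0 into t = `firstTime` - (log 8)/2, that is ρ = 8. -/
theorem exp_half_log_eight : Real.exp (Real.log 8 / 2) = 2 * Real.sqrt 2 := by
  rw [show Real.log 8 / 2 = Real.log 8 * (1 / 2) by ring, ← Real.rpow_def_of_pos (by norm_num),
    ← Real.sqrt_eq_rpow, show (8 : ℝ) = 2 ^ 2 * 2 by norm_num,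
    Real.sqrt_mul (by norm_num), Real.sqrt_sq (by norm_num)]

theorem exists_family {p : ℝ} (hp : 0 < p) {h : ℝ → ℝ} (hH0 : CondH0 h) (hH1 : CondH1 p h)
    {lam mu : ℕ → ℝ} {u : ℕ → ℝ → ℝ} (hsol : ∀ n, IsSolution p h (lam n) (mu n) (u n))
    (hmu : Tendsto mu atTop atTop) :
    ∃ w T, Family p h lam mu (fun n t => u n (Real.exp (-t))) w T := by
  have hT : ∀ n : ℕ, ∀ y : ℝ, ∃ t : ℝ, 0 < y → y < 1 →
      0 < t ∧ u n (Real.exp (-t)) = y * mu n := fun n y => by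
    by_cases hy : 0 < y ∧ y < 1
    · obtain ⟨t, h1, h2⟩ := (hsol n).logSol.exists_height hH0 hy
      exact ⟨t, fun _ _ => ⟨h1, h2⟩⟩
    · exact ⟨0, fun h1 h2 => absurd ⟨h1, h2⟩ hy⟩
  choose T hT using hT
  exact ⟨fun n t => -(Real.exp (-t) * deriv (u n) (Real.exp (-t))), T, hp, hH0, hH1,
    fun n => (hsol n).logSol, hmu, fun n y h0 h1 => (hT n y h0 h1).1,
    fun n y h0 h1 => (hT n y h0 h1).2⟩

theorem exp_neg_mem {t : ℝ} (ht : 0 < t) : Real.exp (-t) ∈ Ioo (0 : ℝ) 1 :=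
  ⟨Real.exp_pos _, by rw [Real.exp_lt_one_iff]; linarith⟩

theorem exp_log_neg {r : ℝ} (hr : r ∈ Ioo (0 : ℝ) 1) :
    0 < -Real.log r ∧ Real.exp (- -Real.log r) = r :=
  ⟨by linarith [Real.log_neg hr.1 hr.2], by rw [neg_neg, Real.exp_log hr.1]⟩

namespace Family

variable {p : ℝ} {h : ℝ → ℝ} {lam mu : ℕ → ℝ} {u w : ℕ → ℝ → ℝ} {T : ℕ → ℝ → ℝ}

theorem eventually_first_scale_pos (F : Family p h lam mu (fun n t => u n (Real.exp (-t))) w T) :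
    ∀ᶠ n in atTop, gammaZero p h (lam n) (mu n) = Real.exp (-firstTime p h (lam n) (mu n)) := by
  filter_upwards [F.eventually_top] with n hn
  have := F.mu_pos n
  have := (F.sol n).lam_pos
  have := F.p_pos
  have := hn.1
  exact gammaZero_eq (by positivity)

theorem exists_first_center (F : Family p h lam mu (fun n t => u n (Real.exp (-t))) w T) :
    ∃ r : ℕ → ℝ, (∀ n, r n ∈ Ioo (0 : ℝ) 1) ∧
      Tendsto (fun n => r n / gammaZero p h (lam n) (mu n)) atTop (𝓝 (2 * Real.sqrt 2)) ∧
      Tendsto (fun n => u n (r n) / mu n) atTop (𝓝 1) ∧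
      Tendsto (fun n => phi p h (lam n) (u n) (r n)) atTop (𝓝 2) := by
  classical
  set t : ℕ → ℝ := fun n => firstTime p h (lam n) (mu n) - Real.log 8 / 2 with ht
  -- The value 1/2 only serves the finitely many n for which t n is not positive.
  set r : ℕ → ℝ := fun n => if 0 < t n then Real.exp (-(t n)) else 1 / 2 with hr
  have hpos : ∀ᶠ n in atTop, 0 < t n := by
    filter_upwards [F.tendsto_firstTime_atTop.eventually_gt_atTop (Real.log 8 / 2)] with n hn
    rw [ht]; linarith
  have heq : ∀ᶠ n in atTop, r n = Real.exp (-(t n)) := hpos.mono fun n hn => if_pos hn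
  have hh : Tendsto (fun n => u n (r n) / mu n) atTop (𝓝 1) := by
    refine F.tendsto_height_first.congr' ?_
    filter_upwards [heq] with n hn
    rw [hn]
  refine ⟨r, fun n => ?_, ?_, hh, ?_⟩
  · simp only [hr]
    split_ifs with hn
    · exact exp_neg_mem hn
    · norm_num
  · refine tendsto_const_nhds.congr' ?_
    filter_upwards [heq, F.eventually_first_scale_pos] with n hn hg
    rw [hn, hg, ← Real.exp_sub, ← exp_half_log_eight]
    congr 1
    simp only [ht]
    ring
  · have l := ((hh.rpow_const (p := p - 1) (Or.inl one_ne_zero)).pow 2).mul F.tendsto_potential_first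
    rw [Real.one_rpow, one_pow, one_mul] at l
    refine l.congr' ?_
    filter_upwards [heq, hpos] with n hn h0
    have hu := (F.sol n).pos (t n) h0
    rw [hn, phi_eq F.p_pos (F.mu_pos n) hu]
    simp only [ht]
    ring

theorem exists_later_center (F : Family p h lam mu (fun n t => u n (Real.exp (-t))) w T)
    (hp2 : 2 < p) (k : ℕ) :
    ∃ r : ℕ → ℝ, (∀ n, r n ∈ Ioo (0 : ℝ) 1) ∧
      Tendsto (fun n => u n (r n) / mu n) atTop (𝓝 (deltaSeq p (k + 1))) ∧
      Tendsto (fun n => phi p h (lam n) (u n) (r n)) atTop (𝓝 (aSeq p (k + 1) ^ 2 / 2)) := by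
  have hd := deltaSeq_pos hp2 (k + 1)
  set ψ₀ := (kap p (deltaSeq p (k + 1)) - bubbleSlope p k) ^ 2 / 2 with hψ₀
  -- Adding the two errors lets one diagonal choice achieve both limits.
  set G : ℕ → ℝ → ℝ := fun n t =>
    |u n (Real.exp (-t)) / mu n - deltaSeq p (k + 1)| +
      |potential p h (lam n) (mu n) (fun t => u n (Real.exp (-t))) t - ψ₀| with hG
  obtain ⟨t, ht, -, lim⟩ := exists_seq_tendsto (P := fun _ _ => True) (Q := fun _ t => 0 < t)
    (f := G) (a := 0) (fun _ => ⟨1, one_pos⟩) (fun ε hε => by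
      filter_upwards [F.eventually_center hp2 k (half_pos hε)] with n ⟨t, h0, h1, h2⟩
      refine ⟨t, h0, trivial, ?_⟩
      rw [sub_zero, abs_of_nonneg (by positivity)]
      simp only [hG]
      linarith)
  have l1 : Tendsto (fun n => u n (Real.exp (-(t n))) / mu n) atTop (𝓝 (deltaSeq p (k + 1))) := by
    refine tendsto_iff_dist_tendsto_zero.2 (squeeze_zero (fun _ => dist_nonneg) (fun n => ?_) lim)
    rw [Real.dist_eq]
    simp only [hG]
    linarith [abs_nonneg (potential p h (lam n) (mu n) (fun t => u n (Real.exp (-t))) (t n) - ψ₀)]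
  have l2 : Tendsto (fun n => potential p h (lam n) (mu n) (fun t => u n (Real.exp (-t))) (t n))
      atTop (𝓝 ψ₀) := by
    refine tendsto_iff_dist_tendsto_zero.2 (squeeze_zero (fun _ => dist_nonneg) (fun n => ?_) lim)
    rw [Real.dist_eq]
    simp only [hG]
    linarith [abs_nonneg (u n (Real.exp (-(t n))) / mu n - deltaSeq p (k + 1))]
  refine ⟨fun n => Real.exp (-(t n)), fun n => exp_neg_mem (ht n), l1, ?_⟩
  have l := (((l1.rpow_const (p := p - 1) (Or.inl hd.ne')).pow 2).const_mul (p ^ 2)).mul l2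
  have e : p ^ 2 * (deltaSeq p (k + 1) ^ (p - 1)) ^ 2 * ψ₀ = aSeq p (k + 1) ^ 2 / 2 := by
    have hp := F.p_pos
    have : 0 < deltaSeq p (k + 1) ^ (p - 1) := by positivity
    rw [hψ₀, kap_eq hd, bubbleSlope_eq hp2]
    field_simp
    ring
  rw [e] at l
  refine l.congr fun n => ?_
  rw [phi_eq F.p_pos (F.mu_pos n) ((F.sol n).pos (t n) (ht n))]

theorem exists_centers (F : Family p h lam mu (fun n t => u n (Real.exp (-t))) w T) :
    ∃ r, IsCenters p h lam mu u r := by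
  obtain ⟨r₀, h1, h2, h3, h4⟩ := F.exists_first_center
  have hk : ∀ k : ℕ, ∃ r : ℕ → ℝ, (k = 0 → r = r₀) ∧ (2 < p → 1 ≤ k →
      (∀ n, r n ∈ Ioo (0 : ℝ) 1) ∧
      Tendsto (fun n => u n (r n) / mu n) atTop (𝓝 (deltaSeq p k)) ∧
      Tendsto (fun n => phi p h (lam n) (u n) (r n)) atTop (𝓝 (aSeq p k ^ 2 / 2))) := by
    intro k
    by_cases hc : 2 < p ∧ 1 ≤ k
    · obtain ⟨j, rfl⟩ : ∃ j, k = j + 1 := ⟨k - 1, by omega⟩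
      obtain ⟨r, hr⟩ := F.exists_later_center hc.1 j
      exact ⟨r, fun h0 => absurd h0 j.succ_ne_zero, fun _ _ => hr⟩
    · exact ⟨r₀, fun _ => rfl, fun hp2 h1 => absurd ⟨hp2, h1⟩ hc⟩
  choose r hr0 hr using hk
  have e : r 0 = r₀ := hr0 0 rfl
  rw [← e] at h1 h2 h3 h4
  exact ⟨r, h1, h2, h3, h4, fun hp2 k hk => (hr k hp2 hk).1, fun hp2 k hk => (hr k hp2 hk).2.1,
    fun hp2 k hk => (hr k hp2 hk).2.2⟩

theorem eventually_lt_of_height (F : Family p h lam mu (fun n t => u n (Real.exp (-t))) w T)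
    {r s : ℕ → ℝ} {a b : ℝ} (hr : ∀ n, r n ∈ Ioo (0 : ℝ) 1) (hs : ∀ n, s n ∈ Ioo (0 : ℝ) 1)
    (hra : Tendsto (fun n => u n (r n) / mu n) atTop (𝓝 a))
    (hsb : Tendsto (fun n => u n (s n) / mu n) atTop (𝓝 b)) (hab : b < a) :
    ∀ᶠ n in atTop, r n < s n := by
  filter_upwards [hsb.eventually_lt hra hab] with n hn
  rw [div_lt_div_iff_of_pos_right (F.mu_pos n)] at hn
  obtain ⟨r1, r2⟩ := exp_log_neg (hr n)
  obtain ⟨s1, s2⟩ := exp_log_neg (hs n)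
  have := (F.sol n).lt_of_height_lt F.condH0 s1 r1 (by simp only [r2, s2]; exact hn)
  rw [← Real.log_lt_log_iff (hr n).1 (hs n).1]
  linarith

theorem exists_cross_seq (F : Family p h lam mu (fun n t => u n (Real.exp (-t))) w T) {β δ : ℝ}
    (H : ∀ ε > 0, ∀ᶠ n in atTop, ∃ t, 0 < t ∧ u n (Real.exp (-t)) ^ p = β * t ∧
      |u n (Real.exp (-t)) / mu n - δ| < ε) :
    ∃ s : ℕ → ℝ, (∀ n, s n ∈ Ioo (0 : ℝ) 1) ∧
      Tendsto (fun n => u n (s n) / mu n) atTop (𝓝 δ) ∧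
      ∀ᶠ n in atTop, u n (s n) = curveU p β (s n) := by
  obtain ⟨s, h1, h2, h3⟩ := exists_seq_tendsto (Q := fun _ x => x ∈ Ioo (0 : ℝ) 1)
    (P := fun n x => u n x = curveU p β x) (f := fun n x => u n x / mu n) (a := δ)
    (fun _ => ⟨1 / 2, by norm_num⟩) (fun ε hε => by
      filter_upwards [H ε hε] with n ⟨t, h0, e, hlt⟩
      exact ⟨Real.exp (-t), exp_neg_mem h0, curveU_eq F.p_pos ((F.sol n).pos t h0) e, hlt⟩)
  exact ⟨s, h1, h3, h2⟩

/-- r_0/γ_0 has a finite positive limit, so its logarithm vanishes after division by μ^p. -/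
theorem tendsto_center_time (F : Family p h lam mu (fun n t => u n (Real.exp (-t))) w T)
    {r : ℕ → ℕ → ℝ} (R : IsCenters p h lam mu u r) {L : ℝ}
    (hL : Tendsto (fun n => firstTime p h (lam n) (mu n) / mu n ^ p) atTop (𝓝 L)) :
    Tendsto (fun n => -Real.log (r 0 n) / mu n ^ p) atTop (𝓝 L) := by
  have l1 := (R.first_scale.log (by positivity)).div_atTop F.tendsto_mu_rpow
  have l2 := hL.sub l1
  rw [sub_zero] at l2
  refine l2.congr' ?_
  filter_upwards [F.eventually_first_scale_pos] with n hn
  rw [hn, Real.log_div (R.first_mem n).1.ne' (Real.exp_pos _).ne', Real.log_exp]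
  ring

/-- At the first center y → 1 and t/μ^p tends to p/4 or 1/2; the bound on β makes the defect 1 - βL
positive, and a crossing follows at a larger t, hence a smaller r. -/
theorem eventually_first_zero (F : Family p h lam mu (fun n t => u n (Real.exp (-t))) w T)
    {r : ℕ → ℕ → ℝ} (R : IsCenters p h lam mu u r) {β : ℝ} (hβ : 0 < β)
    (h1 : p ≤ 2 → β < 4 / p) (h2 : 2 < p → β < 2) :
    ∀ᶠ n in atTop, 1 ≤ zeroCount (Ioc 0 (r 0 n)) (fun x => u n x - curveU p β x) := by
  have hp := F.p_pos
  obtain ⟨L, hL, hlt⟩ : ∃ L, Tendsto (fun n => firstTime p h (lam n) (mu n) / mu n ^ p) atTop (𝓝 L)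
      ∧ β * L < 1 := by
    rcases le_or_gt p 2 with hp2 | hp2
    · refine ⟨_, F.firstTime_of_le_two hp2, ?_⟩
      have := h1 hp2
      rw [lt_div_iff₀ hp] at this
      linarith
    · exact ⟨_, F.firstTime_of_two_lt hp2, by linarith [h2 hp2]⟩
  have hl := fun n => exp_log_neg (R.first_mem n)
  filter_upwards [F.eventually_cross_above (t := fun n => -Real.log (r 0 n)) (y := 1) one_pos hβ
    (by simp only [(hl _).2]; exact R.first_height) (Eventually.of_forall fun n => (hl n).1)
    (F.tendsto_center_time R hL) (by rw [Real.one_rpow]; linarith)] with n ⟨s, hs, e⟩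
  have hs0 := (hl n).1.trans_le hs
  refine one_le_zeroCount (z := Real.exp (-s)) (Real.exp_pos _) ?_
    (sub_eq_zero.2 (curveU_eq hp ((F.sol n).pos s hs0) e))
  rw [← (hl n).2]
  exact Real.exp_le_exp.2 (by linarith)

theorem four_mul_rpow_div {p β : ℝ} (hp : 0 < p) (hp1 : p ≠ 1) (hβ : 0 < β) :
    4 * ((p * β / 4) ^ (1 / (p - 1))) ^ (p - 1) / p = β := by
  rw [← Real.rpow_mul (by positivity), one_div_mul_cancel (sub_ne_zero.2 hp1), Real.rpow_one]
  field_simp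

theorem defect_eq {p β δ y : ℝ} (hp : 0 < p) (hy : 0 < y) (hδ : 4 * δ ^ (p - 1) / p = β) :
    y ^ p - β * (p / 4 * y) = y * (y ^ (p - 1) - δ ^ (p - 1)) := by
  rw [← rpow_sub_one_mul_self hy, ← hδ]
  field_simp

theorem crossings_of_lt_one (F : Family p h lam mu (fun n t => u n (Real.exp (-t))) w T)
    (hp1 : p < 1) {β : ℝ} (hβ : 4 / p ≤ β) :
    ∃ δ ∈ Ioc (0 : ℝ) 1, 4 * δ ^ (p - 1) / p = β ∧ ∃ s : ℕ → ℝ, (∀ n, s n ∈ Ioo (0 : ℝ) 1) ∧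
      Tendsto (fun n => u n (s n) / mu n) atTop (𝓝 δ) ∧
      ∀ᶠ n in atTop, u n (s n) = curveU p β (s n) := by
  have hp := F.p_pos
  have hβ0 : 0 < β := lt_of_lt_of_le (by positivity) hβ
  rw [div_le_iff₀ hp] at hβ
  have e := four_mul_rpow_div hp hp1.ne hβ0
  set δ := (p * β / 4) ^ (1 / (p - 1)) with hδ
  have hδ0 : 0 < δ := by positivity
  have hδ1 : δ ≤ 1 := Real.rpow_le_one_of_one_le_of_nonpos (by linarith)
    (one_div_nonpos.2 (by linarith))
  refine ⟨δ, ⟨hδ0, hδ1⟩, e, F.exists_cross_seq fun ε hε => ?_⟩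
  have hleft : ∀ y ∈ Ioo 0 δ, 0 < y ^ p - β * (p / 4 * y) := fun y hy => by
    rw [defect_eq hp hy.1 e]
    exact mul_pos hy.1 (sub_pos.2 (Real.rpow_lt_rpow_of_neg hy.1 hy.2 (by linarith)))
  -- When β = 4/p the root is δ = 1 and there is no height above it to show a sign change; the
  -- crossing comes instead from the growth of βt, and v ≤ μ keeps it near relative height 1.
  rcases hδ1.eq_or_lt with h1 | h1
  · obtain ⟨y, hy, hy1⟩ := exists_between (show max 0 (1 - ε) < 1 from max_lt one_pos (by linarith))
    have hy0 : 0 < y := (le_max_left _ _).trans_lt hy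
    have hyε : 1 - ε < y := (le_max_right _ _).trans_lt hy
    have hht : ∀ n, u n (Real.exp (-(T n y))) = y * mu n := fun n => F.height n y hy0 hy1
    filter_upwards [F.eventually_cross_above (t := fun n => T n y) hy0 hβ0
      (tendsto_const_nhds.congr fun n => by
        rw [hht n, mul_div_cancel_right₀ _ (F.mu_pos n).ne'])
      (Eventually.of_forall fun n => F.time_pos n y hy0 hy1)
      (F.time_of_le_two (by linarith) hy0 hy1) (hleft y ⟨hy0, by rwa [h1]⟩)] with n ⟨s, hs, es⟩
    have hT := F.time_pos n y hy0 hy1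
    have hs0 := hT.trans_le hs
    have hmu := F.mu_pos n
    have k1 := (F.sol n).monotoneOn F.condH0 hT hs0 hs
    have k2 := (F.sol n).le_top F.condH0 hs0
    simp only [hht n] at k1
    rw [← le_div_iff₀ hmu] at k1
    rw [← div_le_one hmu] at k2
    exact ⟨s, hs0, es, by rw [h1, abs_lt]; constructor <;> linarith⟩
  · refine F.eventually_cross_of_sign (L := fun y => p / 4 * y) le_rfl le_rfl hδ0 h1
      (fun y hy => F.time_of_le_two (by linarith) hy.1 hy.2) (fun y₁ hy₁ y₂ hy₂ => ?_) hε
    refine mul_neg_of_pos_of_neg (hleft y₁ hy₁) ?_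
    have hy0 := hδ0.trans hy₂.1
    rw [defect_eq hp hy0 e]
    exact mul_neg_of_pos_of_neg hy0
      (sub_neg.2 (Real.rpow_lt_rpow_of_neg hδ0 hy₂.1 (by linarith)))

theorem crossings_of_one_lt (F : Family p h lam mu (fun n t => u n (Real.exp (-t))) w T)
    (hp1 : 1 < p) (hp2 : p ≤ 2) {β : ℝ} (hβ0 : 0 < β) (hβ : β < 4 / p) :
    ∃ δ ∈ Ioo (0 : ℝ) 1, 4 * δ ^ (p - 1) / p = β ∧ ∃ s : ℕ → ℝ, (∀ n, s n ∈ Ioo (0 : ℝ) 1) ∧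
      Tendsto (fun n => u n (s n) / mu n) atTop (𝓝 δ) ∧
      ∀ᶠ n in atTop, u n (s n) = curveU p β (s n) := by
  have hp := F.p_pos
  rw [lt_div_iff₀ hp] at hβ
  have e := four_mul_rpow_div hp hp1.ne' hβ0
  set δ := (p * β / 4) ^ (1 / (p - 1)) with hδ
  have hδ0 : 0 < δ := by positivity
  have hδ1 : δ < 1 := Real.rpow_lt_one (by positivity) (by linarith)
    (one_div_pos.2 (by linarith))
  refine ⟨δ, ⟨hδ0, hδ1⟩, e, F.exists_cross_seq fun ε hε => ?_⟩
  refine F.eventually_cross_of_sign (L := fun y => p / 4 * y) le_rfl le_rfl hδ0 hδ1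
    (fun y hy => F.time_of_le_two hp2 hy.1 hy.2) (fun y₁ hy₁ y₂ hy₂ => ?_) hε
  have hy0 := hδ0.trans hy₂.1
  rw [defect_eq hp hy₁.1 e, defect_eq hp hy0 e]
  exact mul_neg_of_neg_of_pos
    (mul_neg_of_pos_of_neg hy₁.1
      (sub_neg.2 (Real.rpow_lt_rpow hy₁.1.le hy₁.2 (by linarith))))
    (mul_pos hy0 (sub_pos.2 (Real.rpow_lt_rpow hδ0.le hy₂.1 (by linarith))))

theorem crossings_of_two_lt (F : Family p h lam mu (fun n t => u n (Real.exp (-t))) w T)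
    (hp2 : 2 < p) {r : ℕ → ℕ → ℝ} (R : IsCenters p h lam mu u r) (k : ℕ) {β : ℝ}
    (hβ : betaStar p k < β) (hβ2 : β < 2) :
    ∃ δ δ' : ℝ, δ ∈ Ioo (deltaStar p k) (deltaSeq p k) ∧
      δ' ∈ Ioo (deltaSeq p (k + 1)) (deltaStar p k) ∧
      betaFun p k δ = β ∧ betaFun p k δ' = β ∧
      ∃ s s' : ℕ → ℝ, (∀ n, s n ∈ Ioo (0 : ℝ) 1) ∧ (∀ n, s' n ∈ Ioo (0 : ℝ) 1) ∧
        (∀ᶠ n in atTop, s n ∈ Ioo (r k n) (r (k + 1) n)) ∧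
        (∀ᶠ n in atTop, s' n ∈ Ioo (r k n) (r (k + 1) n)) ∧
        Tendsto (fun n => u n (s n) / mu n) atTop (𝓝 δ) ∧
        Tendsto (fun n => u n (s' n) / mu n) atTop (𝓝 δ') ∧
        (∀ᶠ n in atTop, u n (s n) = curveU p β (s n)) ∧
        (∀ᶠ n in atTop, u n (s' n) = curveU p β (s' n)) ∧ ∀ᶠ n in atTop, s n < s' n := by
  obtain ⟨δ, δ', hδ, hδ', e, e', s1, s2, s3, s4⟩ := bubble_roots hp2 k hβ hβ2
  have hs := deltaStar_mem hp2 k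
  have hd' := deltaSeq_pos hp2 (k + 1)
  have hmem : ∀ j n, r j n ∈ Ioo (0 : ℝ) 1 := fun j n => by
    rcases j.eq_zero_or_pos with rfl | hj
    · exact R.first_mem n
    · exact R.mem hp2 j hj n
  have hht : ∀ j, Tendsto (fun n => u n (r j n) / mu n) atTop (𝓝 (deltaSeq p j)) := fun j => by
    rcases j.eq_zero_or_pos with rfl | hj
    · exact R.first_height
    · exact R.height hp2 j hj
  obtain ⟨s, m, l, c⟩ := F.exists_cross_seq (β := β) (δ := δ) fun ε hε =>
    F.eventually_cross_of_sign (L := fun y => bubbleTime p k y / 2) (hd'.trans hs.1).le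
      (deltaSeq_le_one hp2 k) hδ.1 hδ.2
      (fun y hy => F.time_of_two_lt hp2 k ⟨hs.1.trans hy.1, hy.2⟩)
      (fun y₁ hy₁ y₂ hy₂ => mul_neg_of_neg_of_pos (s1 y₁ hy₁) (s2 y₂ hy₂)) hε
  obtain ⟨s', m', l', c'⟩ := F.exists_cross_seq (β := β) (δ := δ') fun ε hε =>
    F.eventually_cross_of_sign (L := fun y => bubbleTime p k y / 2) hd'.le
      (hs.2.le.trans (deltaSeq_le_one hp2 k)) hδ'.1 hδ'.2
      (fun y hy => F.time_of_two_lt hp2 k ⟨hy.1, hy.2.trans hs.2⟩)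
      (fun y₁ hy₁ y₂ hy₂ => mul_neg_of_pos_of_neg (s3 y₁ hy₁) (s4 y₂ hy₂)) hε
  refine ⟨δ, δ', hδ, hδ', e, e', s, s', m, m', ?_, ?_, l, l', c, c',
    F.eventually_lt_of_height m m' l l' (hδ'.2.trans hδ.1)⟩
  · exact (F.eventually_lt_of_height (hmem k) m (hht k) l hδ.2).and
      (F.eventually_lt_of_height m (hmem (k + 1)) l (hht (k + 1)) (hs.1.trans hδ.1))
  · exact (F.eventually_lt_of_height (hmem k) m' (hht k) l' (hδ'.2.trans hs.2)).and
      (F.eventually_lt_of_height m' (hmem (k + 1)) l' (hht (k + 1)) hδ'.1)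

theorem zeroCount_add_two_le {g : ℝ → ℝ} {a s s' : ℝ} (h0 : 0 < s) (h1 : a < s) (h2 : s < s')
    (hs : g s = 0) (hs' : g s' = 0) :
    zeroCount (Ioc 0 a) g + 2 ≤ zeroCount (Ioc 0 s') g := by
  have k1 := zeroCount_add_one_le h1 h0 hs
  have k2 := zeroCount_add_one_le h2 (h0.trans h2) hs'
  calc zeroCount (Ioc 0 a) g + 2 = zeroCount (Ioc 0 a) g + 1 + 1 := by
        rw [add_assoc]; norm_num
    _ ≤ zeroCount (Ioc 0 s) g + 1 := by gcongr
    _ ≤ _ := k2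

/-- Each interval between consecutive centers contributes two crossings, at distinct limiting
heights, on top of the zero before the first center. -/
theorem eventually_le_zeroCount (F : Family p h lam mu (fun n t => u n (Real.exp (-t))) w T)
    (hp2 : 2 < p) {r : ℕ → ℕ → ℝ} (R : IsCenters p h lam mu u r) {β : ℝ} (hβ0 : 0 < β)
    (hβ2 : β < 2) (k : ℕ) (hβ : ∀ j < k, betaStar p j < β) :
    ∀ᶠ n in atTop, ((1 + 2 * k : ℕ) : ℕ∞) ≤
      zeroCount (Ioc 0 (r k n)) (fun x => u n x - curveU p β x) := by
  induction k with
  | zero =>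
    simpa using F.eventually_first_zero R hβ0 (fun h => absurd h (not_le.2 hp2)) fun _ => hβ2
  | succ k ih =>
    obtain ⟨δ, δ', -, -, -, -, s, s', m, -, i, i', -, -, c, c', o⟩ :=
      F.crossings_of_two_lt hp2 R k (hβ k k.lt_succ_self) hβ2
    filter_upwards [ih fun j hj => hβ j (hj.trans k.lt_succ_self), i, i', c, c', o]
      with n h1 h2 h3 h4 h5 h6
    have h7 := zeroCount_add_two_le (g := fun x => u n x - curveU p β x) (m n).1 h2.1 h6
      (sub_eq_zero.2 h4) (sub_eq_zero.2 h5)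
    calc ((1 + 2 * (k + 1) : ℕ) : ℕ∞) = ((1 + 2 * k : ℕ) : ℕ∞) + 2 := by push_cast; ring
      _ ≤ zeroCount (Ioc 0 (r k n)) (fun x => u n x - curveU p β x) + 2 := by gcongr
      _ ≤ _ := h7
      _ ≤ _ := zeroCount_mono h3.2.le

end Family

/-! ### Assembly -/

theorem betaStar_pos {p : ℝ} (hp : 2 < p) (k : ℕ) : 0 < betaStar p k := by
  have ha := aSeq_mem hp k
  have hα : 0 < 1 - aSeq p k / (2 * (p - 1)) := by
    rw [sub_pos, div_lt_one (by linarith)]; linarith [ha.2]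
  have := ha.1
  rw [betaStar_eq hp]
  positivity

end RadialExp

theorem corollary4p2 (p : ℝ) (hp : 0 < p) (h : ℝ → ℝ)
    (hH0 : RadialExp.CondH0 h) (hH1 : RadialExp.CondH1 p h)
    (lam mu : ℕ → ℝ) (u : ℕ → ℝ → ℝ)
    (hsol : ∀ n, RadialExp.IsSolution p h (lam n) (mu n) (u n))
    (hmu : Tendsto mu atTop atTop) :
    ∃ φ : ℕ → ℕ, StrictMono φ ∧
      -- the centers exist along the subsequence,
      (∃ r : ℕ → ℕ → ℝ, RadialExp.IsCenters p h (lam ∘ φ) (mu ∘ φ) (u ∘ φ) r) ∧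
      -- and for every choice of the centers the following holds
      ∀ r : ℕ → ℕ → ℝ, RadialExp.IsCenters p h (lam ∘ φ) (mu ∘ φ) (u ∘ φ) r →
        (∀ β : ℝ, 0 < β → (p ≤ 2 → β < 4 / p) → (2 < p → β < 2) →
          ∀ᶠ n in atTop, 1 ≤ RadialExp.zeroCount (Ioc 0 (r 0 n))
            (fun x => u (φ n) x - RadialExp.curveU p β x)) ∧
        (p < 1 → ∀ β : ℝ, 4 / p ≤ β →
          ∃ δ ∈ Ioc (0 : ℝ) 1, 4 * δ ^ (p - 1) / p = β ∧
            ∃ s : ℕ → ℝ, (∀ n, s n ∈ Ioo (0 : ℝ) 1) ∧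
              Tendsto (fun n => u (φ n) (s n) / mu (φ n)) atTop (𝓝 δ) ∧
              (∀ᶠ n in atTop, u (φ n) (s n) = RadialExp.curveU p β (s n)) ∧
              (∀ᶠ n in atTop, 1 ≤ RadialExp.zeroCount (Ioc 0 (s n))
                (fun x => u (φ n) x - RadialExp.curveU p β x))) ∧
        (1 < p → p ≤ 2 → ∀ β : ℝ, 0 < β → β < 4 / p →
          ∃ δ ∈ Ioo (0 : ℝ) 1, 4 * δ ^ (p - 1) / p = β ∧
            ∃ s : ℕ → ℝ, (∀ n, s n ∈ Ioo (r 0 n) 1) ∧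
              Tendsto (fun n => u (φ n) (s n) / mu (φ n)) atTop (𝓝 δ) ∧
              (∀ᶠ n in atTop, u (φ n) (s n) = RadialExp.curveU p β (s n)) ∧
              (∀ᶠ n in atTop, 2 ≤ RadialExp.zeroCount (Ioc 0 (s n))
                (fun x => u (φ n) x - RadialExp.curveU p β x))) ∧
        (2 < p → ∀ k : ℕ, ∀ β : ℝ, RadialExp.betaStar p k < β → β < 2 →
          ∃ δ δ' : ℝ,
            δ ∈ Ioo (RadialExp.deltaStar p k) (RadialExp.deltaSeq p k) ∧
            δ' ∈ Ioo (RadialExp.deltaSeq p (k + 1)) (RadialExp.deltaStar p k) ∧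
            RadialExp.betaFun p k δ = β ∧ RadialExp.betaFun p k δ' = β ∧
            ∃ s s' : ℕ → ℝ,
              (∀ n, s n ∈ Ioo (0 : ℝ) 1) ∧ (∀ n, s' n ∈ Ioo (0 : ℝ) 1) ∧
              (∀ᶠ n in atTop, s n ∈ Ioo (r k n) (r (k + 1) n)) ∧
              (∀ᶠ n in atTop, s' n ∈ Ioo (r k n) (r (k + 1) n)) ∧
              Tendsto (fun n => u (φ n) (s n) / mu (φ n)) atTop (𝓝 δ) ∧
              Tendsto (fun n => u (φ n) (s' n) / mu (φ n)) atTop (𝓝 δ') ∧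
              (∀ᶠ n in atTop, u (φ n) (s n) = RadialExp.curveU p β (s n)) ∧
              (∀ᶠ n in atTop, u (φ n) (s' n) = RadialExp.curveU p β (s' n)) ∧
              (∀ᶠ n in atTop, ((1 + 2 * (k + 1) : ℕ) : ℕ∞) ≤
                RadialExp.zeroCount (Ioc 0 (s' n))
                  (fun x => u (φ n) x - RadialExp.curveU p β x))) := by
  obtain ⟨w, T, F⟩ := RadialExp.exists_family hp hH0 hH1 hsol hmu
  -- All limits are independent of the ultrafilter, so the whole sequence already works.
  refine ⟨id, strictMono_id, F.exists_centers, fun r R => ?_⟩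
  change RadialExp.IsCenters p h lam mu u r at R
  refine ⟨fun β hβ h1 h2 => F.eventually_first_zero R hβ h1 h2, fun hp1 β hβ => ?_,
    fun hp1 hp2 β hβ0 hβ => ?_, fun hp2 k β hβ hβ2 => ?_⟩
  · obtain ⟨δ, hδ, e, s, m, l, c⟩ := F.crossings_of_lt_one hp1 hβ
    refine ⟨δ, hδ, e, s, m, l, c, ?_⟩
    filter_upwards [c] with n hn
    exact RadialExp.one_le_zeroCount (m n).1 le_rfl (sub_eq_zero.2 hn)
  · obtain ⟨δ, hδ, e, s, m, l, c⟩ := F.crossings_of_one_lt hp1 hp2 hβ0 hβ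
    have hlt := F.eventually_lt_of_height R.first_mem m R.first_height l hδ.2
    -- Finitely many terms are replaced by a midpoint, since s n > r_{0,n} is wanted for every n.
    set s' : ℕ → ℝ := fun n => if r 0 n < s n then s n else (r 0 n + 1) / 2 with hs'
    have heq : ∀ᶠ n in atTop, s' n = s n := hlt.mono fun n hn => if_pos hn
    refine ⟨δ, hδ, e, s', fun n => ?_, ?_, ?_, ?_⟩
    · simp only [hs']
      split_ifs with hn
      · exact ⟨hn, (m n).2⟩
      · have := (R.first_mem n).2
        constructor <;> linarith
    · refine l.congr' ?_
      filter_upwards [heq] with n hn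
      simp only [id, hn]
    · filter_upwards [heq, c] with n hn hc
      rw [hn]
      exact hc
    · filter_upwards [heq, c, hlt, F.eventually_first_zero R hβ0 (fun _ => hβ)
        (fun h => absurd hp2 (not_le.2 h))] with n hn hc hl h1
      rw [hn]
      have h2 := RadialExp.zeroCount_add_one_le (g := fun x => u n x - RadialExp.curveU p β x) hl
        (m n).1 (sub_eq_zero.2 hc)
      calc (2 : ℕ∞) = 1 + 1 := by norm_num
        _ ≤ _ + 1 := by gcongr
        _ ≤ _ := h2
  · obtain ⟨δ, δ', hδ, hδ', e, e', s, s', m, m', i, i', l, l', c, c', o⟩ :=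
      F.crossings_of_two_lt hp2 R k hβ hβ2
    refine ⟨δ, δ', hδ, hδ', e, e', s, s', m, m', i, i', l, l', c, c', ?_⟩
    -- Monotonicity of β_j^* gives β > β_j^* for all j < k, hence 1 + 2k zeros up to r_{k,n}; s and
    -- s' add two more.
    filter_upwards [F.eventually_le_zeroCount hp2 R ((RadialExp.betaStar_pos hp2 k).trans hβ) hβ2 k
      (fun j hj => (RadialExp.betaStar_mono hp2 hj.le).trans_lt hβ), i, c, c', o]
      with n h1 h2 h4 h5 h6
    have h7 := RadialExp.Family.zeroCount_add_two_le
      (g := fun x => u n x - RadialExp.curveU p β x) (m n).1 h2.1 h6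
      (sub_eq_zero.2 h4) (sub_eq_zero.2 h5)
    calc ((1 + 2 * (k + 1) : ℕ) : ℕ∞) = ((1 + 2 * k : ℕ) : ℕ∞) + 2 := by push_cast; ring
      _ ≤ _ + 2 := by gcongr
      _ ≤ _ := h7
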